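/- Let $M$ be a smooth second countable $n$-dimensional Riemannian manifold, complete for its Riemannian distance. A closed convex cone is a nonempty closed set $K$ in a finite-dimensional real vector space with $K+K\subset K$, $\alpha K\subset K$ for all $\alpha\ge 0$ and $K\cap(-K)=\{0\}$. Let $C_M$ be a continuous solid cone field on $M$: each $C_M(x)\subset T_xM$ is a closed convex cone with nonempty interior and, for every $x\in M$ and every smooth chart $\Phi$ at $x$, the cones $C_M^\Phi(y)=d\Phi(y)\,C_M(y)\subset\mathbb R^n$ satisfy: (upper semicontinuity) if $K'\subset\mathbb R^n$ is a closed convex cone with $C_M^\Phi(x)\setminus\{0\}\subset\operatorname{Int}K'$, then $C_M^\Phi(y)\subset K'$ for all $y$ near $x$; (lower semicontinuity) if $N\subset\mathbb R^n$ is open and meets $C_M^\Phi(x)$, then $N$ meets $C_M^\Phi(y)$ for all $y$ near $x$. Write $x\le_M y$ (resp. $x\ll_M y$) if there is a continuous, piecewise smooth curve $\gamma:[t_0,t_1]\to M$, $t_0<t_1$, from $x$ to $y$ with $\gamma'(t)\in C_M(\gamma(t))$ (resp. $\gamma'(t)\in\operatorname{Int}C_M(\gamma(t))$) for all $t_0\le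 t<t_1$, where $\gamma'$ is the right-hand derivative at the break points. Let $f$ be a smooth vector field on $M$ whose integral curves $t\mapsto\varphi_t(x)$, $\varphi_0(x)=x$, exist for all $t\ge 0$, and assume that each forward orbit $\{\varphi_t(x):t\ge0\}$ has compact closure. Assume that the system is strongly differentially positive: $d\varphi_t(x)\big(C_M(x)\setminus\{0\}\big)\subset\operatorname{Int}C_M(\varphi_t(x))$ for all $x\in M$ and $t>0$. Assume moreover: (H1) $\le_M$ is a partial order, and every point has a basis of order convex neighbourhoods (a set $U$ is order convex if $p,q\in U$ and $p\le_M y\le_M q$ imply $y\in U$); (H2) $\le_M$ is quasi-closed: if $x_k\to x$, $y_k\to y$ and $x_k\ll_M y_k$ for all $k$, then $x\le_M y$; (H3) there are linear isomorphisms $\Gamma(x_1,x_2):T_{x_1}M\to T_{x_2}M$ for all $x_1,x_2\in M$, depending continuously on $(x_1,x_2)$, with $\Gamma(x,x)=\mathrm{Id}$, $\Gamma(x_1,x_2)C_M(x_1)=C_M(x_2)$ and $(\Gamma(x_1,x_2)u,\Gamma(x_1,x_2)v)_{x_2}=(u,v)_{x_1}$ for all $u,v\in T_{x_1}M$. Let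 $C$ be the set of convergent points, i.e. of those $x\in M$ whose $\omega$-limit set $\omega(x)=\bigcap_{s\ge0}\overline{\{\varphi_t(x):t\ge s\}}$ consists of a single equilibrium. Then $D=M\setminus C$ has measure zero in $M$: for every smooth chart $(U,\Phi)$ of $M$, the set $\Phi(D\cap U)\subset\mathbb R^n$ has $n$-dimensional Lebesgue measure zero. -/

import Mathlib

open Set Filter MeasureTheory Bundle
open scoped Manifold ContDiff Topology

noncomputable section

namespace ConalFlow

/-! ### Closed convex cones -/

/-- A closed convex cone of a real topological vector space: a nonempty closed set that is stable
under sums and under multiplication by nonnegative scalars, and that contains no line. -/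
structure IsClosedConvexCone {V : Type*} [AddCommGroup V] [Module ℝ V] [TopologicalSpace V]
    (K : Set V) : Prop where
  nonempty : K.Nonempty
  isClosed : IsClosed K
  add_mem : ∀ u ∈ K, ∀ v ∈ K, u + v ∈ K
  smul_mem : ∀ a : ℝ, 0 ≤ a → ∀ v ∈ K, a • v ∈ K
  inter_neg : K ∩ {v | -v ∈ K} = {0}

/-- `K'` surrounds `K` if `K \ {0}` is contained in the interior of `K'`. -/
def Surrounds {V : Type*} [AddCommGroup V] [TopologicalSpace V] (K' K : Set V) : Prop :=
  K \ {0} ⊆ interior K'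

/-! ### Cone fields -/

section ConeField

variable {n : ℕ} {M : Type*} [TopologicalSpace M] [ChartedSpace (EuclideanSpace ℝ (Fin n)) M]

/-- A solid cone field: each `C x` is a closed convex cone of `T_x M` with nonempty interior. -/
def IsSolidConeField (C : ∀ x : M, Set (TangentSpace (𝓡 n) x)) : Prop :=
  ∀ x, IsClosedConvexCone (C x) ∧ (interior (C x)).Nonempty

/-- The cone `dΦ(y)(C y) ⊆ ℝⁿ` representing the cone field at `y` in the chart `Φ`. -/
def coneInChart (C : ∀ x : M, Set (TangentSpace (𝓡 n) x))
    (Φ : OpenPartialHomeomorph M (EuclideanSpace ℝ (Fin n))) (y : M) :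
    Set (EuclideanSpace ℝ (Fin n)) :=
  (fun v : TangentSpace (𝓡 n) y ↦ mfderiv (𝓡 n) (𝓡 n) Φ y v) '' C y

/-- Upper semicontinuity of a cone field at `x`. -/
def ConeUpperSemicontinuousAt (C : ∀ x : M, Set (TangentSpace (𝓡 n) x)) (x : M) : Prop :=
  ∀ Φ ∈ IsManifold.maximalAtlas (𝓡 n) ∞ M, x ∈ Φ.source →
    ∀ K' : Set (EuclideanSpace ℝ (Fin n)), IsClosedConvexCone K' →
      Surrounds K' (coneInChart C Φ x) → ∀ᶠ y in 𝓝 x, coneInChart C Φ y ⊆ K'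

/-- Lower semicontinuity of a cone field at `x`. -/
def ConeLowerSemicontinuousAt (C : ∀ x : M, Set (TangentSpace (𝓡 n) x)) (x : M) : Prop :=
  ∀ Φ ∈ IsManifold.maximalAtlas (𝓡 n) ∞ M, x ∈ Φ.source →
    ∀ N : Set (EuclideanSpace ℝ (Fin n)), IsOpen N →
      (N ∩ coneInChart C Φ x).Nonempty → ∀ᶠ y in 𝓝 x, (N ∩ coneInChart C Φ y).Nonempty

/-- Continuity of a cone field. -/
def IsContinuousConeField (C : ∀ x : M, Set (TangentSpace (𝓡 n) x)) : Prop :=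
  ∀ x, ConeUpperSemicontinuousAt C x ∧ ConeLowerSemicontinuousAt C x

/-! ### Conal curves and the conal order -/

variable (n) in
/-- The right-hand velocity of a curve; it is the velocity where the curve is differentiable. -/
def rightVelocity (γ : ℝ → M) (t : ℝ) : TangentSpace (𝓡 n) (γ t) :=
  mfderivWithin 𝓘(ℝ, ℝ) (𝓡 n) γ (Ici t) t (1 : ℝ)

variable (n) in
/-- `γ` is continuous and piecewise smooth on `[a, b]`: there is a subdivision
`a = s 0 ≤ s 1 ≤ … ≤ s k = b` such that `γ` is smooth, up to the end points, on each
`[s i, s (i + 1)]`. Values of `γ` outside `[a, b]` are irrelevant. -/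
def IsPiecewiseSmoothOn (γ : ℝ → M) (a b : ℝ) : Prop :=
  ContinuousOn γ (Icc a b) ∧
    ∃ (k : ℕ) (s : ℕ → ℝ), Monotone s ∧ s 0 = a ∧ s k = b ∧
      ∀ i < k, ContMDiffOn 𝓘(ℝ, ℝ) (𝓡 n) ∞ γ (Icc (s i) (s (i + 1)))

/-- `γ` is a conal curve on `[a, b]`. -/
def IsConalCurve (C : ∀ x : M, Set (TangentSpace (𝓡 n) x)) (γ : ℝ → M) (a b : ℝ) : Prop :=
  IsPiecewiseSmoothOn n γ a b ∧ ∀ t ∈ Ico a b, rightVelocity n γ t ∈ C (γ t)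

/-- `γ` is a strictly conal curve on `[a, b]`. -/
def IsStrictlyConalCurve (C : ∀ x : M, Set (TangentSpace (𝓡 n) x)) (γ : ℝ → M) (a b : ℝ) : Prop :=
  IsPiecewiseSmoothOn n γ a b ∧ ∀ t ∈ Ico a b, rightVelocity n γ t ∈ interior (C (γ t))

/-- The conal order `x ≤_M y`. -/
def ConalLE (C : ∀ x : M, Set (TangentSpace (𝓡 n) x)) (x y : M) : Prop :=
  ∃ (γ : ℝ → M) (a b : ℝ), a < b ∧ IsConalCurve C γ a b ∧ γ a = x ∧ γ b = y

/-- The strict conal relation `x ≪_M y`. -/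
def ConalLL (C : ∀ x : M, Set (TangentSpace (𝓡 n) x)) (x y : M) : Prop :=
  ∃ (γ : ℝ → M) (a b : ℝ), a < b ∧ IsStrictlyConalCurve C γ a b ∧ γ a = x ∧ γ b = y

/-- The conal order is antisymmetric (it is always reflexive and transitive), and each point has
a basis of order convex neighbourhoods. -/
def IsGloballyOrderable (C : ∀ x : M, Set (TangentSpace (𝓡 n) x)) : Prop :=
  (∀ x y : M, ConalLE C x y → ConalLE C y x → x = y) ∧
    ∀ x : M, ∀ V ∈ 𝓝 x, ∃ U ∈ 𝓝 x, U ⊆ V ∧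
      ∀ p ∈ U, ∀ q ∈ U, {y | ConalLE C p y ∧ ConalLE C y q} ⊆ U

/-- The conal order is quasi-closed. -/
def IsQuasiClosed (C : ∀ x : M, Set (TangentSpace (𝓡 n) x)) : Prop :=
  ∀ (x y : M) (u v : ℕ → M), Tendsto u atTop (𝓝 x) → Tendsto v atTop (𝓝 y) →
    (∀ k, ConalLL C (u k) (v k)) → ConalLE C x y

/-- Both the cone field and the Riemannian metric are invariant under one family of linear
isomorphisms `Γ x₁ x₂ : T_{x₁} M → T_{x₂} M` that depends continuously on `(x₁, x₂)` and
satisfies `Γ x x = Id`. Continuity is that of `((x₁, v), x₂) ↦ (x₂, Γ x₁ x₂ v)`, as a map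
`TM × M → TM`; as the fibres are finite-dimensional and the maps linear, this is continuity of
the matrices of `Γ x₁ x₂` in local frames. -/
def IsGammaInvariant [IsManifold (𝓡 n) 1 M] [RiemannianBundle (fun x : M ↦ TangentSpace (𝓡 n) x)]
    (C : ∀ x : M, Set (TangentSpace (𝓡 n) x)) : Prop :=
  ∃ Γ : ∀ x₁ x₂ : M, TangentSpace (𝓡 n) x₁ ≃ₗ[ℝ] TangentSpace (𝓡 n) x₂,
    Continuous (fun p : TangentBundle (𝓡 n) M × M ↦
      (⟨p.2, Γ p.1.proj p.2 p.1.snd⟩ : TangentBundle (𝓡 n) M)) ∧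
    (∀ x, ∀ v : TangentSpace (𝓡 n) x, Γ x x v = v) ∧
    (∀ x₁ x₂, Γ x₁ x₂ '' C x₁ = C x₂) ∧
    ∀ x₁ x₂, ∀ u v : TangentSpace (𝓡 n) x₁,
      inner ℝ (Γ x₁ x₂ u) (Γ x₁ x₂ v) = inner ℝ u v

/-! ### Flows -/

/-- `φ` is the forward flow of the vector field `f`, all of whose forward orbits are complete:
for each `x`, the curve `t ↦ φ t x`, `t ≥ 0`, is the integral curve of `f` starting at `x`.
Values of `φ` at negative times are irrelevant. -/
def IsForwardFlow (f : ∀ x : M, TangentSpace (𝓡 n) x) (φ : ℝ → M → M) : Prop :=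
  ∀ x, φ 0 x = x ∧ IsMIntegralCurveOn (I := 𝓡 n) (fun t ↦ φ t x) f (Ici 0)

/-- Strong differential positivity with respect to the cone field `C`. -/
def IsStronglyDifferentiallyPositive (C : ∀ x : M, Set (TangentSpace (𝓡 n) x))
    (φ : ℝ → M → M) : Prop :=
  ∀ (x : M) (t : ℝ), 0 < t → ∀ v ∈ C x, v ≠ 0 →
    mfderiv (𝓡 n) (𝓡 n) (φ t) x v ∈ interior (C (φ t x))

variable (n) in
/-- A subset of `M` has measure zero if its image in each smooth chart is Lebesgue-null. -/
def HasMeasureZero (A : Set M) : Prop :=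
  ∀ Φ ∈ IsManifold.maximalAtlas (𝓡 n) ∞ M,
    (volume : Measure (EuclideanSpace ℝ (Fin n))) (Φ '' (A ∩ Φ.source)) = 0

end ConeField

section Convergence

variable {M : Type*} [TopologicalSpace M]

/-- `e` is an equilibrium of the forward flow `φ`. -/
def IsEquilibrium (φ : ℝ → M → M) (e : M) : Prop :=
  ∀ t, 0 ≤ t → φ t e = e

/-- The set of convergent points: those whose omega-limit set consists of one equilibrium. -/
def convergentPoints (φ : ℝ → M → M) : Set M :=
  {x | ∃ e, IsEquilibrium φ e ∧ omegaLimit atTop φ {x} = {e}}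

end Convergence

end ConalFlow

end

/-!
Strong differential positivity makes the flow strongly monotone for the conal order, and the theorem
follows from the theory of strongly monotone flows, once two strictly ordered orbits are known not
to be asymptotic to each other.

*The conal order in charts.* The isomorphisms `Γ` transport, in the chart at a point `e`, the cones
at nearby points to the cone at `e` by linear maps close to the identity (`exists_isConeTransport`).
Hence the increments of conal curves near `e` lie in a slightly enlarged cone
(`IsConeTransport.exists_nhds_sub_mem_fatCone`), and segments in directions well inside the cone are
strictly conal (`IsConeTransport.exists_nhds_stableLL`). The strict relation used is `StableLL`, the
interior of `ConalLL`: the velocity at the end point of a strictly conal curve is unconstrained, so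
that `ConalLL` itself need not be open. The time maps of the flow are strictly differentiable
(`IsForwardFlow.hasStrictFDerivAt`), so they map the end points of a short conal curve, whose
increment is almost in the cone, to points whose difference is well inside the cone. Chaining along
a conal curve gives strong monotonicity (`IsForwardFlow.isStronglyMonotoneFlow`).

*Strongly monotone flows.* Omega-limit sets are unordered
(`IsStronglyMonotoneFlow.eq_of_mem_omegaLimit_of_le`). If `x ≪ y`, `x` does not converge and the two
orbits have distinct limits along some common sequence of times, then every point of `ω(x)` is
strictly below every point of `ω(y)` (`IsStronglyMonotoneFlow.ll_of_mem_omegaLimit`). On a chain of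
nonconvergent points one can therefore select points of the omega-limit sets that are isolated from
all the later ones, and such a chain is countable (`IsStronglyMonotoneFlow.countable_of_forall_ll`).

*Distinct synchronous limits* (`exists_ne_of_stableLL`). Suppose that `x ≪ y`, `x` does not converge
and all the synchronous limits of the two orbits coincide. Then `ω(x)` consists of equilibria, which
are mutually unordered, and it has no isolated point. At each of its points `e` the derivative of
the time-one map fixes a limit direction of other equilibria, which is outside `±C(e)` because the
equilibria are unordered. The derivative being strongly positive, its Perron eigenvalue exceeds the
eigenvalue `1` of this direction, and a power of it expands the cone by any prescribed factor
(`IsClosedConvexCone.exists_le_norm_pow`). So near `ω(x)` the flow expands the distance of ordered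
points (`IsSolidConeField.exists_nhds_expanding`), and the two ordered orbits cannot approach each
other.

*Measure.* The set of nonconvergent points is a Borel set. In a chart, lines in a direction interior
to the cone are chains, which meet this set in countable sets; by Fubini the set is null
(`IsSolidConeField.hasMeasureZero`).
-/

namespace ConalFlow

/-! ### Strongly monotone flows on ordered spaces -/

/-- A forward flow `φ` with relatively compact orbits that is strongly monotone for a pair of
relations: `ll` is a strict open relation and `le` an antisymmetric one that contains the closure
of `ll`. Neither closedness of `le` nor the equivalence of `ll` with an interior of `le` is
assumed. -/
structure IsStronglyMonotoneFlow {X : Type*} [TopologicalSpace X] (ll le : X → X → Prop)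
    (φ : ℝ → X → X) : Prop where
  map_zero : ∀ x, φ 0 x = x
  map_add : ∀ s t, 0 ≤ s → 0 ≤ t → ∀ x, φ (s + t) x = φ s (φ t x)
  continuousOn : ContinuousOn (fun p : ℝ × X ↦ φ p.1 p.2) (Ici 0 ×ˢ univ)
  isCompact : ∀ x, IsCompact (closure ((fun t ↦ φ t x) '' Ici 0))
  antisymm : ∀ x y, le x y → le y x → x = y
  ll_trans : ∀ x y z, ll x y → ll y z → ll x z
  ll_irrefl : ∀ x, ¬ ll x x
  isOpen : IsOpen {p : X × X | ll p.1 p.2}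
  closure_subset : closure {p : X × X | ll p.1 p.2} ⊆ {p | le p.1 p.2}
  strong : ∀ t, 0 < t → ∀ x y, le x y → x ≠ y → ll (φ t x) (φ t y)

theorem mem_omegaLimit_iff_ultrafilter {X : Type*} [TopologicalSpace X] {φ : ℝ → X → X} {x p : X} :
    p ∈ omegaLimit atTop φ {x} ↔
      ∃ F : Ultrafilter ℝ, (F : Filter ℝ) ≤ atTop ∧ Tendsto (fun t ↦ φ t x) F (𝓝 p) := by
  rw [mem_omegaLimit_singleton_iff_mapClusterPt, mapClusterPt_iff_ultrafilter]

/-- Iterated limits along two proper filters are limits along a proper filter. -/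
theorem neBot_curry {α β : Type*} (l : Filter α) (m : Filter β) [l.NeBot] [m.NeBot] :
    (l.curry m).NeBot := by
  refine ⟨fun hbot ↦ ?_⟩
  have h : ∀ᶠ p in l.curry m, False := by rw [hbot]; exact eventually_bot
  rw [eventually_curry_iff] at h
  exact h.exists.choose_spec.exists.choose_spec

namespace IsStronglyMonotoneFlow

variable {X : Type*} [TopologicalSpace X] {ll le : X → X → Prop} {φ : ℝ → X → X}

theorem tendsto_map (h : IsStronglyMonotoneFlow ll le φ) {ι : Type*} {l : Filter ι} {s : ι → ℝ}
    {u : ι → X} {s₀ : ℝ} {p : X} (hs : Tendsto s l (𝓝 s₀)) (hs0 : ∀ᶠ i in l, 0 ≤ s i)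
    (h0 : 0 ≤ s₀) (hu : Tendsto u l (𝓝 p)) :
    Tendsto (fun i ↦ φ (s i) (u i)) l (𝓝 (φ s₀ p)) := by
  have h1 := h.continuousOn (s₀, p) ⟨h0, mem_univ _⟩
  have h2 : Tendsto (fun i ↦ (s i, u i)) l (𝓝[Ici 0 ×ˢ univ] (s₀, p)) := by
    refine tendsto_nhdsWithin_iff.2 ⟨hs.prodMk_nhds hu, ?_⟩
    filter_upwards [hs0] with i hi using ⟨hi, mem_univ _⟩
  exact h1.tendsto.comp h2

theorem tendsto_map_const (h : IsStronglyMonotoneFlow ll le φ) {ι : Type*} {l : Filter ι}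
    {u : ι → X} {s : ℝ} {p : X} (h0 : 0 ≤ s) (hu : Tendsto u l (𝓝 p)) :
    Tendsto (fun i ↦ φ s (u i)) l (𝓝 (φ s p)) :=
  h.tendsto_map tendsto_const_nhds (Eventually.of_forall fun _ ↦ h0) h0 hu

theorem le_of_ll (h : IsStronglyMonotoneFlow ll le φ) {x y : X} (hxy : ll x y) : le x y :=
  h.closure_subset (subset_closure (a := (x, y)) hxy)

theorem ll_map (h : IsStronglyMonotoneFlow ll le φ) {x y : X} (hxy : ll x y) {t : ℝ} (ht : 0 ≤ t) :
    ll (φ t x) (φ t y) := by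
  rcases ht.eq_or_lt with rfl | ht
  · simpa [h.map_zero] using hxy
  · refine h.strong t ht x y (h.le_of_ll hxy) ?_
    rintro rfl
    exact h.ll_irrefl _ hxy

theorem le_of_tendsto (h : IsStronglyMonotoneFlow ll le φ) {ι : Type*} {l : Filter ι} [l.NeBot]
    {u v : ι → X} {p q : X} (hu : Tendsto u l (𝓝 p)) (hv : Tendsto v l (𝓝 q))
    (huv : ∀ᶠ i in l, ll (u i) (v i)) : le p q :=
  h.closure_subset (mem_closure_of_tendsto (hu.prodMk_nhds hv) huv)

theorem eventually_ll (h : IsStronglyMonotoneFlow ll le φ) {ι : Type*} {l : Filter ι}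
    {u v : ι → X} {p q : X} (hu : Tendsto u l (𝓝 p)) (hv : Tendsto v l (𝓝 q)) (hpq : ll p q) :
    ∀ᶠ i in l, ll (u i) (v i) :=
  (hu.prodMk_nhds hv).eventually (h.isOpen.mem_nhds hpq)

/-- Relatively compact orbits have limits along every ultrafilter of nonnegative times. -/
theorem exists_tendsto (h : IsStronglyMonotoneFlow ll le φ) {ι : Type*} (F : Ultrafilter ι)
    {s : ι → ℝ} (hs : ∀ᶠ i in (F : Filter ι), 0 ≤ s i) (y : X) :
    ∃ b, Tendsto (fun i ↦ φ (s i) y) F (𝓝 b) := by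
  have h1 : closure ((fun t ↦ φ t y) '' Ici 0) ∈ F.map (fun i ↦ φ (s i) y) := by
    change ∀ᶠ i in (F : Filter ι), φ (s i) y ∈ closure ((fun t ↦ φ t y) '' Ici 0)
    filter_upwards [hs] with i hi using subset_closure ⟨_, hi, rfl⟩
  obtain ⟨b, -, hb⟩ := (h.isCompact y).ultrafilter_le_nhds' _ h1
  exact ⟨b, hb⟩

theorem map_mem_omegaLimit (h : IsStronglyMonotoneFlow ll le φ) {x p : X} {s : ℝ} (hs : 0 ≤ s)
    (hp : p ∈ omegaLimit atTop φ {x}) : φ s p ∈ omegaLimit atTop φ {x} := by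
  obtain ⟨F, hF, hp⟩ := mem_omegaLimit_iff_ultrafilter.1 hp
  refine mem_omegaLimit_iff_ultrafilter.2 ⟨F.map (fun t ↦ s + t), ?_, ?_⟩
  · exact (tendsto_atTop_add_const_left atTop s tendsto_id).comp hF
  · change Tendsto ((fun t ↦ φ t x) ∘ (fun t ↦ s + t)) F _
    refine (h.tendsto_map_const hs hp).congr' ?_
    filter_upwards [hF (eventually_ge_atTop 0)] with t ht using (h.map_add s t hs ht x).symm

theorem exists_mem_omegaLimit_map_eq [T2Space X] (h : IsStronglyMonotoneFlow ll le φ) {x q : X}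
    {s : ℝ} (hs : 0 ≤ s) (hq : q ∈ omegaLimit atTop φ {x}) :
    ∃ p ∈ omegaLimit atTop φ {x}, φ s p = q := by
  obtain ⟨F, hF, hq⟩ := mem_omegaLimit_iff_ultrafilter.1 hq
  have hF' : Tendsto (fun t ↦ t - s) F atTop :=
    (tendsto_atTop_add_const_right atTop (-s) tendsto_id).comp hF
  obtain ⟨p, hp⟩ := h.exists_tendsto F (hF' (eventually_ge_atTop 0)) x
  refine ⟨p, mem_omegaLimit_iff_ultrafilter.2 ⟨F.map (fun t ↦ t - s), hF', hp⟩, ?_⟩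
  refine tendsto_nhds_unique (h.tendsto_map_const hs hp) (hq.congr' ?_)
  filter_upwards [hF' (eventually_ge_atTop 0)] with t ht
  rw [← h.map_add s _ hs ht, add_sub_cancel]

theorem nonempty_omegaLimit (h : IsStronglyMonotoneFlow ll le φ) (x : X) :
    (omegaLimit atTop φ {x}).Nonempty := by
  have hF := Ultrafilter.of_le (atTop : Filter ℝ)
  obtain ⟨b, hb⟩ := h.exists_tendsto (Ultrafilter.of atTop) (s := id)
    (hF (eventually_ge_atTop 0)) x
  exact ⟨b, mem_omegaLimit_iff_ultrafilter.2 ⟨_, hF, hb⟩⟩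

theorem isCompact_omegaLimit (h : IsStronglyMonotoneFlow ll le φ) (x : X) :
    IsCompact (omegaLimit atTop φ {x}) := by
  refine (h.isCompact x).of_isClosed_subset (isClosed_omegaLimit _ _ _) fun p hp ↦ ?_
  obtain ⟨F, hF, hp⟩ := mem_omegaLimit_iff_ultrafilter.1 hp
  refine mem_closure_of_tendsto hp ?_
  filter_upwards [hF (eventually_ge_atTop 0)] with t ht using ⟨t, ht, rfl⟩

theorem omegaLimit_subset (h : IsStronglyMonotoneFlow ll le φ) {y b : X}
    (hb : b ∈ omegaLimit atTop φ {y}) : omegaLimit atTop φ {b} ⊆ omegaLimit atTop φ {y} := by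
  intro p hp
  obtain ⟨F, hF, hp⟩ := mem_omegaLimit_iff_ultrafilter.1 hp
  refine (isClosed_omegaLimit _ _ _).mem_of_tendsto hp ?_
  filter_upwards [hF (eventually_ge_atTop 0)] with t ht using h.map_mem_omegaLimit ht hb

/-- A point with arbitrarily small periods, filling an interval `[0, δ)`, is an equilibrium. -/
theorem isEquilibrium_of_forall_small (h : IsStronglyMonotoneFlow ll le φ) {p : X} {δ : ℝ}
    (hδ : 0 < δ) (hp : ∀ s, 0 ≤ s → s < δ → φ s p = p) : IsEquilibrium φ p := by
  have key : ∀ s, 0 ≤ s → s < δ → ∀ k : ℕ, φ (k * s) p = p := by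
    intro s hs hsδ k
    induction k with
    | zero => simp [h.map_zero]
    | succ k ih =>
      rw [Nat.cast_succ, add_mul, one_mul, h.map_add _ _ (by positivity) hs, hp s hs hsδ, ih]
  intro t ht
  obtain ⟨N, hN⟩ := exists_nat_gt (t / δ)
  have hN0 : (0 : ℝ) < N := lt_of_le_of_lt (by positivity) hN
  have := key (t / N) (by positivity) (by rw [div_lt_iff₀ hN0]; rwa [div_lt_iff₀' hδ] at hN) N
  rwa [mul_div_cancel₀ _ hN0.ne'] at this

/-- The points `φ (k T) x` of an orbit that increases after time `T` converge. -/
theorem exists_tendsto_of_ll_map [T2Space X] (h : IsStronglyMonotoneFlow ll le φ) {x : X} {T : ℝ}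
    (hT : 0 < T) (hx : ll x (φ T x)) :
    ∃ p, Tendsto (fun k : ℕ ↦ φ (k * T) x) atTop (𝓝 p) ∧ φ T p = p := by
  have hsucc : ∀ k : ℕ, ll (φ (k * T) x) (φ ((k + 1 : ℕ) * T) x) := by
    intro k
    have := h.ll_map hx (t := k * T) (by positivity)
    rwa [← h.map_add _ _ (by positivity) hT.le, ← add_one_mul, ← Nat.cast_add_one] at this
  have : IsTrans X ll := ⟨h.ll_trans⟩
  have hmono : ∀ j k : ℕ, j < k → ll (φ (j * T) x) (φ (k * T) x) := fun j k hjk ↦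
    Nat.rel_of_forall_rel_succ_of_lt ll (f := fun k : ℕ ↦ φ (k * T) x) hsucc hjk
  have hle : ∀ p q, MapClusterPt p atTop (fun k : ℕ ↦ φ (k * T) x) →
      MapClusterPt q atTop (fun k : ℕ ↦ φ (k * T) x) → le p q := by
    intro p q hp hq
    obtain ⟨F, hF, hp⟩ := mapClusterPt_iff_ultrafilter.1 hp
    obtain ⟨G, hG, hq⟩ := mapClusterPt_iff_ultrafilter.1 hq
    have hFG : (F : Filter ℕ).curry (G : Filter ℕ) ≤ (F : Filter ℕ) ×ˢ (G : Filter ℕ) :=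
      curry_le_prod
    -- in the iterated limit the second index is eventually larger than the first one
    have := neBot_curry (F : Filter ℕ) (G : Filter ℕ)
    refine h.le_of_tendsto (l := (F : Filter ℕ).curry (G : Filter ℕ))
      ((hp.comp tendsto_fst).mono_left hFG) ((hq.comp tendsto_snd).mono_left hFG) ?_
    refine eventually_curry_iff.2 ?_
    refine Eventually.of_forall fun j ↦ ?_
    filter_upwards [hG (eventually_gt_atTop j)] with k hk using hmono j k hk
  have hmem : ∀ k : ℕ, φ (k * T) x ∈ closure ((fun t ↦ φ t x) '' Ici 0) := fun k ↦
    subset_closure ⟨k * T, by simp only [mem_Ici]; positivity, rfl⟩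
  obtain ⟨p, -, hp⟩ := (h.isCompact x).exists_mapClusterPt (f := atTop)
    (u := fun k : ℕ ↦ φ (k * T) x) (tendsto_principal.2 (Eventually.of_forall hmem))
  have hlim : Tendsto (fun k : ℕ ↦ φ (k * T) x) atTop (𝓝 p) :=
    (h.isCompact x).tendsto_nhds_of_unique_mapClusterPt (Eventually.of_forall hmem)
      fun q _ hq ↦ h.antisymm _ _ (hle _ _ hq hp) (hle _ _ hp hq)
  refine ⟨p, hlim, tendsto_nhds_unique (h.tendsto_map_const hT.le hlim) ?_⟩
  refine (hlim.comp (tendsto_add_atTop_nat 1)).congr fun k ↦ ?_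
  simp only [Function.comp]
  rw [← h.map_add _ _ hT.le (by positivity), Nat.cast_add_one, add_one_mul, add_comm]

/-- If `φ (k T) x` converges to a point `p`, the ultralimits of the orbit of `x` are on the orbit
of `p`, at times in `[0, T]`. -/
theorem exists_tendsto_of_tendsto_nat (h : IsStronglyMonotoneFlow ll le φ) {x p : X} {T : ℝ}
    (hT : 0 < T) (hp : Tendsto (fun k : ℕ ↦ φ (k * T) x) atTop (𝓝 p)) {ι : Type*}
    (F : Ultrafilter ι) {s : ι → ℝ} (hs : Tendsto s F atTop) :
    ∃ r ∈ Icc 0 T, Tendsto (fun i ↦ φ (s i) x) F (𝓝 (φ r p)) := by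
  set m : ι → ℕ := fun i ↦ ⌊s i / T⌋₊
  have hm : Tendsto m F atTop :=
    tendsto_nat_floor_atTop.comp (hs.atTop_div_const hT)
  have hr : ∀ᶠ i in (F : Filter ι), s i - m i * T ∈ Icc 0 T := by
    filter_upwards [hs (eventually_ge_atTop 0)] with i hi
    have hi0 : 0 ≤ s i / T := div_nonneg hi hT.le
    have h1 := Nat.floor_le hi0
    have h2 := Nat.lt_floor_add_one (s i / T)
    rw [le_div_iff₀ hT] at h1
    rw [div_lt_iff₀ hT] at h2
    constructor <;> simp only [m] <;> linarith
  obtain ⟨r, hrm, hr'⟩ := isCompact_Icc.ultrafilter_le_nhds' (F.map (fun i ↦ s i - m i * T)) hr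
  refine ⟨r, hrm, ?_⟩
  have := h.tendsto_map (l := F) (s := fun i ↦ s i - m i * T) hr' (hr.mono fun i hi ↦ hi.1) hrm.1
    (hp.comp hm)
  refine this.congr' ?_
  filter_upwards [hr] with i hi
  simp only [Function.comp]
  rw [← h.map_add _ _ hi.1 (by positivity), sub_add_cancel]

/-- Convergence criterion: an orbit that increases after some time converges to an equilibrium.
The periodic limit has all the periods close to `T`, because `ll` is open. -/
theorem tendsto_of_ll_map [T2Space X] (h : IsStronglyMonotoneFlow ll le φ) {x : X} {T : ℝ}
    (hT : 0 < T) (hx : ll x (φ T x)) :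
    ∃ p, Tendsto (fun t ↦ φ t x) atTop (𝓝 p) := by
  obtain ⟨p, hp, hTp⟩ := h.exists_tendsto_of_ll_map hT hx
  have hev : ∀ᶠ s in 𝓝[≥] (0 : ℝ), ll x (φ (s + T) x) := by
    refine h.eventually_ll tendsto_const_nhds ?_ hx
    refine h.tendsto_map (s₀ := T) ?_ ?_ hT.le tendsto_const_nhds
    · exact ((continuous_id.add continuous_const).tendsto' (0 : ℝ) T (by simp)).mono_left
        nhdsWithin_le_nhds
    · filter_upwards [self_mem_nhdsWithin] with s (hs : 0 ≤ s)
      positivity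
  obtain ⟨δ, hδ, hsub⟩ := mem_nhdsGE_iff_exists_Ico_subset.1 hev
  have heq : IsEquilibrium φ p := by
    refine h.isEquilibrium_of_forall_small hδ fun s hs hsδ ↦ ?_
    have hS : 0 < s + T := by positivity
    obtain ⟨q, hq, hSq⟩ := h.exists_tendsto_of_ll_map hS (hsub ⟨hs, hsδ⟩)
    -- `q` has period `s + T` and is on the orbit of `p`, so that `p` has the periods `T`, `s + T`
    obtain ⟨r, hr, hrq⟩ := h.exists_tendsto_of_tendsto_nat hT hp (Ultrafilter.of atTop)
      (s := fun k : ℕ ↦ k * (s + T))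
      ((tendsto_natCast_atTop_atTop.atTop_mul_const hS).mono_left (Ultrafilter.of_le _))
    obtain rfl : q = φ r p := tendsto_nhds_unique (hq.mono_left (Ultrafilter.of_le _)) hrq
    have h1 : 0 ≤ T - r := sub_nonneg.2 hr.2
    have h2 := congrArg (φ (T - r)) hSq
    rw [← h.map_add _ _ h1 hr.1, sub_add_cancel, hTp, ← h.map_add _ _ hS.le hr.1,
      ← h.map_add _ _ h1 (by linarith [hr.1]),
      show T - r + (s + T + r) = s + T + T by ring, h.map_add _ _ hS.le hT.le, hTp,
      h.map_add _ _ hs hT.le, hTp] at h2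
    exact h2
  refine ⟨p, tendsto_iff_ultrafilter _ _ _ |>.2 fun F hF ↦ ?_⟩
  obtain ⟨r, hr, hr'⟩ := h.exists_tendsto_of_tendsto_nat hT hp F (s := id) hF
  rwa [heq r hr.1] at hr'

theorem eq_of_tendsto_of_mem_omegaLimit [T2Space X] {x p e : X}
    (hx : Tendsto (fun t ↦ φ t x) atTop (𝓝 e)) (hp : p ∈ omegaLimit atTop φ {x}) : p = e := by
  obtain ⟨F, hF, hp⟩ := mem_omegaLimit_iff_ultrafilter.1 hp
  exact tendsto_nhds_unique hp (hx.mono_left hF)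

/-- An omega-limit set is unordered. -/
theorem eq_of_mem_omegaLimit_of_le [T2Space X] (h : IsStronglyMonotoneFlow ll le φ) {x p q : X}
    (hp : p ∈ omegaLimit atTop φ {x}) (hq : q ∈ omegaLimit atTop φ {x}) (hpq : le p q) :
    p = q := by
  by_contra hne
  have hll := h.strong 1 one_pos p q hpq hne
  have hp1 := h.map_mem_omegaLimit zero_le_one hp
  have hq1 := h.map_mem_omegaLimit zero_le_one hq
  obtain ⟨F, hF, hFp⟩ := mem_omegaLimit_iff_ultrafilter.1 hp1
  obtain ⟨G, hG, hGq⟩ := mem_omegaLimit_iff_ultrafilter.1 hq1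
  have hFG : (F : Filter ℝ).curry (G : Filter ℝ) ≤ (F : Filter ℝ) ×ˢ (G : Filter ℝ) :=
    curry_le_prod
  have hev := h.eventually_ll ((hFp.comp tendsto_fst).mono_left hFG)
    ((hGq.comp tendsto_snd).mono_left hFG) hll
  rw [eventually_curry_iff] at hev
  obtain ⟨s, hs, hs0⟩ := (hev.and (hF (eventually_ge_atTop 0))).exists
  obtain ⟨t, ht, hst⟩ := (hs.and (hG (eventually_gt_atTop s))).exists
  simp only [Function.comp] at ht
  obtain ⟨e, he⟩ := h.tendsto_of_ll_map (x := φ s x) (T := t - s) (sub_pos.2 hst) (by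
    rwa [← h.map_add _ _ (sub_pos.2 hst).le hs0, sub_add_cancel])
  have he' : Tendsto (fun t ↦ φ t x) atTop (𝓝 e) := by
    refine (he.comp (tendsto_atTop_add_const_right atTop (-s) tendsto_id)).congr' ?_
    filter_upwards [eventually_ge_atTop s] with r hr
    simp only [Function.comp, id]
    rw [← h.map_add _ _ (by linarith) hs0, neg_add_cancel_right]
  rw [eq_of_tendsto_of_mem_omegaLimit he' hp1, eq_of_tendsto_of_mem_omegaLimit he' hq1] at hll
  exact h.ll_irrefl _ hll

theorem mem_convergentPoints_of_subsingleton (h : IsStronglyMonotoneFlow ll le φ) {x e : X}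
    (he : omegaLimit atTop φ {x} = {e}) : x ∈ convergentPoints φ := by
  refine ⟨e, fun t ht ↦ ?_, he⟩
  have h1 := h.map_mem_omegaLimit (x := x) (p := e) ht (by rw [he]; rfl)
  rwa [he] at h1

theorem exists_ne_of_notMem_convergentPoints (h : IsStronglyMonotoneFlow ll le φ) {x : X}
    (hx : x ∉ convergentPoints φ) (p : X) : ∃ q ∈ omegaLimit atTop φ {x}, q ≠ p := by
  by_contra! hall
  obtain ⟨q, hq⟩ := h.nonempty_omegaLimit x
  exact hx (h.mem_convergentPoints_of_subsingleton (e := p) (subset_antisymm hall (by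
    rw [singleton_subset_iff, ← hall q hq]; exact hq)))

/-- Colimiting principle: a common synchronous limit of two strictly ordered orbits is an
equilibrium. -/
theorem isEquilibrium_of_tendsto_of_tendsto [T2Space X] (h : IsStronglyMonotoneFlow ll le φ)
    {x y p : X} (hxy : ll x y) {F : Ultrafilter ℝ} (hF : (F : Filter ℝ) ≤ atTop)
    (hx : Tendsto (fun t ↦ φ t x) F (𝓝 p)) (hy : Tendsto (fun t ↦ φ t y) F (𝓝 p)) :
    IsEquilibrium φ p := by
  have hev : ∀ᶠ s in 𝓝[≥] (0 : ℝ), ll x (φ s y) := by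
    refine h.eventually_ll tendsto_const_nhds ?_ (hxy)
    have := h.tendsto_map (l := 𝓝[≥] (0 : ℝ)) (s := id) (u := fun _ ↦ y)
      nhdsWithin_le_nhds self_mem_nhdsWithin le_rfl tendsto_const_nhds
    rwa [h.map_zero] at this
  obtain ⟨δ, hδ, hsub⟩ := mem_nhdsGE_iff_exists_Ico_subset.1 hev
  have hpy : p ∈ omegaLimit atTop φ {y} := mem_omegaLimit_iff_ultrafilter.2 ⟨F, hF, hy⟩
  refine h.isEquilibrium_of_forall_small hδ fun s hs hsδ ↦ ?_
  refine (h.eq_of_mem_omegaLimit_of_le hpy (h.map_mem_omegaLimit hs hpy) ?_).symm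
  refine h.le_of_tendsto hx (h.tendsto_map_const hs hy) ?_
  filter_upwards [hF (eventually_ge_atTop 0)] with t ht
  have := h.ll_map (hsub ⟨hs, hsδ⟩) ht
  rwa [← h.map_add _ _ ht hs, add_comm, h.map_add _ _ hs ht] at this

/-- If two strictly ordered orbits have distinct synchronous limits `a` and `b`, then the orbit of
`a` is strictly below that of `b` with any delay. The delays for which this holds form an open and
closed set of times, since the orbit of `a` stays out of the omega-limit set containing `b`. -/
theorem ll_map_add_of_tendsto [T2Space X] (h : IsStronglyMonotoneFlow ll le φ) {x y a b : X}
    (hxy : ll x y) {F : Ultrafilter ℝ} (hF : (F : Filter ℝ) ≤ atTop)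
    (hx : Tendsto (fun t ↦ φ t x) F (𝓝 a)) (hy : Tendsto (fun t ↦ φ t y) F (𝓝 b)) (hab : a ≠ b) :
    (∀ τ, 0 ≤ τ → φ τ a ∉ omegaLimit atTop φ {y}) ∧
      ∀ s, 0 ≤ s → ll (φ 1 a) (φ (1 + s) b) := by
  have hF0 : ∀ᶠ t in (F : Filter ℝ), 0 ≤ t := hF (eventually_ge_atTop 0)
  have hb : b ∈ omegaLimit atTop φ {y} := mem_omegaLimit_iff_ultrafilter.2 ⟨F, hF, hy⟩
  have hle : le a b := h.le_of_tendsto hx hy (hF0.mono fun t ht ↦ h.ll_map hxy ht)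
  have hout : ∀ τ, 0 ≤ τ → φ τ a ∉ omegaLimit atTop φ {y} := by
    intro τ hτ ha
    rcases hτ.eq_or_lt with rfl | hτ0
    · rw [h.map_zero] at ha
      exact hab (h.eq_of_mem_omegaLimit_of_le ha hb hle)
    · have hll := h.strong τ hτ0 a b hle hab
      rw [h.eq_of_mem_omegaLimit_of_le ha (h.map_mem_omegaLimit hτ hb)
        (h.le_of_ll hll)] at hll
      exact h.ll_irrefl _ hll
  refine ⟨hout, ?_⟩
  -- a strict inequality at the limit holds along the orbits, and then persists
  have hstep : ∀ τ s, 0 ≤ τ → 0 ≤ s → ll (φ τ a) (φ (τ + s) b) → ll (φ 1 a) (φ (1 + s) b) := by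
    intro τ s hτ hs hll
    have hτs : 0 ≤ τ + s := by positivity
    obtain ⟨r, hr, hr0⟩ := ((h.eventually_ll (h.tendsto_map_const hτ hx)
      (h.tendsto_map_const hτs hy) hll).and hF0).exists
    have hle' : le a (φ s b) := by
      refine h.le_of_tendsto hx (h.tendsto_map_const hs hy) ?_
      filter_upwards [hF (eventually_ge_atTop (τ + r))] with t ht
      have h1 : 0 ≤ t - (τ + r) := sub_nonneg.2 ht
      have := h.ll_map hr h1
      rw [← h.map_add _ _ hτ hr0, ← h.map_add _ _ hτs hr0,
        ← h.map_add _ _ h1 (by positivity), ← h.map_add _ _ h1 (by positivity),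
        sub_add_cancel, show t - (τ + r) + (τ + s + r) = s + t by ring,
        h.map_add _ _ hs (by linarith)] at this
      exact this
    have hne : a ≠ φ s b := fun hEq ↦ hout 0 le_rfl (by
      rw [h.map_zero, hEq]; exact h.map_mem_omegaLimit hs hb)
    have := h.strong 1 one_pos _ _ hle' hne
    rwa [← h.map_add _ _ zero_le_one hs] at this
  set S : Set ℝ := {s | ll (φ 1 a) (φ (1 + s) b)}
  have htend : ∀ s : ℝ, 0 ≤ s → ∀ l ≤ 𝓝 s, (∀ᶠ r in l, 0 ≤ r) →
      ∀ τ, 0 ≤ τ → Tendsto (fun r ↦ φ (τ + r) b) l (𝓝 (φ (τ + s) b)) := by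
    intro s hs l hl hl0 τ hτ
    refine h.tendsto_map ?_ (hl0.mono fun r hr ↦ by positivity) (by positivity) tendsto_const_nhds
    exact (tendsto_id.const_add τ).mono_left hl
  have hclosed : ∀ s, 0 ≤ s → ∀ l ≤ 𝓝 s, l.NeBot → (∀ᶠ r in l, 0 ≤ r ∧ r ∈ S) → s ∈ S := by
    intro s hs l hl hne hlS
    have hle' : le (φ 1 a) (φ (1 + s) b) :=
      h.le_of_tendsto tendsto_const_nhds (htend s hs l hl (hlS.mono fun r hr ↦ hr.1) 1 zero_le_one)
        (hlS.mono fun r hr ↦ hr.2)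
    have hne' : φ 1 a ≠ φ (1 + s) b := fun hEq ↦ hout 1 zero_le_one (by
      rw [hEq]; exact h.map_mem_omegaLimit (by positivity) hb)
    have := h.strong 1 one_pos _ _ hle' hne'
    rw [← h.map_add _ _ zero_le_one zero_le_one, ← h.map_add _ _ zero_le_one (by positivity),
      ← add_assoc] at this
    exact hstep (1 + 1) s (by norm_num) hs this
  intro s hs
  have hsub : Icc 0 s ⊆ S ∩ Ici 0 := by
    refine IsClosed.Icc_subset_of_forall_mem_nhdsGT_of_Icc_subset ?_ ?_ ?_
    · refine isClosed_iff_clusterPt.2 fun r hr ↦ ?_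
      have hmem : r ∈ Icc 0 s :=
        isClosed_Icc.closure_subset_iff.2 inter_subset_right (mem_closure_iff_clusterPt.2 hr)
      have : (𝓝 r ⊓ 𝓟 (S ∩ Ici 0 ∩ Icc 0 s)).NeBot := hr
      refine ⟨⟨hclosed r hmem.1 _ inf_le_left this ?_, hmem.1⟩, hmem⟩
      filter_upwards [mem_inf_of_right (mem_principal_self _)] with q hq using ⟨hq.1.2, hq.1.1⟩
    · refine ⟨?_, self_mem_Ici⟩
      have := h.strong 1 one_pos a b hle hab
      simpa [S] using this
    · intro r hr hrS
      have hr0 : 0 ≤ r := hr.1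
      have hmem : r ∈ S := (hrS ⟨hr0, le_rfl⟩).1
      have hpos : ∀ᶠ q in 𝓝[>] r, 0 ≤ q := by
        filter_upwards [self_mem_nhdsWithin] with q hq using hr0.trans (le_of_lt hq)
      filter_upwards [hpos, h.eventually_ll tendsto_const_nhds
        (htend r hr0 _ nhdsWithin_le_nhds hpos 1 zero_le_one) hmem] with q hq0 hq using ⟨hq, hq0⟩
  exact (hsub ⟨hs, le_rfl⟩).1

/-- Separation principle: if two strictly ordered orbits have distinct synchronous limits and the
lower one does not converge, all points of the lower omega-limit set are strictly below all points
of the upper one. -/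
theorem ll_of_mem_omegaLimit [T2Space X] (h : IsStronglyMonotoneFlow ll le φ) {x y a b : X}
    (hxy : ll x y) {F : Ultrafilter ℝ} (hF : (F : Filter ℝ) ≤ atTop)
    (hx : Tendsto (fun t ↦ φ t x) F (𝓝 a)) (hy : Tendsto (fun t ↦ φ t y) F (𝓝 b)) (hab : a ≠ b)
    (hxD : x ∉ convergentPoints φ) :
    ∀ p ∈ omegaLimit atTop φ {x}, ∀ q ∈ omegaLimit atTop φ {y}, ll p q := by
  obtain ⟨hout, hdelay⟩ := h.ll_map_add_of_tendsto hxy hF hx hy hab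
  have ha : a ∈ omegaLimit atTop φ {x} := mem_omegaLimit_iff_ultrafilter.2 ⟨F, hF, hx⟩
  have hb : b ∈ omegaLimit atTop φ {y} := mem_omegaLimit_iff_ultrafilter.2 ⟨F, hF, hy⟩
  have ha1 := h.map_mem_omegaLimit zero_le_one ha
  have hby := h.omegaLimit_subset hb
  -- an order relation between two disjoint invariant sets is strict
  have hstrict : ∀ u v, (∀ p ∈ omegaLimit atTop φ {u}, ∀ q ∈ omegaLimit atTop φ {v}, le p q) →
      (∀ p ∈ omegaLimit atTop φ {u}, p ∉ omegaLimit atTop φ {v}) →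
      ∀ p ∈ omegaLimit atTop φ {u}, ∀ q ∈ omegaLimit atTop φ {v}, ll p q := by
    intro u v hle hdisj p hp q hq
    obtain ⟨p', hp', rfl⟩ := h.exists_mem_omegaLimit_map_eq zero_le_one hp
    obtain ⟨q', hq', rfl⟩ := h.exists_mem_omegaLimit_map_eq zero_le_one hq
    exact h.strong 1 one_pos _ _ (hle p' hp' q' hq') fun hEq ↦ hdisj p' hp' (hEq ▸ hq')
  have hale : ∀ z ∈ omegaLimit atTop φ {b}, le (φ 1 a) z := by
    intro z hz
    obtain ⟨G, hG, hz⟩ := mem_omegaLimit_iff_ultrafilter.1 hz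
    refine h.le_of_tendsto tendsto_const_nhds hz ?_
    filter_upwards [hG (eventually_ge_atTop 1)] with t ht
    have := hdelay (t - 1) (by linarith)
    rwa [add_sub_cancel] at this
  have hall : ∀ z ∈ omegaLimit atTop φ {b}, ll (φ 1 (φ 1 a)) z := by
    intro z hz
    obtain ⟨z', hz', rfl⟩ := h.exists_mem_omegaLimit_map_eq zero_le_one hz
    exact h.strong 1 one_pos _ _ (hale z' hz') fun hEq ↦ hout 1 zero_le_one (hby (hEq ▸ hz'))
  -- the orbit of `x` falls below the compact invariant set `ω(b)`
  have hxb : ∀ p ∈ omegaLimit atTop φ {x}, ∀ z ∈ omegaLimit atTop φ {b}, le p z := by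
    obtain ⟨G, hG, hGa⟩ := mem_omegaLimit_iff_ultrafilter.1 (h.map_mem_omegaLimit zero_le_one ha1)
    have hev : ∀ᶠ u in 𝓝 (φ 1 (φ 1 a)), ∀ z ∈ omegaLimit atTop φ {b}, ll u z :=
      (h.isCompact_omegaLimit b).eventually_forall_of_forall_eventually fun z hz ↦
        h.isOpen.mem_nhds (x := (φ 1 (φ 1 a), z)) (hall z hz)
    obtain ⟨τ, hτ, hτ0⟩ := ((hGa.eventually hev).and (hG (eventually_ge_atTop 0))).exists
    intro p hp z hz
    obtain ⟨P, hP, hPp⟩ := mem_omegaLimit_iff_ultrafilter.1 hp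
    refine h.le_of_tendsto hPp tendsto_const_nhds ?_
    filter_upwards [hP (eventually_ge_atTop τ)] with t ht
    have ht' : 0 ≤ t - τ := sub_nonneg.2 ht
    obtain ⟨z', hz', rfl⟩ := h.exists_mem_omegaLimit_map_eq ht' hz
    have := h.ll_map (hτ z' hz') ht'
    rwa [← h.map_add _ _ ht' hτ0, sub_add_cancel] at this
  have hxb' : ∀ p ∈ omegaLimit atTop φ {x}, ∀ z ∈ omegaLimit atTop φ {b}, ll p z := by
    refine hstrict x b hxb fun p hp hpb ↦ hout 1 zero_le_one ?_
    rw [h.eq_of_mem_omegaLimit_of_le ha1 hp (hxb _ ha1 _ hpb)]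
    exact hby hpb
  -- the orbit of `y` rises above the compact invariant set `ω(x)`
  have hxy' : ∀ p ∈ omegaLimit atTop φ {x}, ∀ q ∈ omegaLimit atTop φ {y}, le p q := by
    obtain ⟨z, hz⟩ := h.nonempty_omegaLimit b
    obtain ⟨G, hG, hGz⟩ := mem_omegaLimit_iff_ultrafilter.1 (hby hz)
    have hev : ∀ᶠ u in 𝓝 z, ∀ p ∈ omegaLimit atTop φ {x}, ll p u := by
      refine (h.isCompact_omegaLimit x).eventually_forall_of_forall_eventually fun p hp ↦ ?_
      exact (continuous_swap.tendsto (z, p)).eventually (h.isOpen.mem_nhds (hxb' p hp z hz))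
    obtain ⟨τ, hτ, hτ0⟩ := ((hGz.eventually hev).and (hG (eventually_ge_atTop 0))).exists
    intro p hp q hq
    obtain ⟨P, hP, hPq⟩ := mem_omegaLimit_iff_ultrafilter.1 hq
    refine h.le_of_tendsto tendsto_const_nhds hPq ?_
    filter_upwards [hP (eventually_ge_atTop τ)] with t ht
    have ht' : 0 ≤ t - τ := sub_nonneg.2 ht
    obtain ⟨p', hp', rfl⟩ := h.exists_mem_omegaLimit_map_eq ht' hp
    have := h.ll_map (hτ p' hp') ht'
    rwa [← h.map_add _ _ ht' hτ0, sub_add_cancel] at this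
  refine hstrict x y hxy' fun p hp hpy ↦ ?_
  obtain ⟨q, hq, hqp⟩ := h.exists_ne_of_notMem_convergentPoints hxD p
  exact hqp (h.eq_of_mem_omegaLimit_of_le hq hp (hxy' q hq p hpy))

/-- On a simply ordered family of points, nonconvergent points are exceptional, provided that two
strictly ordered orbits, the lower one nonconvergent, always have distinct synchronous limits. -/
theorem countable_of_forall_ll [T2Space X] [SecondCountableTopology X]
    (h : IsStronglyMonotoneFlow ll le φ)
    (hsep : ∀ x y, ll x y → x ∉ convergentPoints φ →
      ∃ (F : Ultrafilter ℝ) (a b : X), (F : Filter ℝ) ≤ atTop ∧ Tendsto (fun t ↦ φ t x) F (𝓝 a) ∧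
        Tendsto (fun t ↦ φ t y) F (𝓝 b) ∧ a ≠ b)
    {T : Set ℝ} {c : ℝ → X} (hcD : ∀ s ∈ T, c s ∉ convergentPoints φ)
    (hc : ∀ s ∈ T, ∀ t ∈ T, s < t → ll (c s) (c t)) : T.Countable := by
  choose p hp using fun s ↦ h.nonempty_omegaLimit (c s)
  have hll : ∀ s ∈ T, ∀ t ∈ T, s < t → ∀ q ∈ omegaLimit atTop φ {c s}, ll q (p t) := by
    intro s hs t ht hst q hq
    obtain ⟨F, a, b, hF, ha, hb, hab⟩ := hsep _ _ (hc s hs t ht hst) (hcD s hs)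
    exact h.ll_of_mem_omegaLimit (hc s hs t ht hst) hF ha hb hab (hcD s hs) q hq _ (hp t)
  -- `p s` is isolated from all the later points
  have hiso : ∀ s ∈ T, p s ∉ closure (p '' {t ∈ T | s < t}) := by
    intro s hs hcl
    obtain ⟨q, hq, hqp⟩ := h.exists_ne_of_notMem_convergentPoints (hcD s hs) (p s)
    refine hqp (h.eq_of_mem_omegaLimit_of_le hq (hp s) ?_)
    refine h.closure_subset (closure_mono (s := (fun u ↦ (q, u)) '' (p '' {t ∈ T | s < t})) ?_
      (image_closure_subset_closure_image (Continuous.prodMk_right q) ⟨_, hcl, rfl⟩))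
    rintro _ ⟨_, ⟨t, ht, rfl⟩, rfl⟩
    exact hll s hs t ht.1 ht.2 q hq
  have hB := TopologicalSpace.isBasis_countableBasis X
  have hex : ∀ s : T, ∃ B ∈ TopologicalSpace.countableBasis X, p s ∈ B ∧
      B ⊆ (closure (p '' {t ∈ T | s < t}))ᶜ := fun s ↦
    hB.exists_subset_of_mem_open (hiso s s.2) isClosed_closure.isOpen_compl
  choose B hBm hpB hBsub using hex
  have hinj : Function.Injective
      (fun s : T ↦ (⟨B s, hBm s⟩ : TopologicalSpace.countableBasis X)) := by
    have key : ∀ s t : T, B s = B t → ¬ s < t := by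
      intro s t hst hlt
      exact hBsub s (hst ▸ hpB t) (subset_closure ⟨t, ⟨t.2, hlt⟩, rfl⟩)
    intro s t hst
    have hst : B s = B t := congrArg Subtype.val hst
    exact le_antisymm (not_lt.1 (key t s hst.symm)) (not_lt.1 (key s t hst))
  have : Countable (TopologicalSpace.countableBasis X) :=
    (TopologicalSpace.countable_countableBasis X).to_subtype
  exact hinj.countable

end IsStronglyMonotoneFlow

/-! ### Closed convex cones in finite dimension -/

section Cone

variable {E : Type*} [NormedAddCommGroup E] [NormedSpace ℝ E]

namespace IsClosedConvexCone

variable {K : Set E}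

theorem zero_mem (hK : IsClosedConvexCone K) : (0 : E) ∈ K := by
  obtain ⟨v, hv⟩ := hK.nonempty
  simpa using hK.smul_mem 0 le_rfl v hv

theorem convex (hK : IsClosedConvexCone K) : Convex ℝ K := fun x hx y hy a b ha hb _ ↦
  hK.add_mem _ (hK.smul_mem a ha x hx) _ (hK.smul_mem b hb y hy)

theorem eq_zero (hK : IsClosedConvexCone K) {v : E} (hv : v ∈ K) (hv' : -v ∈ K) : v = 0 := by
  have : v ∈ K ∩ {v | -v ∈ K} := ⟨hv, hv'⟩
  rwa [hK.inter_neg] at this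

theorem zero_notMem_interior [Nontrivial E] (hK : IsClosedConvexCone K) : (0 : E) ∉ interior K := by
  intro h
  obtain ⟨r, hr, hsub⟩ := Metric.mem_nhds_iff.1 (mem_interior_iff_mem_nhds.1 h)
  obtain ⟨v, hv⟩ := exists_ne (0 : E)
  have hn : 0 < ‖v‖ := norm_pos_iff.2 hv
  have hs : 0 < r / (2 * ‖v‖) := by positivity
  have hw : ‖(r / (2 * ‖v‖)) • v‖ < r := by
    rw [norm_smul, Real.norm_of_nonneg hs.le, show r / (2 * ‖v‖) * ‖v‖ = r / 2 by field_simp]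
    linarith
  have h1 : (r / (2 * ‖v‖)) • v = 0 :=
    hK.eq_zero (hsub (mem_ball_zero_iff.2 hw)) (hsub (mem_ball_zero_iff.2 (by rwa [norm_neg])))
  exact hv ((smul_eq_zero_iff_right hs.ne').1 h1)

end IsClosedConvexCone

/-- A set stable under nonnegative multiples lies in every half-space `{f ≥ u}`, `u` arbitrary,
only if it lies in `{f ≥ 0}`. -/
theorem nonneg_of_forall_lt {K : Set E} (hsmul : ∀ a : ℝ, 0 ≤ a → ∀ v ∈ K, a • v ∈ K)
    {f : E →L[ℝ] ℝ} {u : ℝ} (hu : ∀ b ∈ K, u < f b) {v : E} (hv : v ∈ K) : 0 ≤ f v := by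
  by_contra! hneg
  obtain ⟨N, hN⟩ := exists_nat_gt (u / f v)
  have h1 := hu _ (hsmul N N.cast_nonneg v hv)
  rw [div_lt_iff_of_neg hneg] at hN
  simp only [map_smul, smul_eq_mul] at h1
  linarith

/-- Mean value inclusion: the increments of a curve whose right velocity lies in a closed convex
cone belong to the cone. -/
theorem sub_mem_of_rightDeriv_mem {K : Set E} (hc : IsClosed K) (h0 : (0 : E) ∈ K)
    (hadd : ∀ u ∈ K, ∀ v ∈ K, u + v ∈ K) (hsmul : ∀ a : ℝ, 0 ≤ a → ∀ v ∈ K, a • v ∈ K)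
    {g g' : ℝ → E} {a b : ℝ} (hab : a ≤ b) (hg : ContinuousOn g (Icc a b))
    (hg' : ∀ t ∈ Ico a b, HasDerivWithinAt g (g' t) (Ici t) t) (hK : ∀ t ∈ Ico a b, g' t ∈ K) :
    g b - g a ∈ K := by
  by_contra hnot
  have hconv : Convex ℝ K := fun x hx y hy a b ha hb _ ↦
    hadd _ (hsmul a ha x hx) _ (hsmul b hb y hy)
  obtain ⟨f, u, hfu, hu⟩ := geometric_hahn_banach_point_closed hconv hc hnot
  have hu0 : u < 0 := by simpa using hu 0 h0
  have := image_le_of_deriv_right_le_deriv_boundary (f := fun _ ↦ f (g a)) (f' := fun _ ↦ 0)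
    (B := fun t ↦ f (g t)) (B' := fun t ↦ f (g' t)) continuousOn_const
    (fun t _ ↦ hasDerivWithinAt_const _ _ _) le_rfl (f.continuous.comp_continuousOn hg)
    (fun t ht ↦ f.hasFDerivAt.comp_hasDerivWithinAt t (hg' t ht))
    (fun t ht ↦ nonneg_of_forall_lt hsmul hu (hK t ht)) (right_mem_Icc.2 hab)
  rw [map_sub] at hfu
  linarith

/-- A pointed closed convex cone has a strictly positive functional. -/
theorem IsClosedConvexCone.exists_norm_le [FiniteDimensional ℝ E] {K : Set E}
    (hK : IsClosedConvexCone K) :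
    ∃ l : E →L[ℝ] ℝ, ∀ w ∈ K, ‖w‖ ≤ l w := by
  have : ProperSpace E := FiniteDimensional.proper ℝ E
  have hS : IsCompact (K ∩ Metric.sphere (0 : E) 1) :=
    (isCompact_sphere 0 1).inter_left hK.isClosed
  have hsep : ∀ w : E, ∃ f : E →L[ℝ] ℝ, (∀ v ∈ K, 0 ≤ f v) ∧
      (w ∈ K ∩ Metric.sphere (0 : E) 1 → 0 < f w) := by
    intro w
    by_cases hw : w ∈ K ∩ Metric.sphere (0 : E) 1
    · have hnot : -w ∉ K := fun h ↦ by
        have h1 := hK.eq_zero hw.1 h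
        simpa [h1] using hw.2
      obtain ⟨f, u, hfu, hu⟩ := geometric_hahn_banach_point_closed hK.convex hK.isClosed hnot
      have hu0 : u < 0 := by simpa using hu 0 hK.zero_mem
      refine ⟨f, fun v hv ↦ nonneg_of_forall_lt hK.smul_mem hu hv, fun _ ↦ ?_⟩
      rw [map_neg] at hfu
      linarith
    · exact ⟨0, fun _ _ ↦ le_rfl, fun h ↦ absurd h hw⟩
  choose f hf0 hfpos using hsep
  obtain ⟨t, htS, ht⟩ := hS.elim_nhds_subcover (fun w ↦ {v | 0 < f w v}) fun w hw ↦
    (isOpen_lt continuous_const (f w).continuous).mem_nhds (hfpos w hw)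
  have hpos : ∀ v ∈ K ∩ Metric.sphere (0 : E) 1, 0 < (∑ w ∈ t, f w) v := by
    intro v hv
    obtain ⟨w, hw, hvw⟩ := mem_iUnion₂.1 (ht hv)
    rw [sum_apply]
    exact Finset.sum_pos' (fun w _ ↦ hf0 w v hv.1) ⟨w, hw, hvw⟩
  obtain ⟨c, hc, hcl⟩ : ∃ c > 0, ∀ v ∈ K ∩ Metric.sphere (0 : E) 1, c ≤ (∑ w ∈ t, f w) v := by
    rcases (K ∩ Metric.sphere (0 : E) 1).eq_empty_or_nonempty with he | hne
    · exact ⟨1, one_pos, by simp [he]⟩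
    · obtain ⟨v, hv, hmin⟩ := hS.exists_isMinOn hne (∑ w ∈ t, f w).continuous.continuousOn
      exact ⟨_, hpos v hv, hmin⟩
  refine ⟨c⁻¹ • ∑ w ∈ t, f w, fun w hw ↦ ?_⟩
  rcases eq_or_ne w 0 with rfl | hw0
  · simp
  have hn : 0 < ‖w‖ := norm_pos_iff.2 hw0
  have h1 := hcl (‖w‖⁻¹ • w) ⟨hK.smul_mem _ (by positivity) w hw, by
    simp [norm_smul, hn.ne']⟩
  rw [map_smul, smul_eq_mul, inv_mul_eq_div, le_div_iff₀ hn] at h1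
  rw [smul_apply, smul_eq_mul, inv_mul_eq_div, le_div_iff₀ hc]
  linarith

/-- The enlargement of the cone `K` by an angle of order `ε`, measured by a functional `l` that is
positive on `K`. The additivity of `l` on `K` makes the enlargement convex. -/
def fatCone (K : Set E) (l : E →L[ℝ] ℝ) (ε : ℝ) : Set E :=
  {v | ∃ w ∈ K, ‖v - w‖ ≤ ε * l w}

section Fat

variable {K : Set E} {l : E →L[ℝ] ℝ} {ε : ℝ}

theorem IsClosedConvexCone.zero_mem_fatCone (hK : IsClosedConvexCone K) :
    (0 : E) ∈ fatCone K l ε := ⟨0, hK.zero_mem, by simp⟩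

theorem IsClosedConvexCone.add_mem_fatCone (hK : IsClosedConvexCone K) :
    ∀ u ∈ fatCone K l ε, ∀ v ∈ fatCone K l ε, u + v ∈ fatCone K l ε := by
  rintro u ⟨w, hw, hu⟩ v ⟨z, hz, hv⟩
  refine ⟨w + z, hK.add_mem _ hw _ hz, ?_⟩
  calc ‖u + v - (w + z)‖ = ‖(u - w) + (v - z)‖ := by congr 1; abel
    _ ≤ ‖u - w‖ + ‖v - z‖ := norm_add_le _ _
    _ ≤ ε * l w + ε * l z := add_le_add hu hv
    _ = ε * l (w + z) := by rw [map_add]; ring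

theorem IsClosedConvexCone.smul_mem_fatCone (hK : IsClosedConvexCone K) :
    ∀ a : ℝ, 0 ≤ a → ∀ v ∈ fatCone K l ε, a • v ∈ fatCone K l ε := by
  rintro a ha v ⟨w, hw, hv⟩
  refine ⟨a • w, hK.smul_mem a ha w hw, ?_⟩
  rw [← smul_sub, norm_smul, Real.norm_of_nonneg ha, map_smul, smul_eq_mul]
  nlinarith

/-- A vector of the enlarged cone is close to the vector of the cone that witnesses it, relative to
the size of the latter. -/
theorem norm_sub_le_of_mem {v w : E} (hε : 0 ≤ ε) (h : ‖v - w‖ ≤ ε * l w) :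
    ‖v - w‖ ≤ ε * ‖l‖ * ‖w‖ := by
  have := (le_abs_self _).trans (l.le_opNorm w)
  calc ‖v - w‖ ≤ ε * l w := h
    _ ≤ ε * (‖l‖ * ‖w‖) := by gcongr
    _ = _ := by ring

theorem IsClosedConvexCone.isClosed_fatCone [FiniteDimensional ℝ E] (hK : IsClosedConvexCone K)
    (hε : 0 ≤ ε) (hεl : ε * ‖l‖ ≤ 1 / 2) : IsClosed (fatCone K l ε) := by
  have : ProperSpace E := FiniteDimensional.proper ℝ E
  refine isClosed_of_closure_subset fun v hv ↦ ?_
  obtain ⟨u, hu, huv⟩ := mem_closure_iff_seq_limit.1 hv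
  choose w hw huw using hu
  have hbd : ∀ k, ‖w k‖ ≤ 2 * ‖u k‖ := fun k ↦ by
    have h1 := norm_sub_le_of_mem hε (huw k)
    have h2 := norm_sub_norm_le (w k) (u k)
    rw [norm_sub_rev] at h2
    have h3 : ε * ‖l‖ * ‖w k‖ ≤ 1 / 2 * ‖w k‖ := by gcongr
    linarith
  obtain ⟨R, hR⟩ := (Metric.isBounded_range_of_tendsto u huv).exists_norm_le
  obtain ⟨z, -, σ, hσ, hz⟩ := tendsto_subseq_of_bounded (Metric.isBounded_closedBall (x := (0 : E))
    (r := 2 * R)) (x := w) fun k ↦ by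
      have := hR _ (mem_range_self k)
      have := hbd k
      simp only [mem_closedBall_zero_iff]
      linarith
  refine ⟨z, hK.isClosed.mem_of_tendsto hz (Eventually.of_forall fun k ↦ hw _), ?_⟩
  exact le_of_tendsto_of_tendsto (((huv.comp hσ.tendsto_atTop).sub hz).norm)
    (((l.continuous.tendsto z).comp hz).const_mul ε) (Eventually.of_forall fun k ↦ huw (σ k))

end Fat

variable {F : Type*} [NormedAddCommGroup F] [NormedSpace ℝ F]

/-- A linear map that sends a cone strictly inside another one does so with a uniform margin. -/
theorem IsClosedConvexCone.exists_closedBall_subset [FiniteDimensional ℝ E] {K : Set E}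
    (hK : IsClosedConvexCone K) {K' : Set F} (hK' : IsClosedConvexCone K') {D : E →L[ℝ] F}
    (hD : ∀ w ∈ K, w ≠ 0 → D w ∈ interior K') :
    ∃ c > 0, ∀ w ∈ K, Metric.closedBall (D w) (c * ‖w‖) ⊆ K' := by
  have : ProperSpace E := FiniteDimensional.proper ℝ E
  have hS : IsCompact (D '' (K ∩ Metric.sphere (0 : E) 1)) :=
    ((isCompact_sphere 0 1).inter_left hK.isClosed).image D.continuous
  obtain ⟨c, hc, hsub⟩ := hS.exists_cthickening_subset_open isOpen_interior (by
    rintro _ ⟨w, hw, rfl⟩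
    refine hD w hw.1 fun h ↦ ?_
    simpa [h] using hw.2)
  refine ⟨c, hc, fun w hw v hv ↦ ?_⟩
  rcases eq_or_ne w 0 with rfl | hw0
  · simp only [map_zero, norm_zero, mul_zero, Metric.closedBall_zero, mem_singleton_iff] at hv
    exact hv ▸ hK'.zero_mem
  have hn : 0 < ‖w‖ := norm_pos_iff.2 hw0
  have hmem : ‖w‖⁻¹ • v ∈ K' := by
    refine interior_subset (hsub (Metric.mem_cthickening_of_dist_le _ (D (‖w‖⁻¹ • w)) _ _
      ⟨_, ⟨hK.smul_mem _ (by positivity) w hw, by simp [norm_smul, hn.ne']⟩, rfl⟩ ?_))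
    rw [map_smul, dist_smul₀, Real.norm_of_nonneg (by positivity), inv_mul_eq_div, div_le_iff₀ hn]
    exact hv
  simpa [smul_smul, hn.ne'] using hK'.smul_mem ‖w‖ hn.le _ hmem

/-- The parameter of the enlarged cone can be chosen small relative to the functional. -/
theorem exists_small {l : E →L[ℝ] ℝ} {b : ℝ} (hb : 0 < b) : ∃ ε > 0, ε * ‖l‖ ≤ b := by
  refine ⟨b / (‖l‖ + 1), by positivity, ?_⟩
  rw [div_mul_eq_mul_div, div_le_iff₀ (by positivity)]
  nlinarith [norm_nonneg l]

/-- A linear map that sends a cone strictly inside another one does the same with a small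
enlargement of the first cone. -/
theorem IsClosedConvexCone.exists_closedBall_subset_of_mem_fatCone [FiniteDimensional ℝ E]
    {K : Set E} (hK : IsClosedConvexCone K) {K' : Set F} (hK' : IsClosedConvexCone K')
    {D : E →L[ℝ] F} (hD : ∀ w ∈ K, w ≠ 0 → D w ∈ interior K') (l : E →L[ℝ] ℝ) :
    ∃ c > 0, ∃ ε > 0, ε * ‖l‖ ≤ 1 / 2 ∧
      ∀ v ∈ fatCone K l ε, Metric.closedBall (D v) (c * ‖v‖) ⊆ K' := by
  obtain ⟨c, hc, hcK⟩ := hK.exists_closedBall_subset hK' hD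
  obtain ⟨ε, hε, hεl⟩ := exists_small (l := l) (b := min (1 / 2) (c / 2 / (‖D‖ + 1)))
    (by positivity)
  refine ⟨c / 4, by positivity, ε, hε, hεl.trans (min_le_left _ _), ?_⟩
  rintro v ⟨w, hw, hvw⟩ z hz
  refine hcK w hw ?_
  have h1 := norm_sub_le_of_mem hε.le hvw
  have h2 : ‖v - w‖ ≤ 1 / 2 * ‖w‖ := h1.trans (by gcongr; exact hεl.trans (min_le_left _ _))
  have h3 : ‖v - w‖ ≤ c / 2 / (‖D‖ + 1) * ‖w‖ :=
    h1.trans (by gcongr; exact hεl.trans (min_le_right _ _))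
  have h4 : ‖v‖ ≤ 2 * ‖w‖ := by
    have := norm_le_norm_add_norm_sub' v w
    linarith [norm_nonneg w]
  have h5 : ‖D v - D w‖ ≤ c / 2 * ‖w‖ := by
    rw [← map_sub]
    calc ‖D (v - w)‖ ≤ (‖D‖ + 1) * ‖v - w‖ :=
          (D.le_opNorm _).trans (by gcongr; linarith)
      _ ≤ (‖D‖ + 1) * (c / 2 / (‖D‖ + 1) * ‖w‖) := by gcongr
      _ = c / 2 * ‖w‖ := by field_simp
  rw [Metric.mem_closedBall, dist_eq_norm] at hz ⊢
  calc ‖z - D w‖ ≤ ‖z - D v‖ + ‖D v - D w‖ := norm_sub_le_norm_sub_add_norm_sub _ _ _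
    _ ≤ c / 4 * ‖v‖ + c / 2 * ‖w‖ := add_le_add hz h5
    _ ≤ c / 4 * (2 * ‖w‖) + c / 2 * ‖w‖ := by gcongr
    _ = c * ‖w‖ := by ring

/-- A strongly positive linear map that fixes a vector `u` outside `K ∪ -K` is eventually
expanding on `K`, at a uniform rate: its Perron eigenvalue exceeds the eigenvalue of `u`. The proof
follows the largest multiple of `u` that can be subtracted in `K` along the iterates. -/
theorem IsClosedConvexCone.exists_le_norm_pow [FiniteDimensional ℝ E] {K : Set E}
    (hK : IsClosedConvexCone K) {D : E →L[ℝ] E} (hD : ∀ w ∈ K, w ≠ 0 → D w ∈ interior K) {u : E}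
    (hu : D u = u) (huK : u ∉ K) (huK' : -u ∉ K) (κ : ℝ) :
    ∃ m : ℕ, 1 ≤ m ∧ ∀ w ∈ K, κ * ‖w‖ ≤ ‖(D ^ m) w‖ := by
  obtain ⟨c₀, hc₀, hcK⟩ := hK.exists_closedBall_subset hK hD
  have hu0 : 0 < ‖u‖ := norm_pos_iff.2 fun h ↦ huK (h ▸ hK.zero_mem)
  obtain ⟨δ₁, hδ₁, h₁⟩ := Metric.mem_nhds_iff.1 (hK.isClosed.isOpen_compl.mem_nhds huK)
  obtain ⟨δ₂, hδ₂, h₂⟩ := Metric.mem_nhds_iff.1 (hK.isClosed.isOpen_compl.mem_nhds huK')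
  -- `D w` dominates the multiple `c ‖w‖` of `u`
  set c := c₀ / ‖u‖
  have hc : 0 < c := by positivity
  have hDw : ∀ w ∈ K, ∀ s, 0 ≤ s → s ≤ c * ‖w‖ → D w - s • u ∈ K := by
    intro w hw s hs hsc
    refine hcK w hw ?_
    rw [Metric.mem_closedBall, dist_eq_norm, sub_sub_cancel_left, norm_neg, norm_smul,
      Real.norm_of_nonneg hs]
    calc s * ‖u‖ ≤ c * ‖w‖ * ‖u‖ := by gcongr
      _ = c₀ * ‖w‖ := by simp only [c]; field_simp
  -- as `u` is outside `K`, what remains after subtracting a multiple of `u` has a definite size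
  have hlow : ∀ w ∈ K, ∀ s, 0 < s → s * δ₁ ≤ ‖w - s • u‖ := by
    intro w hw s hs
    by_contra! hlt
    refine h₁ (a := s⁻¹ • w) ?_ (hK.smul_mem _ (by positivity) w hw)
    rw [Metric.mem_ball, dist_eq_norm]
    have h3 : s⁻¹ • w - u = s⁻¹ • (w - s • u) := by
      rw [smul_sub, smul_smul, inv_mul_cancel₀ hs.ne', one_smul]
    rw [h3, norm_smul, Real.norm_of_nonneg (by positivity), inv_mul_eq_div, div_lt_iff₀ hs]
    linarith
  have hup : ∀ w ∈ K, ∀ s, 0 < s → w - s • u ∈ K → s * δ₂ ≤ ‖w‖ := by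
    intro w hw s hs hws
    by_contra! hlt
    refine h₂ (a := s⁻¹ • (w - s • u)) ?_ (hK.smul_mem _ (by positivity) _ hws)
    rw [Metric.mem_ball, dist_eq_norm, smul_sub, smul_smul, inv_mul_cancel₀ hs.ne', one_smul,
      sub_neg_eq_add, sub_add_cancel, norm_smul, Real.norm_of_nonneg (by positivity),
      inv_mul_eq_div, div_lt_iff₀ hs]
    linarith
  set r := 1 + c * δ₁
  have hr : 1 < r := by simp only [r]; linarith [mul_pos hc hδ₁]
  have hstep : ∀ w ∈ K, ∀ s, 0 < s → w - s • u ∈ K → D w - (r * s) • u ∈ K := by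
    intro w hw s hs hws
    have h3 := hlow w hw s hs
    have h4 := hDw _ hws (c * δ₁ * s) (by positivity) (by
      calc c * δ₁ * s = c * (s * δ₁) := by ring
        _ ≤ _ := by gcongr)
    rw [map_sub, map_smul, hu, sub_sub, ← add_smul] at h4
    rwa [show r * s = s + c * δ₁ * s by simp only [r]; ring]
  have hDK : ∀ w ∈ K, D w ∈ K := fun w hw ↦ by simpa using hDw w hw 0 le_rfl (by positivity)
  have hpowK : ∀ k : ℕ, ∀ w ∈ K, (D ^ k) w ∈ K := by
    intro k
    induction k with
    | zero => simp
    | succ k ih =>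
      intro w hw
      rw [pow_succ']
      exact hDK _ (ih w hw)
  have hiter : ∀ k : ℕ, ∀ w ∈ K, w ≠ 0 → (D ^ (k + 1)) w - (r ^ k * (c * ‖w‖)) • u ∈ K := by
    intro k w hw hw0
    have hn : 0 < ‖w‖ := norm_pos_iff.2 hw0
    induction k with
    | zero => simpa using hDw w hw (c * ‖w‖) (by positivity) le_rfl
    | succ k ih =>
      have := hstep _ (hpowK _ w hw) _ (by positivity) ih
      rw [← mul_assoc, ← pow_succ'] at this
      rwa [pow_succ' D (k + 1)]
  obtain ⟨k, hk⟩ := pow_unbounded_of_one_lt (κ / (c * δ₂)) hr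
  refine ⟨k + 1, by omega, fun w hw ↦ ?_⟩
  rcases eq_or_ne w 0 with rfl | hw0
  · simp
  have hn : 0 < ‖w‖ := norm_pos_iff.2 hw0
  have h5 := hup _ (hpowK (k + 1) w hw) _ (by positivity) (hiter k w hw hw0)
  refine le_trans ?_ h5
  rw [div_lt_iff₀ (by positivity)] at hk
  calc κ * ‖w‖ ≤ r ^ k * (c * δ₂) * ‖w‖ := by gcongr
    _ = _ := by ring

/-- Uniform expansion on a cone extends to a small enlargement of the cone. -/
theorem IsClosedConvexCone.exists_le_norm_of_mem_fatCone {K : Set E} {A : E →L[ℝ] F} {κ : ℝ}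
    (hκ : 0 ≤ κ) (hA : ∀ w ∈ K, (2 * κ + 1) * ‖w‖ ≤ ‖A w‖) (l : E →L[ℝ] ℝ) :
    ∃ ε > 0, ε * ‖l‖ ≤ 1 / 2 ∧ ∀ v ∈ fatCone K l ε, κ * ‖v‖ ≤ ‖A v‖ := by
  obtain ⟨ε, hε, hεl⟩ := exists_small (l := l) (b := min (1 / 2) (1 / (‖A‖ + 1))) (by positivity)
  refine ⟨ε, hε, hεl.trans (min_le_left _ _), ?_⟩
  rintro v ⟨w, hw, hvw⟩
  have h1 := norm_sub_le_of_mem hε.le hvw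
  have h2 : ‖v - w‖ ≤ 1 / 2 * ‖w‖ := h1.trans (by gcongr; exact hεl.trans (min_le_left _ _))
  have h3 : ‖v - w‖ ≤ 1 / (‖A‖ + 1) * ‖w‖ :=
    h1.trans (by gcongr; exact hεl.trans (min_le_right _ _))
  have h4 : ‖v‖ ≤ 2 * ‖w‖ := by
    have := norm_le_norm_add_norm_sub' v w
    linarith [norm_nonneg w]
  have h5 : ‖A v - A w‖ ≤ ‖w‖ := by
    rw [← map_sub]
    calc ‖A (v - w)‖ ≤ (‖A‖ + 1) * ‖v - w‖ :=
          (A.le_opNorm _).trans (by gcongr; linarith)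
      _ ≤ (‖A‖ + 1) * (1 / (‖A‖ + 1) * ‖w‖) := by gcongr
      _ = ‖w‖ := by field_simp
  have h6 := hA w hw
  have h7 := norm_le_norm_add_norm_sub (A v) (A w)
  calc κ * ‖v‖ ≤ κ * (2 * ‖w‖) := by gcongr
    _ ≤ ‖A v‖ := by linarith

end Cone

/-! ### Conal curves -/

section Curves

variable {n : ℕ} {M : Type*} [TopologicalSpace M] [ChartedSpace (EuclideanSpace ℝ (Fin n)) M]
  {C : ∀ x : M, Set (TangentSpace (𝓡 n) x)}

theorem contMDiffWithinAt_singleton {γ : ℝ → M} {t : ℝ} :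
    ContMDiffWithinAt 𝓘(ℝ, ℝ) (𝓡 n) ∞ γ {t} t := by
  refine ⟨continuousWithinAt_singleton, ?_⟩
  have : ContDiffWithinAt ℝ ∞ (writtenInExtChartAt 𝓘(ℝ, ℝ) (𝓡 n) t γ) {t} t :=
    contDiffWithinAt_singleton
  simpa [ContDiffWithinAtProp, writtenInExtChartAt] using! this

/-- A piecewise smooth curve is differentiable from the right: `t` lies in the interior, or at the
left end, of the last piece that starts at or before `t`. -/
theorem IsPiecewiseSmoothOn.mdifferentiableWithinAt {γ : ℝ → M} {a b t : ℝ}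
    (h : IsPiecewiseSmoothOn n γ a b) (ht : t ∈ Ico a b) :
    MDifferentiableWithinAt 𝓘(ℝ, ℝ) (𝓡 n) γ (Ici t) t := by
  obtain ⟨-, k, s, hs, hs0, hsk, hsm⟩ := h
  have hex : ∃ i, t < s i := ⟨k, hsk ▸ ht.2⟩
  classical
  have hi := Nat.find_spec hex
  have hmin := fun j ↦ Nat.find_min hex (m := j)
  have hle : Nat.find hex ≤ k := Nat.find_min' hex (hsk ▸ ht.2)
  set i := Nat.find hex
  obtain ⟨j, hj⟩ : ∃ j, i = j + 1 := Nat.exists_eq_succ_of_ne_zero fun h0 ↦ by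
    rw [h0, hs0] at hi
    exact absurd ht.1 (not_le.2 hi)
  have hjt : s j ≤ t := not_lt.1 (hmin j (by omega))
  rw [hj] at hi
  have hd := (hsm j (by omega) t ⟨hjt, hi.le⟩).mdifferentiableWithinAt (by simp)
  refine hd.mono_of_mem_nhdsWithin ?_
  exact mem_of_superset (Icc_mem_nhdsGE hi) (Icc_subset_Icc_left hjt)

/-- The tangent spaces at equal points are identified with the same model space; this transfers
membership in the cones along an equality of base points. -/
theorem mem_of_eq_of_mem {K : ∀ x : M, Set (TangentSpace (𝓡 n) x)} {x y : M} (h : x = y)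
    {v : TangentSpace (𝓡 n) x} {w : TangentSpace (𝓡 n) y}
    (hvw : (v : EuclideanSpace ℝ (Fin n)) = w) (hv : v ∈ K x) : w ∈ K y := by
  subst h
  obtain rfl : v = w := hvw
  exact hv

/-- Restriction of a conal curve. The subdivision points are clamped to `[c, d]`. -/
theorem IsConalCurve.mono {γ : ℝ → M} {a b c d : ℝ} (h : IsConalCurve C γ a b) (hac : a ≤ c)
    (hcd : c ≤ d) (hdb : d ≤ b) : IsConalCurve C γ c d := by
  obtain ⟨⟨hγ, k, s, hs, hs0, hsk, hsm⟩, hv⟩ := h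
  refine ⟨⟨hγ.mono (Icc_subset_Icc hac hdb), k, fun i ↦ max c (min (s i) d), ?_, ?_, ?_, ?_⟩,
    fun t ht ↦ hv t ⟨hac.trans ht.1, ht.2.trans_le hdb⟩⟩
  · exact fun i j hij ↦ max_le_max le_rfl (min_le_min (hs hij) le_rfl)
  · simp only [hs0, min_eq_left (hac.trans hcd), max_eq_left hac]
  · simp only [hsk, min_eq_right hdb, max_eq_right hcd]
  · intro i hi
    simp only
    -- the pieces outside `[c, d]` degenerate to single points
    rcases (max_le_max_left c (min_le_min_right d (hs i.le_succ))).eq_or_lt with heq | hlt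
    · rw [← Nat.succ_eq_add_one, ← heq, Icc_self]
      rintro t rfl
      exact contMDiffWithinAt_singleton
    · refine (hsm i hi).mono (Icc_subset_Icc ?_ ?_)
      · rcases le_total (s i) d with h1 | h1
        · exact (le_min le_rfl h1).trans (le_max_right _ _)
        · rw [min_eq_right h1, min_eq_right (h1.trans (hs i.le_succ))] at hlt
          exact absurd hlt (lt_irrefl _)
      · rcases le_total c (s (i + 1)) with h1 | h1
        · exact max_le h1 (min_le_left _ _)
        · rw [← Nat.succ_eq_add_one] at h1
          rw [max_eq_left ((min_le_left _ _).trans h1)] at hlt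
          exact absurd ((le_max_left _ _).trans_lt hlt) (lt_irrefl _)

/-- Translation of the parameter of a conal curve. -/
theorem IsConalCurve.comp_sub_const {γ : ℝ → M} {a b : ℝ} (h : IsConalCurve C γ a b) (c : ℝ) :
    IsConalCurve C (fun t ↦ γ (t - c)) (a + c) (b + c) := by
  have hmaps : ∀ p q : ℝ, MapsTo (fun t ↦ t - c) (Icc (p + c) (q + c)) (Icc p q) := by
    intro p q t ht
    constructor <;> linarith [ht.1, ht.2]
  obtain ⟨hps, hv⟩ := h
  have hps' := hps
  obtain ⟨hγ, k, s, hs, hs0, hsk, hsm⟩ := hps'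
  refine ⟨⟨hγ.comp (by fun_prop) (hmaps a b), k, fun i ↦ s i + c,
    fun i j hij ↦ by simpa using hs hij, by simp [hs0], by simp [hsk], fun i hi ↦ ?_⟩, ?_⟩
  · have hsub : ContMDiffOn 𝓘(ℝ, ℝ) 𝓘(ℝ, ℝ) ∞ (fun t : ℝ ↦ t - c) (Icc (s i + c) (s (i + 1) + c)) :=
      (contDiff_id.sub contDiff_const).contMDiff.contMDiffOn
    exact (hsm i hi).comp hsub (hmaps _ _)
  · intro t ht
    have ht' : t - c ∈ Ico a b := ⟨by linarith [ht.1], by linarith [ht.2]⟩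
    have h1 := (hps.mdifferentiableWithinAt ht').hasMFDerivWithinAt
    have h2 : HasMFDerivWithinAt 𝓘(ℝ, ℝ) 𝓘(ℝ, ℝ) (fun t : ℝ ↦ t - c) (Ici t) t
        (ContinuousLinearMap.id ℝ ℝ) :=
      ((hasFDerivAt_id t).sub_const c).hasFDerivWithinAt.hasMFDerivWithinAt
    have h3 : HasMFDerivWithinAt 𝓘(ℝ, ℝ) (𝓡 n) (fun t ↦ γ (t - c)) (Ici t) t _ :=
      HasMFDerivWithinAt.comp t h1 h2 fun r (hr : t ≤ r) ↦ by simpa using hr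
    have h4 := h3.mfderivWithin (uniqueDiffOn_Ici t t self_mem_Ici).uniqueMDiffWithinAt
    have h5 : rightVelocity n (fun t ↦ γ (t - c)) t = rightVelocity n γ (t - c) := by
      unfold rightVelocity
      rw [h4]
      rfl
    rw [h5]
    exact hv _ ht'

/-- Concatenation of conal curves. Velocities are right-hand derivatives, so the break point `b`
belongs to the second curve. -/
theorem IsConalCurve.trans {γ₁ γ₂ : ℝ → M} {a b c : ℝ} (h₁ : IsConalCurve C γ₁ a b)
    (h₂ : IsConalCurve C γ₂ b c) (hab : a < b) (hbc : b < c) (hb : γ₁ b = γ₂ b) :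
    IsConalCurve C (fun t ↦ if t < b then γ₁ t else γ₂ t) a c := by
  obtain ⟨⟨hc₁, k₁, s₁, hs₁, hs0₁, hsk₁, hsm₁⟩, hv₁⟩ := h₁
  obtain ⟨⟨hc₂, k₂, s₂, hs₂, hs0₂, hsk₂, hsm₂⟩, hv₂⟩ := h₂
  set γ : ℝ → M := fun t ↦ if t < b then γ₁ t else γ₂ t
  have hγ₁ : ∀ t ≤ b, γ t = γ₁ t := by
    intro t ht
    rcases ht.eq_or_lt with rfl | ht
    · simp [γ, hb]
    · simp [γ, ht]
  have hγ₂ : ∀ t, b ≤ t → γ t = γ₂ t := fun t ht ↦ by simp [γ, not_lt.2 ht]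
  refine ⟨⟨?_, k₁ + k₂, fun i ↦ if i < k₁ then s₁ i else s₂ (i - k₁), ?_, ?_, ?_, ?_⟩, ?_⟩
  · rw [← Icc_union_Icc_eq_Icc hab.le hbc.le]
    exact (hc₁.congr fun t ht ↦ hγ₁ t ht.2).union_of_isClosed (hc₂.congr fun t ht ↦ hγ₂ t ht.1)
      isClosed_Icc isClosed_Icc
  · refine monotone_nat_of_le_succ fun i ↦ ?_
    rcases lt_trichotomy (i + 1) k₁ with hi | hi | hi
    · rw [if_pos hi, if_pos (by omega)]
      exact hs₁ i.le_succ
    · rw [if_pos (by omega), if_neg (by omega), hi, Nat.sub_self, hs0₂, ← hsk₁]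
      exact hs₁ (by omega)
    · rw [if_neg (by omega), if_neg (by omega)]
      exact hs₂ (by omega)
  · have hk : 0 < k₁ := Nat.pos_of_ne_zero fun h0 ↦ by
      rw [h0, hs0₁] at hsk₁
      exact hab.ne hsk₁
    simp [hk, hs0₁]
  · simp [hsk₂]
  · intro i hi
    rcases lt_or_ge i k₁ with hik | hik
    · have heq : (if i + 1 < k₁ then s₁ (i + 1) else s₂ (i + 1 - k₁)) = s₁ (i + 1) := by
        split_ifs with hlt
        · rfl
        · obtain rfl : k₁ = i + 1 := by omega
          rw [Nat.sub_self, hs0₂, hsk₁]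
      simp only [if_pos hik, heq]
      refine (hsm₁ i hik).congr fun t ht ↦ hγ₁ t (ht.2.trans ?_)
      rw [← hsk₁]
      exact hs₁ hik
    · simp only [if_neg (not_lt.2 hik), if_neg (show ¬ i + 1 < k₁ by omega)]
      rw [show i + 1 - k₁ = i - k₁ + 1 by omega]
      refine (hsm₂ (i - k₁) (by omega)).congr fun t ht ↦ hγ₂ t (le_trans ?_ ht.1)
      rw [← hs0₂]
      exact hs₂ (Nat.zero_le _)
  · intro t ht
    rcases lt_or_ge t b with htb | htb
    · refine mem_of_eq_of_mem (hγ₁ t htb.le).symm ?_ (hv₁ t ⟨ht.1, htb⟩)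
      have hev : γ =ᶠ[𝓝[Ici t] t] γ₁ := by
        filter_upwards [mem_nhdsWithin_of_mem_nhds (Iio_mem_nhds htb)] with r hr
        exact hγ₁ r (le_of_lt hr)
      have := hev.mfderivWithin_eq (I := 𝓘(ℝ, ℝ)) (I' := 𝓡 n) (hγ₁ t htb.le)
      exact congrArg (fun L : ℝ →L[ℝ] EuclideanSpace ℝ (Fin n) ↦ L 1) this.symm
    · refine mem_of_eq_of_mem (hγ₂ t htb).symm ?_ (hv₂ t ⟨htb, ht.2⟩)
      have hev : γ =ᶠ[𝓝[Ici t] t] γ₂ := by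
        filter_upwards [self_mem_nhdsWithin] with r (hr : t ≤ r)
        exact hγ₂ r (htb.trans hr)
      have := hev.mfderivWithin_eq (I := 𝓘(ℝ, ℝ)) (I' := 𝓡 n) (hγ₂ t htb)
      exact congrArg (fun L : ℝ →L[ℝ] EuclideanSpace ℝ (Fin n) ↦ L 1) this.symm

theorem ConalLE.trans {x y z : M} (hxy : ConalLE C x y) (hyz : ConalLE C y z) : ConalLE C x z := by
  obtain ⟨γ₁, a, b, hab, h₁, rfl, rfl⟩ := hxy
  obtain ⟨γ₂, c, d, hcd, h₂, hc, rfl⟩ := hyz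
  have h₂' := h₂.comp_sub_const (b - c)
  rw [add_sub_cancel] at h₂'
  have hbd : b < d + (b - c) := by linarith
  refine ⟨_, a, d + (b - c), hab.trans hbd, h₁.trans h₂' hab hbd ?_, ?_, ?_⟩
  · simp [hc]
  · simp [hab]
  · simp [not_lt.2 hbd.le]

/-- A strictly conal curve is a conal curve for the field of the interiors of the cones. -/
theorem ConalLL.trans {x y z : M} (hxy : ConalLL C x y) (hyz : ConalLL C y z) : ConalLL C x z :=
  ConalLE.trans (C := fun x ↦ interior (C x)) hxy hyz

theorem ConalLL.conalLE {x y : M} (h : ConalLL C x y) : ConalLE C x y := by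
  obtain ⟨γ, a, b, hab, h, hx, hy⟩ := h
  exact ⟨γ, a, b, hab, ⟨h.1, fun t ht ↦ interior_subset (h.2 t ht)⟩, hx, hy⟩

end Curves

/-! ### The conal order in a chart -/

section LocalOrder

variable {n : ℕ} {M : Type*} [TopologicalSpace M] [ChartedSpace (EuclideanSpace ℝ (Fin n)) M]
  {C : ∀ x : M, Set (TangentSpace (𝓡 n) x)}

/-- The cone at `x`, as a subset of the model space: tangent vectors at `x` are identified with
their coordinates in the preferred chart at `x`. -/
def coneAt (C : ∀ x : M, Set (TangentSpace (𝓡 n) x)) (x : M) : Set (EuclideanSpace ℝ (Fin n)) := C x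

/-- The derivative at `y` of the preferred chart at `e`. -/
noncomputable def chartDeriv (e y : M) : TangentSpace (𝓡 n) y →L[ℝ] EuclideanSpace ℝ (Fin n) :=
  mfderiv (𝓡 n) (𝓡 n) (extChartAt (𝓡 n) e) y

theorem hasDerivWithinAt_extChartAt_comp [IsManifold (𝓡 n) ∞ M] {γ : ℝ → M} {t : ℝ} {s : Set ℝ}
    {v : TangentSpace (𝓡 n) (γ t)}
    (hγ : HasMFDerivWithinAt 𝓘(ℝ, ℝ) (𝓡 n) γ s t ((1 : ℝ →L[ℝ] ℝ).smulRight v)) {e : M}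
    (he : γ t ∈ (chartAt (EuclideanSpace ℝ (Fin n)) e).source) :
    HasDerivWithinAt (fun r ↦ extChartAt (𝓡 n) e (γ r)) (chartDeriv e (γ t) v) s t := by
  have h1 := (mdifferentiableAt_extChartAt (I := 𝓡 n) he).hasMFDerivAt
  let L : ℝ →L[ℝ] EuclideanSpace ℝ (Fin n) :=
    (chartDeriv e (γ t)).comp ((1 : ℝ →L[ℝ] ℝ).smulRight v)
  have h2 : HasFDerivWithinAt (fun r ↦ extChartAt (𝓡 n) e (γ r)) L s t :=
    (h1.comp_hasMFDerivWithinAt t hγ).hasFDerivWithinAt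
  refine h2.hasDerivWithinAt.congr_deriv ?_
  change chartDeriv e (γ t) ((1 : ℝ) • v) = _
  rw [one_smul]

theorem hasMFDerivWithinAt_rightVelocity {γ : ℝ → M} {t : ℝ}
    (hγ : MDifferentiableWithinAt 𝓘(ℝ, ℝ) (𝓡 n) γ (Ici t) t) :
    HasMFDerivWithinAt 𝓘(ℝ, ℝ) (𝓡 n) γ (Ici t) t
      ((1 : ℝ →L[ℝ] ℝ).smulRight (rightVelocity n γ t)) := by
  refine hγ.hasMFDerivWithinAt.congr_mfderiv ?_
  ext
  change _ = (1 : ℝ) • rightVelocity n γ t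
  rw [one_smul]
  rfl

/-- A family of linear maps `P y` that tend to the identity as `y` tends to `e` and that transport,
in the preferred chart at `e`, the cones at nearby points `y` onto the cone at `e`. -/
structure IsConeTransport (C : ∀ x : M, Set (TangentSpace (𝓡 n) x)) (e : M)
    (P : M → EuclideanSpace ℝ (Fin n) →L[ℝ] EuclideanSpace ℝ (Fin n)) : Prop where
  tendsto : Tendsto P (𝓝 e) (𝓝 (ContinuousLinearMap.id ℝ _))
  mem_iff : ∀ y ∈ (chartAt (EuclideanSpace ℝ (Fin n)) e).source, ∀ v : TangentSpace (𝓡 n) y,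
    v ∈ C y ↔ P y (chartDeriv e y v) ∈ coneAt C e

/-- The maps `Γ y e`, read in the preferred chart at `e`, transport the cones. -/
theorem exists_isConeTransport [IsManifold (𝓡 n) ∞ M]
    [RiemannianBundle (fun x : M ↦ TangentSpace (𝓡 n) x)] (H3 : IsGammaInvariant C) (e : M) :
    ∃ P, IsConeTransport C e P := by
  obtain ⟨Γ, hΓc, hΓid, hΓC, -⟩ := H3
  set T := trivializationAt (EuclideanSpace ℝ (Fin n)) (TangentSpace (𝓡 n) : M → Type _) e with hT
  set P : M → EuclideanSpace ℝ (Fin n) →L[ℝ] EuclideanSpace ℝ (Fin n) := fun y ↦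
    LinearMap.toContinuousLinearMap
      ((Γ y e).toLinearMap.comp (T.symmL ℝ y).toLinearMap :
        EuclideanSpace ℝ (Fin n) →ₗ[ℝ] EuclideanSpace ℝ (Fin n)) with hP
  have hbase : T.baseSet = (chartAt (EuclideanSpace ℝ (Fin n)) e).source := rfl
  have hderiv : ∀ y ∈ (chartAt (EuclideanSpace ℝ (Fin n)) e).source,
      T.continuousLinearMapAt ℝ y = chartDeriv e y := fun y hy ↦
    TangentBundle.continuousLinearMapAt_trivializationAt hy
  have hPapp : ∀ y ∈ (chartAt (EuclideanSpace ℝ (Fin n)) e).source, ∀ v : TangentSpace (𝓡 n) y,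
      P y (chartDeriv e y v) = Γ y e v := by
    intro y hy v
    change Γ y e (T.symmL ℝ y (chartDeriv e y v)) = _
    rw [← hderiv y hy, T.symmL_continuousLinearMapAt hy]
  refine ⟨P, ?_, fun y hy v ↦ ?_⟩
  · have hcont : ∀ w, ContinuousAt (fun y ↦ P y w) e := by
      intro w
      have h1 : ContinuousAt (fun y : M ↦ (⟨y, T.symm y w⟩ : TangentBundle (𝓡 n) M)) e := by
        have he : e ∈ T.baseSet := mem_chart_source _ e
        have h2 : ContinuousAt (fun y : M ↦ T.toOpenPartialHomeomorph.symm (y, w)) e := by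
          have h3 : ContinuousAt T.toOpenPartialHomeomorph.symm (e, w) :=
            T.toOpenPartialHomeomorph.continuousAt_symm (T.mem_target.2 he)
          exact h3.comp (f := fun y : M ↦ (y, w)) (by fun_prop)
        refine h2.congr ?_
        filter_upwards [T.open_baseSet.mem_nhds he] with y hy
        exact (T.mk_symm hy w).symm
      have h4 : ContinuousAt (fun y : M ↦
          (⟨e, Γ y e (T.symm y w)⟩ : TangentBundle (𝓡 n) M)) e :=
        hΓc.continuousAt.comp (f := fun y : M ↦
          ((⟨y, T.symm y w⟩ : TangentBundle (𝓡 n) M), e)) (h1.prodMk continuousAt_const)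
      have h5 := (FiberBundle.totalSpaceMk_isInducing (EuclideanSpace ℝ (Fin n))
        (TangentSpace (𝓡 n) : M → Type _) e).continuousAt_iff.2 h4
      refine h5.congr ?_
      filter_upwards [T.open_baseSet.mem_nhds (mem_chart_source _ e)] with y hy
      change Γ y e (T.symm y w) = Γ y e (T.symmL ℝ y w)
      rw [T.symmL_apply hy]
    have hPe : P e = ContinuousLinearMap.id ℝ _ := by
      ext1 w
      have h6 := hPapp e (mem_chart_source _ e) w
      have h7 : chartDeriv e e w = w := congrArg (fun L : EuclideanSpace ℝ (Fin n) →L[ℝ]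
        EuclideanSpace ℝ (Fin n) ↦ L w) (mfderiv_extChartAt_self (I := 𝓡 n) (x := e))
      rw [h7] at h6
      exact h6.trans (hΓid e w)
    rw [← hPe]
    exact continuousAt_clm_apply.2 hcont
  · rw [hPapp y hy]
    change v ∈ C y ↔ Γ y e v ∈ C e
    rw [← hΓC y e, (Γ y e).injective.mem_set_image]

theorem IsConeTransport.eventually_norm_sub_le {e : M}
    {P : M → EuclideanSpace ℝ (Fin n) →L[ℝ] EuclideanSpace ℝ (Fin n)} (hP : IsConeTransport C e P)
    {η : ℝ} (hη : 0 < η) : ∀ᶠ y in 𝓝 e, ∀ w, ‖P y w - w‖ ≤ η * ‖w‖ := by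
  filter_upwards [Metric.tendsto_nhds.1 hP.tendsto η hη] with y hy w
  rw [dist_eq_norm] at hy
  exact ((P y - ContinuousLinearMap.id ℝ _).le_opNorm w).trans (by gcongr)

/-- Near `e`, a straight segment in the chart at `e` whose direction is well inside the cone at `e`
is a strictly conal curve. -/
theorem IsConeTransport.exists_nhds_conalLL [IsManifold (𝓡 n) ∞ M] {e : M}
    {P : M → EuclideanSpace ℝ (Fin n) →L[ℝ] EuclideanSpace ℝ (Fin n)} (hP : IsConeTransport C e P)
    {η : ℝ} (hη : 0 < η) :
    ∃ U ∈ 𝓝 e, ∀ x ∈ U, ∀ y ∈ U, extChartAt (𝓡 n) e y - extChartAt (𝓡 n) e x ≠ 0 →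
      Metric.closedBall (extChartAt (𝓡 n) e y - extChartAt (𝓡 n) e x)
        (η * ‖extChartAt (𝓡 n) e y - extChartAt (𝓡 n) e x‖) ⊆ coneAt C e → ConalLL C x y := by
  set Φ := extChartAt (𝓡 n) e with hΦ
  have hV : ∀ᶠ y in 𝓝 e, (∀ w, ‖P y w - w‖ ≤ η / 2 * ‖w‖) ∧ y ∈ Φ.source :=
    (hP.eventually_norm_sub_le (half_pos hη)).and (extChartAt_source_mem_nhds e)
  have hcont : Tendsto Φ.symm (𝓝 (Φ e)) (𝓝 e) := by
    have := continuousAt_extChartAt_symm (I := 𝓡 n) e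
    rwa [ContinuousAt, extChartAt_to_inv] at this
  obtain ⟨r, hr, hball⟩ := Metric.mem_nhds_iff.1
    (inter_mem (hcont hV) (extChartAt_target_mem_nhds (I := 𝓡 n) e))
  refine ⟨Φ.source ∩ Φ ⁻¹' Metric.ball (Φ e) r, inter_mem (extChartAt_source_mem_nhds e)
    ((continuousAt_extChartAt e).preimage_mem_nhds (Metric.ball_mem_nhds _ hr)), ?_⟩
  rintro x ⟨hxs, hx⟩ y ⟨hys, hy⟩ hne hcone
  set w := Φ y - Φ x with hw
  have hseg : ∀ t ∈ Icc (0 : ℝ) 1, Φ x + t • w ∈ Metric.ball (Φ e) r := fun t ht ↦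
    (convex_ball (Φ e) r).add_smul_sub_mem hx hy ht
  have hcur : ContMDiffOn 𝓘(ℝ, ℝ) (𝓡 n) ∞ (fun t : ℝ ↦ Φ.symm (Φ x + t • w)) (Icc 0 1) := by
    have h1 : ContMDiffOn 𝓘(ℝ, ℝ) (𝓡 n) ∞ (fun t : ℝ ↦ Φ x + t • w) (Icc 0 1) := by
      rw [contMDiffOn_iff_contDiffOn]
      fun_prop
    exact (contMDiffOn_extChartAt_symm (I := 𝓡 n) (n := ∞) e).comp h1 fun t ht ↦
      (hball (hseg t ht)).2
  have hps : IsPiecewiseSmoothOn n (fun t : ℝ ↦ Φ.symm (Φ x + t • w)) 0 1 := by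
    refine ⟨hcur.continuousOn, 1, fun i ↦ min i 1, ?_, by simp, by simp, fun i hi ↦ ?_⟩
    · exact fun i j hij ↦ min_le_min (by exact_mod_cast hij) le_rfl
    · obtain rfl : i = 0 := by omega
      simpa using hcur
  refine ⟨_, 0, 1, one_pos, ⟨hps, fun t ht ↦ ?_⟩, ?_, ?_⟩
  · set γ : ℝ → M := fun t ↦ Φ.symm (Φ x + t • w) with hγ
    have ht' : t ∈ Icc (0 : ℝ) 1 := Ico_subset_Icc_self ht
    have hsrc : γ t ∈ (chartAt (EuclideanSpace ℝ (Fin n)) e).source := by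
      rw [← extChartAt_source (𝓡 n)]
      exact Φ.map_target (hball (hseg t ht')).2
    have hd := hasDerivWithinAt_extChartAt_comp
      (hasMFDerivWithinAt_rightVelocity (hps.mdifferentiableWithinAt ht)) hsrc
    have hd' : HasDerivWithinAt (fun r ↦ Φ (γ r)) w (Ici t) t := by
      have h1 : HasDerivWithinAt (fun r : ℝ ↦ Φ x + r • w) w (Ici t) t := by
        simpa using (((hasDerivAt_id t).smul_const w).const_add (Φ x)).hasDerivWithinAt
      refine h1.congr_of_eventuallyEq ?_ (Φ.right_inv (hball (hseg t ht')).2)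
      filter_upwards [Icc_mem_nhdsGE ht.2] with r hr
      exact Φ.right_inv (hball (hseg r ⟨ht.1.trans hr.1, hr.2⟩)).2
    have heq : chartDeriv e (γ t) (rightVelocity n γ t) = w :=
      (uniqueDiffOn_Ici t t self_mem_Ici).eq_deriv _ hd hd'
    have hPt := (hball (hseg t ht')).1.1
    -- all velocities close to `w` belong to the cone at `γ t`
    have hopen : IsOpen {v : TangentSpace (𝓡 n) (γ t) |
        ‖P (γ t) (chartDeriv e (γ t) v) - w‖ < η * ‖w‖} :=
      isOpen_lt ((((P (γ t)).continuous.comp (chartDeriv e (γ t)).continuous).sub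
        continuous_const).norm) continuous_const
    refine interior_maximal (fun v hv ↦ ?_) hopen ?_
    · rw [hP.mem_iff _ hsrc]
      exact hcone (by rw [Metric.mem_closedBall, dist_eq_norm]; exact le_of_lt hv)
    · change ‖P (γ t) (chartDeriv e (γ t) (rightVelocity n γ t)) - w‖ < η * ‖w‖
      rw [heq]
      have hw0 : 0 < ‖w‖ := norm_pos_iff.2 hne
      refine (hPt w).trans_lt ?_
      nlinarith
  · simp [Φ.left_inv hxs]
  · simp [hw, Φ.left_inv hys]

/-- The stable strict order: `x ≪ y` persists under small perturbations of `x` and `y`. The relation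
`ConalLL` itself need not be open, because a strictly conal curve may be tangent to the boundary of
the cone at its end point. -/
def StableLL (C : ∀ x : M, Set (TangentSpace (𝓡 n) x)) (x y : M) : Prop :=
  (x, y) ∈ interior {p : M × M | ConalLL C p.1 p.2}

theorem StableLL.conalLL {x y : M} (h : StableLL C x y) : ConalLL C x y :=
  interior_subset (s := {p : M × M | ConalLL C p.1 p.2}) h

theorem isOpen_stableLL : IsOpen {p : M × M | StableLL C p.1 p.2} :=
  isOpen_interior (s := {p : M × M | ConalLL C p.1 p.2})

theorem StableLL.trans {x y z : M} (hxy : StableLL C x y) (hyz : StableLL C y z) :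
    StableLL C x z := by
  obtain ⟨U, hU, V, hV, hUV⟩ := mem_nhds_prod_iff.1 (mem_interior_iff_mem_nhds.1 hxy)
  obtain ⟨V', hV', W, hW, hVW⟩ := mem_nhds_prod_iff.1 (mem_interior_iff_mem_nhds.1 hyz)
  refine mem_interior_iff_mem_nhds.2 (mem_of_superset (prod_mem_nhds hU hW) fun p hp ↦ ?_)
  have h1 : ConalLL C p.1 y := hUV (mk_mem_prod hp.1 (mem_of_mem_nhds hV))
  have h2 : ConalLL C y p.2 := hVW (mk_mem_prod (mem_of_mem_nhds hV') hp.2)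
  exact h1.trans h2

/-- Two points near `e` whose difference in the chart at `e` is well inside the cone at `e` are
stably ordered: half of the margin `η` is given away to perturbations of the points. -/
theorem IsConeTransport.exists_nhds_stableLL [IsManifold (𝓡 n) ∞ M] {e : M}
    {P : M → EuclideanSpace ℝ (Fin n) →L[ℝ] EuclideanSpace ℝ (Fin n)} (hP : IsConeTransport C e P)
    {η : ℝ} (hη : 0 < η) :
    ∃ U ∈ 𝓝 e, ∀ x ∈ U, ∀ y ∈ U, extChartAt (𝓡 n) e y - extChartAt (𝓡 n) e x ≠ 0 →
      Metric.closedBall (extChartAt (𝓡 n) e y - extChartAt (𝓡 n) e x)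
        (η * ‖extChartAt (𝓡 n) e y - extChartAt (𝓡 n) e x‖) ⊆ coneAt C e → StableLL C x y := by
  obtain ⟨V, hV, hVll⟩ := hP.exists_nhds_conalLL (half_pos hη)
  set Φ := extChartAt (𝓡 n) e with hΦ
  obtain ⟨U, hU, hUo, heU⟩ :=
    mem_nhds_iff.1 (inter_mem hV (extChartAt_source_mem_nhds (I := 𝓡 n) e))
  refine ⟨U, hUo.mem_nhds heU, fun x hx y hy hne hcone ↦ ?_⟩
  have hn : 0 < ‖Φ y - Φ x‖ := norm_pos_iff.2 hne
  have hcont : ContinuousAt (fun p : M × M ↦ Φ p.2 - Φ p.1) (x, y) := by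
    have h1 := continuousAt_extChartAt' (I := 𝓡 n) (hU hx).2
    have h2 := continuousAt_extChartAt' (I := 𝓡 n) (hU hy).2
    exact (h2.comp (f := Prod.snd) (x := (x, y)) continuousAt_snd).sub
      (h1.comp (f := Prod.fst) (x := (x, y)) continuousAt_fst)
  have h3 : ∀ᶠ p : M × M in 𝓝 (x, y), 0 < ‖Φ p.2 - Φ p.1‖ :=
    hcont.norm.eventually (lt_mem_nhds hn)
  have h4 : ∀ᶠ p : M × M in 𝓝 (x, y), ‖(Φ p.2 - Φ p.1) - (Φ y - Φ x)‖ +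
      η / 2 * ‖Φ p.2 - Φ p.1‖ < η * ‖Φ y - Φ x‖ := by
    refine ((hcont.sub continuousAt_const).norm.add (continuousAt_const.mul hcont.norm)).eventually
      (gt_mem_nhds ?_)
    change ‖Φ y - Φ x - (Φ y - Φ x)‖ + η / 2 * ‖Φ y - Φ x‖ < η * ‖Φ y - Φ x‖
    rw [sub_self, norm_zero]
    nlinarith
  refine mem_interior_iff_mem_nhds.2 ?_
  filter_upwards [h3, h4, prod_mem_nhds (hUo.mem_nhds hx) (hUo.mem_nhds hy)] with p hp3 hp4 hp5
  refine hVll _ (hU hp5.1).1 _ (hU hp5.2).1 (norm_pos_iff.1 hp3) (subset_trans ?_ hcone)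
  refine Metric.closedBall_subset_closedBall' ?_
  rw [dist_eq_norm]
  linarith

/-- Near `e`, the increments of conal curves in the chart at `e` are in a small enlargement of the
cone at `e`. -/
theorem IsConeTransport.exists_nhds_sub_mem_fatCone [IsManifold (𝓡 n) ∞ M] {e : M}
    {P : M → EuclideanSpace ℝ (Fin n) →L[ℝ] EuclideanSpace ℝ (Fin n)} (hP : IsConeTransport C e P)
    (hK : IsClosedConvexCone (coneAt C e)) {l : EuclideanSpace ℝ (Fin n) →L[ℝ] ℝ}
    (hl : ∀ w ∈ coneAt C e, ‖w‖ ≤ l w) {ε : ℝ} (hε : 0 < ε) (hεl : ε * ‖l‖ ≤ 1 / 2) :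
    ∃ U ∈ 𝓝 e, ∀ (γ : ℝ → M) (a b : ℝ), a ≤ b → IsConalCurve C γ a b → (∀ t ∈ Icc a b, γ t ∈ U) →
      extChartAt (𝓡 n) e (γ b) - extChartAt (𝓡 n) e (γ a) ∈ fatCone (coneAt C e) l ε := by
  set Φ := extChartAt (𝓡 n) e with hΦ
  refine ⟨_, (hP.eventually_norm_sub_le (η := min (1 / 2) (ε / 2)) (by positivity)).and
    (extChartAt_source_mem_nhds (I := 𝓡 n) e), fun γ a b hab hγ hU ↦ ?_⟩
  have hsrc : ∀ t ∈ Icc a b, γ t ∈ (chartAt (EuclideanSpace ℝ (Fin n)) e).source := by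
    intro t ht
    rw [← extChartAt_source (𝓡 n)]
    exact (hU t ht).2
  refine sub_mem_of_rightDeriv_mem (hK.isClosed_fatCone hε.le hεl) hK.zero_mem_fatCone
    hK.add_mem_fatCone hK.smul_mem_fatCone (g := fun t ↦ Φ (γ t))
    (g' := fun t ↦ chartDeriv e (γ t) (rightVelocity n γ t)) hab ?_ (fun t ht ↦ ?_) fun t ht ↦ ?_
  · exact (continuousOn_extChartAt e).comp hγ.1.1 fun t ht ↦ (hU t ht).2
  · exact hasDerivWithinAt_extChartAt_comp
      (hasMFDerivWithinAt_rightVelocity (hγ.1.mdifferentiableWithinAt ht))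
      (hsrc t (Ico_subset_Icc_self ht))
  · have ht' := Ico_subset_Icc_self ht
    have hmem := (hP.mem_iff _ (hsrc t ht') _).1 (hγ.2 t ht)
    set w := chartDeriv e (γ t) (rightVelocity n γ t)
    have h1 : ‖P (γ t) w - w‖ ≤ min (1 / 2) (ε / 2) * ‖w‖ := (hU t ht').1 w
    refine ⟨P (γ t) w, hmem, ?_⟩
    have h2 : ‖P (γ t) w - w‖ ≤ 1 / 2 * ‖w‖ := h1.trans (by gcongr; exact min_le_left _ _)
    have h3 : ‖P (γ t) w - w‖ ≤ ε / 2 * ‖w‖ := h1.trans (by gcongr; exact min_le_right _ _)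
    have h4 := norm_le_norm_add_norm_sub (P (γ t) w) w
    have h5 := hl _ hmem
    rw [norm_sub_rev]
    nlinarith

end LocalOrder

/-! ### Strict differentiability of flow maps -/

section Gronwall

variable {E : Type*} [NormedAddCommGroup E] [NormedSpace ℝ E]

/-- Linear equations `L' = A L`, `L 0 = id`, have solutions on short intervals. -/
theorem exists_fundamentalSolution [CompleteSpace E] {A : ℝ → E →L[ℝ] E} {T : ℝ} (hT : 0 ≤ T)
    (hA : ContinuousOn A (Icc 0 T)) {K : NNReal} (hK : ∀ t ∈ Icc 0 T, ‖A t‖ ≤ K)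
    (hKT : 2 * K * T ≤ 1) :
    ∃ L : ℝ → E →L[ℝ] E, L 0 = ContinuousLinearMap.id ℝ E ∧
      ∀ t ∈ Icc 0 T, HasDerivWithinAt L ((A t).comp (L t)) (Icc 0 T) t := by
  -- on the ball of radius `1` around the identity the right-hand side is at most `2 K`
  have hPL : IsPicardLindelof (fun t (X : E →L[ℝ] E) ↦ (A t).comp X)
      (⟨0, left_mem_Icc.2 hT⟩ : Icc 0 T) (ContinuousLinearMap.id ℝ E) 1 0 (2 * K) K := by
    refine ⟨fun t ht ↦ LipschitzOnWith.of_dist_le_mul fun X _ Y _ ↦ ?_,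
      fun X _ ↦ by fun_prop, fun t ht X hX ↦ ?_, ?_⟩
    · rw [dist_eq_norm, dist_eq_norm, ← ContinuousLinearMap.comp_sub]
      exact ((A t).opNorm_comp_le _).trans (by gcongr; exact hK t ht)
    · rw [Metric.mem_closedBall, dist_eq_norm, NNReal.coe_one] at hX
      have h1 : ‖X‖ ≤ 2 := by
        have h2 := norm_le_norm_add_norm_sub' X (ContinuousLinearMap.id ℝ E)
        have h3 : ‖ContinuousLinearMap.id ℝ E‖ ≤ 1 := ContinuousLinearMap.norm_id_le
        linarith
      calc ‖(A t).comp X‖ ≤ ‖A t‖ * ‖X‖ := (A t).opNorm_comp_le _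
        _ ≤ K * 2 := by gcongr; exact hK t ht
        _ = (2 * K : NNReal) := by push_cast; ring
    · push_cast
      simp only [sub_zero, sub_self, max_eq_left hT]
      linarith
  obtain ⟨L, hL0, hL⟩ := hPL.exists_eq_forall_mem_Icc_hasDerivWithinAt₀
  exact ⟨L, hL0, hL⟩

/-- The time-`T` map of a `C¹` flow is strictly differentiable, for small `T`. Its derivative is the
fundamental solution `L` of the variational equation: the increment of the flow between two nearby
points with difference `h` satisfies nearly the same linear equation as `L h`, so the two differ by
`o(‖h‖)`. -/
theorem exists_hasStrictFDerivAt_of_flow [CompleteSpace E] {F : E → E} {F' : E → E →L[ℝ] E}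
    {S B : Set E} (hS : IsCompact S) (hconv : Convex ℝ S) (hF : ∀ z ∈ S, HasFDerivAt F (F' z) z)
    (hF' : ContinuousOn F' S) (hB : IsOpen B) {G : ℝ → E → E} {T : ℝ} (hT : 0 ≤ T) {K : NNReal}
    (hK : ∀ z ∈ S, ‖F' z‖ ≤ K) (hKT : 2 * K * T ≤ 1)
    (hG0 : ∀ w ∈ B, G 0 w = w) (hGS : ∀ w ∈ B, ∀ t ∈ Icc 0 T, G t w ∈ S)
    (hGc : ∀ w ∈ B, ContinuousOn (fun t ↦ G t w) (Icc 0 T))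
    (hG : ∀ w ∈ B, ∀ t ∈ Ico 0 T, HasDerivWithinAt (fun t ↦ G t w) (F (G t w)) (Ici t) t)
    {w₀ : E} (hw₀ : w₀ ∈ B) : ∃ D : E →L[ℝ] E, HasStrictFDerivAt (G T) D w₀ := by
  obtain ⟨L, hL0, hL⟩ := exists_fundamentalSolution hT (hF'.comp (hGc w₀ hw₀) (hGS w₀ hw₀))
    (fun t ht ↦ hK _ (hGS w₀ hw₀ t ht)) hKT
  have hLip : LipschitzOnWith K F S := hconv.lipschitzOnWith_of_nnnorm_hasFDerivWithin_le
    (fun z hz ↦ (hF z hz).hasFDerivWithinAt) hK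
  have hdist : ∀ w ∈ B, ∀ z ∈ B, ∀ t ∈ Icc 0 T, ‖G t w - G t z‖ ≤ ‖w - z‖ * Real.exp (K * T) := by
    intro w hw z hz t ht
    have := dist_le_of_trajectories_ODE_of_mem (v := fun _ ↦ F) (s := fun _ ↦ S)
      (fun _ _ ↦ hLip) (hGc w hw) (hG w hw) (fun t ht ↦ hGS w hw t (Ico_subset_Icc_self ht))
      (hGc z hz) (hG z hz) (fun t ht ↦ hGS z hz t (Ico_subset_Icc_self ht)) le_rfl t ht
    rw [hG0 w hw, hG0 z hz, dist_eq_norm, dist_eq_norm] at this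
    refine this.trans ?_
    have : t - 0 ≤ T := by linarith [ht.2]
    gcongr
  set A := Real.exp (K * T)
  have hA : 0 < A := Real.exp_pos _
  -- Gronwall's inequality will turn an error `ε` in the equation into the error `c * ε` at time `T`
  set c : ℝ := A / (K + 1) * (Real.exp ((K + 1) * T) - 1) with hc
  have hc0 : 0 ≤ c := by
    have : 1 ≤ Real.exp ((K + 1) * T) := Real.one_le_exp (by positivity)
    exact mul_nonneg (by positivity) (by linarith)
  refine ⟨L T, HasStrictFDerivAt.of_isLittleO (Asymptotics.isLittleO_iff.2 fun ε' hε' ↦ ?_)⟩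
  set ε := ε' / (c + 1)
  have hε : 0 < ε := by positivity
  obtain ⟨δ, hδ, hunif⟩ := Metric.uniformContinuousOn_iff_le.1
    (hS.uniformContinuousOn_of_continuous hF') ε hε
  have hlin : ∀ a ∈ S, ∀ p ∈ S, ∀ q ∈ S, ‖p - a‖ ≤ δ → ‖q - a‖ ≤ δ →
      ‖F q - F p - F' a (q - p)‖ ≤ ε * ‖q - p‖ := by
    intro a ha p hp q hq hpa hqa
    refine (hconv.inter (convex_closedBall a δ)).norm_image_sub_le_of_norm_hasFDerivWithin_le'
      (f' := F') (fun z hz ↦ (hF z hz.1).hasFDerivWithinAt) (fun z hz ↦ ?_)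
      ⟨hp, by rwa [Metric.mem_closedBall, dist_eq_norm]⟩
      ⟨hq, by rwa [Metric.mem_closedBall, dist_eq_norm]⟩
    rw [← dist_eq_norm]
    exact hunif z hz.1 a ha hz.2
  -- the trajectories of points of `B` that are `δ / A`-close to `w₀` stay `δ`-close to that of `w₀`
  have hclose : ∀ w ∈ B, ‖w - w₀‖ < δ / A → ∀ t ∈ Icc 0 T, ‖G t w - G t w₀‖ ≤ δ := by
    intro w hw hwδ t ht
    exact (hdist w hw w₀ hw₀ t ht).trans ((lt_div_iff₀ hA).1 hwδ).le
  have hnear : ∀ᶠ w in 𝓝 w₀, w ∈ B ∧ ‖w - w₀‖ < δ / A := by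
    filter_upwards [hB.mem_nhds hw₀, Metric.ball_mem_nhds w₀ (show 0 < δ / A by positivity)] with
      w hw hwδ
    exact ⟨hw, by rwa [Metric.mem_ball, dist_eq_norm] at hwδ⟩
  rw [nhds_prod_eq]
  filter_upwards [hnear.prod_mk hnear] with ⟨w₂, w₁⟩ ⟨⟨hB2, h2⟩, ⟨hB1, h1⟩⟩
  simp only at hB1 hB2 h1 h2 ⊢
  set h := w₂ - w₁ with hh
  have hkey : ‖G T w₂ - G T w₁ - L T h‖ ≤ gronwallBound 0 (K + 1) (ε * A * ‖h‖) (T - 0) := by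
    refine norm_le_gronwallBound_of_norm_deriv_right_le
      (f := fun t ↦ G t w₂ - G t w₁ - L t h)
      (f' := fun t ↦ F (G t w₂) - F (G t w₁) - F' (G t w₀) (L t h))
      (((hGc _ hB2).sub (hGc _ hB1)).sub fun t ht ↦
        (hL t ht).continuousWithinAt.clm_apply continuousWithinAt_const)
      (fun t ht ↦ ((hG _ hB2 t ht).sub (hG _ hB1 t ht)).sub ?_)
      ?_ (fun t ht ↦ ?_) T (right_mem_Icc.2 hT)
    · have h3 := ((hL t (Ico_subset_Icc_self ht)).mono_of_mem_nhdsWithin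
        (Icc_mem_nhdsGE_of_mem ht)).clm_apply (hasDerivWithinAt_const t (Ici t) h)
      simpa using h3
    · rw [hG0 _ hB2, hG0 _ hB1, hL0, ContinuousLinearMap.id_apply, hh, sub_self, norm_zero]
    · have ht' := Ico_subset_Icc_self ht
      have e1 := hlin _ (hGS _ hw₀ t ht') _ (hGS _ hB1 t ht') _ (hGS _ hB2 t ht')
        (hclose _ hB1 h1 t ht') (hclose _ hB2 h2 t ht')
      have e2 := hdist _ hB2 _ hB1 t ht'
      have e3 := hK _ (hGS _ hw₀ t ht')
      set Z := F' (G t w₀)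
      set p := G t w₂ - G t w₁
      have e4 : F (G t w₂) - F (G t w₁) - Z (L t h) =
          Z (p - L t h) + (F (G t w₂) - F (G t w₁) - Z p) := by
        rw [map_sub Z p (L t h)]; abel
      rw [e4]
      calc _ ≤ ‖Z (p - L t h)‖ + ‖F (G t w₂) - F (G t w₁) - Z p‖ := norm_add_le _ _
        _ ≤ K * ‖p - L t h‖ + ε * (‖h‖ * A) := by
            gcongr
            · exact (Z.le_opNorm _).trans (by gcongr)
            · exact e1.trans (by gcongr)
        _ ≤ (K + 1) * ‖p - L t h‖ + ε * A * ‖h‖ := by nlinarith [norm_nonneg (p - L t h)]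
  rw [gronwallBound_of_K_ne_0 (by positivity)] at hkey
  simp only [zero_mul, zero_add, sub_zero] at hkey
  calc ‖G T w₂ - G T w₁ - L T h‖ ≤ c * ε * ‖h‖ := hkey.trans (le_of_eq (by rw [hc]; ring))
    _ ≤ (c + 1) * ε * ‖h‖ := by gcongr; linarith
    _ = ε' * ‖h‖ := by simp only [ε]; field_simp

end Gronwall

/-! ### The flow of a smooth vector field -/

section FlowBox

/-- A transitive relation between the points of `[a, b]` that holds locally relates `a` to `b`. -/
theorem rel_of_locally {R : ℝ → ℝ → Prop} {a b : ℝ} (hab : a ≤ b)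
    (htrans : ∀ r s t, a ≤ r → r ≤ s → s ≤ t → R r s → R s t → R r t)
    (hloc : ∀ τ ∈ Icc a b, ∃ V ∈ 𝓝[Icc a b] τ, ∀ s ∈ V, ∀ t ∈ V, s ≤ t → R s t) : R a b := by
  have hloc' : ∀ τ : Icc a b, ∃ V : Set (Icc a b), IsOpen V ∧ τ ∈ V ∧
      ∀ s ∈ V, ∀ t ∈ V, s ≤ t → R s t := by
    intro τ
    obtain ⟨V, hV, hR⟩ := hloc τ τ.2
    have hV' : ((↑) : Icc a b → ℝ) ⁻¹' V ∈ 𝓝 τ := by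
      rw [nhdsWithin_eq_map_subtype_coe τ.2] at hV
      exact hV
    obtain ⟨W, hWV, hW, hτ⟩ := mem_nhds_iff.1 hV'
    exact ⟨W, hW, hτ, fun s hs t ht hst ↦ hR s (hWV hs) t (hWV ht) hst⟩
  choose V hVo hVτ hVR using hloc'
  obtain ⟨t, ht0, htm, ⟨m, hm⟩, ht⟩ := exists_monotone_Icc_subset_open_cover_Icc hab hVo
    fun τ _ ↦ mem_iUnion.2 ⟨τ, hVτ τ⟩
  have hstep : ∀ k, R (t k) (t (k + 1)) := by
    intro k
    obtain ⟨i, hi⟩ := ht k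
    exact hVR i _ (hi (left_mem_Icc.2 (htm k.le_succ))) _ (hi (right_mem_Icc.2 (htm k.le_succ)))
      (htm k.le_succ)
  have hall : ∀ k, R (t 0) (t (k + 1)) := by
    intro k
    induction k with
    | zero => exact hstep 0
    | succ k ih =>
      exact htrans _ _ _ (t 0).2.1 (htm (Nat.zero_le _)) (htm (Nat.le_succ _)) ih (hstep _)
  have := hall m
  rwa [ht0, hm (m + 1) m.le_succ] at this

variable {n : ℕ} {M : Type*} [TopologicalSpace M] [ChartedSpace (EuclideanSpace ℝ (Fin n)) M]
  [IsManifold (𝓡 n) ∞ M] {f : ∀ x : M, TangentSpace (𝓡 n) x}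

/-- The coordinate expression of a smooth vector field in a preferred chart is `C¹`. -/
theorem exists_hasFDerivAt_vectorField
    (hf : ContMDiff (𝓡 n) (𝓡 n).tangent ∞ (fun x ↦ (⟨x, f x⟩ : TangentBundle (𝓡 n) M))) (e : M) :
    ∃ (F : EuclideanSpace ℝ (Fin n) → EuclideanSpace ℝ (Fin n))
      (F' : EuclideanSpace ℝ (Fin n) → EuclideanSpace ℝ (Fin n) →L[ℝ] EuclideanSpace ℝ (Fin n)),
      (∀ y ∈ (chartAt (EuclideanSpace ℝ (Fin n)) e).source,
        F (extChartAt (𝓡 n) e y) = chartDeriv e y (f y)) ∧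
      (∀ z ∈ (extChartAt (𝓡 n) e).target, HasFDerivAt F (F' z) z) ∧
      ContinuousOn F' (extChartAt (𝓡 n) e).target := by
  set T := trivializationAt (EuclideanSpace ℝ (Fin n)) (TangentSpace (𝓡 n) : M → Type _) e with hT
  set Φ := extChartAt (𝓡 n) e with hΦ
  have hbase : T.baseSet = (chartAt (EuclideanSpace ℝ (Fin n)) e).source := rfl
  have h1 : ContMDiffOn (𝓡 n) 𝓘(ℝ, EuclideanSpace ℝ (Fin n)) ∞
      (fun x ↦ (T ⟨x, f x⟩).2) T.baseSet :=
    (T.contMDiffOn_section_baseSet_iff).1 hf.contMDiffOn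
  set F : EuclideanSpace ℝ (Fin n) → EuclideanSpace ℝ (Fin n) :=
    fun z ↦ (T ⟨Φ.symm z, f (Φ.symm z)⟩).2 with hF
  have hmaps : MapsTo Φ.symm Φ.target T.baseSet := by
    intro z hz
    rw [hbase, ← extChartAt_source (𝓡 n) e]
    exact Φ.map_target hz
  have h2 : ContDiffOn ℝ ∞ F Φ.target :=
    contMDiffOn_iff_contDiffOn.1 (h1.comp (contMDiffOn_extChartAt_symm (I := 𝓡 n) e) hmaps)
  have hopen : IsOpen Φ.target := isOpen_extChartAt_target e
  refine ⟨F, fderiv ℝ F, fun y hy ↦ ?_, fun z hz ↦ ?_,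
    h2.continuousOn_fderiv_of_isOpen hopen (by simp)⟩
  · have hy' : Φ.symm (Φ y) = y := Φ.left_inv (by rwa [hΦ, extChartAt_source])
    rw [hF]
    change (T ⟨Φ.symm (Φ y), f (Φ.symm (Φ y))⟩).2 = _
    rw [hy']
    have h3 : T.continuousLinearMapAt ℝ y = chartDeriv e y :=
      TangentBundle.continuousLinearMapAt_trivializationAt hy
    rw [← h3, Trivialization.continuousLinearMapAt_apply, Trivialization.linearMapAt_apply,
      if_pos (show y ∈ T.baseSet from hy)]
  · exact ((h2.differentiableOn (by simp)).differentiableAt (hopen.mem_nhds hz)).hasFDerivAt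

/-- A flow box of the vector field `f` in the preferred chart at `e`: integral curves that start in
the open set `B` of coordinates remain for times in `[0, T]` in the compact convex set `S` of
coordinates, on which `f` is represented by the `C¹` map `F`. The time `T` is small compared to the
derivative of `F` (field `short`), which allows solving the variational equation on `[0, T]`. -/
structure IsFlowBox (f : ∀ x : M, TangentSpace (𝓡 n) x) (e : M)
    (F : EuclideanSpace ℝ (Fin n) → EuclideanSpace ℝ (Fin n))
    (F' : EuclideanSpace ℝ (Fin n) → EuclideanSpace ℝ (Fin n) →L[ℝ] EuclideanSpace ℝ (Fin n))
    (S B : Set (EuclideanSpace ℝ (Fin n))) (T : ℝ) : Prop where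
  isCompact : IsCompact S
  convex : Convex ℝ S
  subset_target : S ⊆ (extChartAt (𝓡 n) e).target
  isOpen : IsOpen B
  mem : extChartAt (𝓡 n) e e ∈ B
  subset : B ⊆ S
  pos : 0 < T
  hasFDerivAt : ∀ z ∈ S, HasFDerivAt F (F' z) z
  continuousOn : ContinuousOn F' S
  short : ∃ K : NNReal, 2 * K * T ≤ 1 ∧ ∀ z ∈ S, ‖F' z‖ ≤ K
  confined : ∀ γ : ℝ → M, IsMIntegralCurveOn (I := 𝓡 n) γ f (Ici 0) →
    γ 0 ∈ (extChartAt (𝓡 n) e).source → extChartAt (𝓡 n) e (γ 0) ∈ B →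
    ∀ t ∈ Icc 0 T, γ t ∈ (extChartAt (𝓡 n) e).source ∧ extChartAt (𝓡 n) e (γ t) ∈ S ∧
      HasDerivWithinAt (fun r ↦ extChartAt (𝓡 n) e (γ r)) (F (extChartAt (𝓡 n) e (γ t))) (Ici t) t

/-- Flow boxes exist around every point: a bound for the speed in a closed ball of coordinates
confines, for a short time, the curves that start in the concentric ball of half the radius. -/
theorem exists_isFlowBox [T2Space M]
    (hf : ContMDiff (𝓡 n) (𝓡 n).tangent ∞ (fun x ↦ (⟨x, f x⟩ : TangentBundle (𝓡 n) M))) (e : M) :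
    ∃ F F' S B T, IsFlowBox f e F F' S B T := by
  obtain ⟨F, F', hFf, hF, hF'⟩ := exists_hasFDerivAt_vectorField hf e
  set Φ := extChartAt (𝓡 n) e with hΦ
  have hsrc : Φ.source = (chartAt (EuclideanSpace ℝ (Fin n)) e).source := extChartAt_source _ e
  obtain ⟨R, hR, hRt⟩ : ∃ R > 0, Metric.closedBall (Φ e) (2 * R) ⊆ Φ.target := by
    obtain ⟨r, hr, hrt⟩ := Metric.nhds_basis_closedBall.mem_iff.1
      (extChartAt_target_mem_nhds (I := 𝓡 n) e)
    exact ⟨r / 2, by positivity, by rwa [mul_div_cancel₀ _ two_ne_zero]⟩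
  set S := Metric.closedBall (Φ e) (2 * R) with hS
  have hSc : IsCompact S := isCompact_closedBall _ _
  obtain ⟨K₁, hK₁⟩ := hSc.exists_bound_of_continuousOn (f := F)
    (fun z hz ↦ (hF z (hRt hz)).continuousAt.continuousWithinAt)
  obtain ⟨K₂, hK₂⟩ := hSc.exists_bound_of_continuousOn (hF'.mono hRt)
  set K := max K₁ K₂
  have hK : ∀ z ∈ S, ‖F z‖ ≤ K := fun z hz ↦ (hK₁ z hz).trans (le_max_left _ _)
  have hK' : ∀ z ∈ S, ‖F' z‖ ≤ K := fun z hz ↦ (hK₂ z hz).trans (le_max_right _ _)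
  have hK0 : 0 ≤ K := (norm_nonneg _).trans (hK (Φ e) (Metric.mem_closedBall_self (by positivity)))
  -- up to time `T`, curves of speed at most `K` cover a distance less than `R`
  set T := min R 1 / (2 * (K + 1))
  have hTpos : 0 < T := by positivity
  have hKT : 2 * K * T < min R 1 := by
    have h1 : T * (2 * (K + 1)) = min R 1 := div_mul_cancel₀ _ (by positivity)
    linarith
  refine ⟨F, F', S, Metric.ball (Φ e) R, T, hSc, convex_closedBall _ _, hRt,
    Metric.isOpen_ball, Metric.mem_ball_self hR, ?_, hTpos, fun z hz ↦ hF z (hRt hz),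
    hF'.mono hRt, ⟨⟨K, hK0⟩, hKT.le.trans (min_le_right _ _), hK'⟩, ?_⟩
  · exact Metric.ball_subset_closedBall.trans (Metric.closedBall_subset_closedBall (by linarith))
  intro γ hγ h0 hB
  have hγc : ContinuousOn γ (Ici 0) := hγ.continuousOn
  have hder : ∀ t, 0 ≤ t → γ t ∈ Φ.source →
      HasDerivWithinAt (fun r ↦ Φ (γ r)) (F (Φ (γ t))) (Ici t) t := by
    intro t ht hs
    rw [hsrc] at hs
    rw [hFf _ hs]
    exact (hasDerivWithinAt_extChartAt_comp (hγ t ht) hs).mono (Ici_subset_Ici.2 ht)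
  have hQ : IsCompact (Φ.symm '' S) :=
    hSc.image_of_continuousOn ((continuousOn_extChartAt_symm e).mono hRt)
  have hmemQ : ∀ y, y ∈ Φ.symm '' S ↔ y ∈ Φ.source ∧ Φ y ∈ S := by
    intro y
    constructor
    · rintro ⟨z, hz, rfl⟩
      exact ⟨Φ.map_target (hRt hz), by rwa [Φ.right_inv (hRt hz)]⟩
    · rintro ⟨hy, hy'⟩
      exact ⟨Φ y, hy', Φ.left_inv hy⟩
  -- continuity method: the times up to which the curve stays in the compact set are closed and open
  have hsub : Icc 0 T ⊆ γ ⁻¹' (Φ.symm '' S) := by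
    refine IsClosed.Icc_subset_of_forall_mem_nhdsGT_of_Icc_subset ?_ ?_ ?_
    · rw [inter_comm]
      exact (hγc.mono Icc_subset_Ici_self).preimage_isClosed_of_isClosed isClosed_Icc hQ.isClosed
    · exact (hmemQ _).2
        ⟨h0, Metric.mem_closedBall.2 ((Metric.mem_ball.1 hB).le.trans (by linarith))⟩
    · intro t ht hsub
      have hts : ∀ r ∈ Icc 0 t, γ r ∈ Φ.source ∧ Φ (γ r) ∈ S := fun r hr ↦ (hmemQ _).1 (hsub hr)
      have h1 := norm_image_sub_le_of_norm_deriv_right_le_segment (f := fun r ↦ Φ (γ r))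
        (f' := fun r ↦ F (Φ (γ r))) (a := 0) (b := t) (C := K)
        (fun r hr ↦ ((continuousAt_extChartAt' (hts r hr).1).comp_continuousWithinAt
          ((hγc r hr.1).mono Icc_subset_Ici_self)))
        (fun r hr ↦ hder r hr.1 (hts r (Ico_subset_Icc_self hr)).1)
        (fun r hr ↦ hK _ (hts r (Ico_subset_Icc_self hr)).2) t (right_mem_Icc.2 ht.1)
      have h2 : K * (t - 0) < R := by
        have h3 : K * t ≤ K * T := by gcongr; exact ht.2.le
        have h4 := hKT.trans_le (min_le_left R 1)
        linarith [mul_nonneg hK0 hTpos.le]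
      have h3 : Φ (γ t) ∈ Metric.ball (Φ e) (2 * R) := by
        rw [Metric.mem_ball]
        have h4 := Metric.mem_ball.1 hB
        rw [← dist_eq_norm] at h1
        linarith [dist_triangle (Φ (γ t)) (Φ (γ 0)) (Φ e)]
      have ht' := (hts t (right_mem_Icc.2 ht.1)).1
      have h5 : ∀ᶠ y in 𝓝 (γ t), y ∈ Φ.source ∧ Φ y ∈ Metric.ball (Φ e) (2 * R) :=
        Filter.Eventually.and ((isOpen_extChartAt_source e).mem_nhds ht')
          ((continuousAt_extChartAt' ht').eventually (Metric.isOpen_ball.mem_nhds h3))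
      have h6 : Tendsto γ (𝓝[>] t) (𝓝 (γ t)) :=
        (hγc t ht.1).mono (fun r hr ↦ ht.1.trans (le_of_lt hr))
      filter_upwards [h6.eventually h5] with r hr
      exact (hmemQ _).2 ⟨hr.1, Metric.ball_subset_closedBall hr.2⟩
  intro t ht
  obtain ⟨h1, h2⟩ := (hmemQ _).1 (hsub ht)
  exact ⟨h1, h2, hder t ht.1 h1⟩

end FlowBox

section FlowRegularity

variable {n : ℕ} {M : Type*} [TopologicalSpace M] [ChartedSpace (EuclideanSpace ℝ (Fin n)) M]
  {f : ∀ x : M, TangentSpace (𝓡 n) x} {φ : ℝ → M → M}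

theorem isMIntegralCurveOn_shift {γ : ℝ → M} (hγ : IsMIntegralCurveOn (I := 𝓡 n) γ f (Ici 0))
    {s : ℝ} (hs : 0 ≤ s) : IsMIntegralCurveOn (I := 𝓡 n) (fun r ↦ γ (r + s)) f (Ici 0) :=
  (hγ.comp_add s).mono fun r (hr : 0 ≤ r) ↦ show 0 ≤ r + s by positivity

namespace IsFlowBox

variable {e : M} {F : EuclideanSpace ℝ (Fin n) → EuclideanSpace ℝ (Fin n)}
  {F' : EuclideanSpace ℝ (Fin n) → EuclideanSpace ℝ (Fin n) →L[ℝ] EuclideanSpace ℝ (Fin n)}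
  {S B : Set (EuclideanSpace ℝ (Fin n))} {T : ℝ}

theorem curve_continuousOn (h : IsFlowBox f e F F' S B T) {γ : ℝ → M}
    (hγ : IsMIntegralCurveOn (I := 𝓡 n) γ f (Ici 0)) (h0 : γ 0 ∈ (extChartAt (𝓡 n) e).source)
    (hB : extChartAt (𝓡 n) e (γ 0) ∈ B) :
    ContinuousOn (fun t ↦ extChartAt (𝓡 n) e (γ t)) (Icc 0 T) := fun t ht ↦
  (continuousAt_extChartAt' (h.confined γ hγ h0 hB t ht).1).comp_continuousWithinAt
    ((hγ.continuousOn t ht.1).mono Icc_subset_Ici_self)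

/-- Two integral curves in a flow box separate at most by a constant factor. -/
theorem exists_dist_le (h : IsFlowBox f e F F' S B T) : ∃ K : NNReal, ∀ γ₁ γ₂ : ℝ → M,
    IsMIntegralCurveOn (I := 𝓡 n) γ₁ f (Ici 0) → IsMIntegralCurveOn (I := 𝓡 n) γ₂ f (Ici 0) →
    γ₁ 0 ∈ (extChartAt (𝓡 n) e).source → extChartAt (𝓡 n) e (γ₁ 0) ∈ B →
    γ₂ 0 ∈ (extChartAt (𝓡 n) e).source → extChartAt (𝓡 n) e (γ₂ 0) ∈ B → ∀ t ∈ Icc 0 T,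
    dist (extChartAt (𝓡 n) e (γ₁ t)) (extChartAt (𝓡 n) e (γ₂ t)) ≤
      K * dist (extChartAt (𝓡 n) e (γ₁ 0)) (extChartAt (𝓡 n) e (γ₂ 0)) := by
  obtain ⟨K, -, hK⟩ := h.short
  have hLip : LipschitzOnWith K F S := h.convex.lipschitzOnWith_of_nnnorm_hasFDerivWithin_le
    (fun z hz ↦ (h.hasFDerivAt z hz).hasFDerivWithinAt) hK
  refine ⟨(Real.exp (K * T)).toNNReal, fun γ₁ γ₂ hγ₁ hγ₂ h1 hB1 h2 hB2 t ht ↦ ?_⟩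
  have H1 := h.confined γ₁ hγ₁ h1 hB1
  have H2 := h.confined γ₂ hγ₂ h2 hB2
  have := dist_le_of_trajectories_ODE_of_mem (v := fun _ ↦ F) (s := fun _ ↦ S)
    (fun _ _ ↦ hLip) (h.curve_continuousOn hγ₁ h1 hB1)
    (fun t ht ↦ (H1 t (Ico_subset_Icc_self ht)).2.2)
    (fun t ht ↦ (H1 t (Ico_subset_Icc_self ht)).2.1) (h.curve_continuousOn hγ₂ h2 hB2)
    (fun t ht ↦ (H2 t (Ico_subset_Icc_self ht)).2.2)
    (fun t ht ↦ (H2 t (Ico_subset_Icc_self ht)).2.1) le_rfl t ht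
  refine this.trans ?_
  rw [Real.coe_toNNReal _ (Real.exp_pos _).le, mul_comm]
  have : t - 0 ≤ T := by linarith [ht.2]
  gcongr

theorem curve_eq (h : IsFlowBox f e F F' S B T) {γ₁ γ₂ : ℝ → M}
    (hγ₁ : IsMIntegralCurveOn (I := 𝓡 n) γ₁ f (Ici 0))
    (hγ₂ : IsMIntegralCurveOn (I := 𝓡 n) γ₂ f (Ici 0)) (heq : γ₁ 0 = γ₂ 0)
    (h0 : γ₁ 0 ∈ (extChartAt (𝓡 n) e).source) (hB : extChartAt (𝓡 n) e (γ₁ 0) ∈ B) {t : ℝ}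
    (ht : t ∈ Icc 0 T) : γ₁ t = γ₂ t := by
  obtain ⟨K, hK⟩ := h.exists_dist_le
  have h0' := h0
  have hB' := hB
  rw [heq] at h0' hB'
  have h1 := hK γ₁ γ₂ hγ₁ hγ₂ h0 hB h0' hB' t ht
  rw [heq, dist_self, mul_zero, dist_le_zero] at h1
  exact (extChartAt (𝓡 n) e).injOn (h.confined γ₁ hγ₁ h0 hB t ht).1
    (h.confined γ₂ hγ₂ h0' hB' t ht).1 h1

/-- The points whose coordinates lie in the open set `B` of a flow box. -/
theorem nhds_mem (h : IsFlowBox f e F F' S B T) :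
    (extChartAt (𝓡 n) e).source ∩ extChartAt (𝓡 n) e ⁻¹' B ∈ 𝓝 e :=
  inter_mem (extChartAt_source_mem_nhds e)
    ((continuousAt_extChartAt e).preimage_mem_nhds (h.isOpen.mem_nhds h.mem))

theorem continuousOn_flow (h : IsFlowBox f e F F' S B T) (hφ : IsForwardFlow f φ) :
    ContinuousOn (fun p : ℝ × M ↦ φ p.1 p.2)
      (Icc 0 T ×ˢ ((extChartAt (𝓡 n) e).source ∩ extChartAt (𝓡 n) e ⁻¹' B)) := by
  set Φ := extChartAt (𝓡 n) e with hΦ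
  obtain ⟨K, hK⟩ := h.exists_dist_le
  have hB : ∀ w ∈ B, w ∈ Φ.target := fun w hw ↦ h.subset_target (h.subset hw)
  have hs : ∀ w ∈ B, φ 0 (Φ.symm w) ∈ Φ.source ∧ Φ (φ 0 (Φ.symm w)) ∈ B := by
    intro w hw
    rw [(hφ _).1, Φ.right_inv (hB w hw)]
    exact ⟨Φ.map_target (hB w hw), hw⟩
  have hG : ContinuousOn (fun q : EuclideanSpace ℝ (Fin n) × ℝ ↦ Φ (φ q.2 (Φ.symm q.1)))
      (B ×ˢ Icc 0 T) := by
    refine continuousOn_prod_of_continuousOn_lipschitzOnWith _ K (fun w hw ↦ ?_) fun t ht ↦ ?_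
    · exact h.curve_continuousOn (hφ (Φ.symm w)).2 (hs w hw).1 (hs w hw).2
    · refine LipschitzOnWith.of_dist_le_mul fun w hw z hz ↦ ?_
      have := hK _ _ (hφ (Φ.symm w)).2 (hφ (Φ.symm z)).2 (hs w hw).1 (hs w hw).2 (hs z hz).1
        (hs z hz).2 t ht
      rwa [(hφ _).1, (hφ _).1, Φ.right_inv (hB w hw), Φ.right_inv (hB z hz)] at this
  have hG2 : ContinuousOn (fun p : ℝ × M ↦ Φ (φ p.1 p.2)) (Icc 0 T ×ˢ (Φ.source ∩ Φ ⁻¹' B)) := by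
    have h1 : ContinuousOn (fun p : ℝ × M ↦ (Φ p.2, p.1)) (Icc 0 T ×ˢ (Φ.source ∩ Φ ⁻¹' B)) :=
      ((continuousOn_extChartAt e).comp continuousOn_snd fun p hp ↦ hp.2.1).prodMk continuousOn_fst
    refine (hG.comp h1 fun p hp ↦ ⟨hp.2.2, hp.1⟩).congr fun p hp ↦ ?_
    change _ = Φ (φ p.1 (Φ.symm (Φ p.2)))
    rw [Φ.left_inv hp.2.1]
  have hc : ∀ p ∈ Icc 0 T ×ˢ (Φ.source ∩ Φ ⁻¹' B), φ p.1 p.2 ∈ Φ.source := by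
    intro p hp
    refine (h.confined _ (hφ p.2).2 ?_ ?_ p.1 hp.1).1
    · rw [(hφ _).1]; exact hp.2.1
    · rw [(hφ _).1]; exact hp.2.2
  refine ((continuousOn_extChartAt_symm e).comp hG2 fun p hp ↦ Φ.map_source (hc p hp)).congr
    fun p hp ↦ ?_
  exact (Φ.left_inv (hc p hp)).symm

end IsFlowBox

variable [IsManifold (𝓡 n) ∞ M] [T2Space M]

/-- Integral curves are determined by their initial points. -/
theorem curve_eq_of_isMIntegralCurveOn
    (hf : ContMDiff (𝓡 n) (𝓡 n).tangent ∞ (fun x ↦ (⟨x, f x⟩ : TangentBundle (𝓡 n) M)))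
    {γ₁ γ₂ : ℝ → M}
    (hγ₁ : IsMIntegralCurveOn (I := 𝓡 n) γ₁ f (Ici 0))
    (hγ₂ : IsMIntegralCurveOn (I := 𝓡 n) γ₂ f (Ici 0)) (heq : γ₁ 0 = γ₂ 0) {t : ℝ} (ht : 0 ≤ t) :
    γ₁ t = γ₂ t := by
  refine rel_of_locally (R := fun s t ↦ γ₁ s = γ₂ s → γ₁ t = γ₂ t) ht
    (fun r s t _ _ _ h1 h2 h ↦ h2 (h1 h)) (fun τ hτ ↦ ?_) heq
  obtain ⟨F, F', S, B, T, hbox⟩ := exists_isFlowBox hf (γ₁ τ)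
  have hT := hbox.pos
  have h1 : ∀ᶠ s in 𝓝[Icc 0 t] τ,
      γ₁ s ∈ (extChartAt (𝓡 n) (γ₁ τ)).source ∩ extChartAt (𝓡 n) (γ₁ τ) ⁻¹' B :=
    ((hγ₁.continuousOn τ hτ.1).mono Icc_subset_Ici_self).eventually hbox.nhds_mem
  have h2 : ∀ᶠ s in 𝓝[Icc 0 t] τ, s ∈ Metric.ball τ (T / 2) :=
    mem_nhdsWithin_of_mem_nhds (Metric.ball_mem_nhds τ (half_pos hT))
  refine ⟨_, (h1.and h2).and self_mem_nhdsWithin, fun s hs r hr hsr heq ↦ ?_⟩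
  obtain ⟨⟨hs1, hs2⟩, hs3⟩ := hs
  have hr2 := hr.1.2
  rw [Metric.mem_ball, Real.dist_eq, abs_lt] at hs2 hr2
  have := hbox.curve_eq (isMIntegralCurveOn_shift hγ₁ hs3.1) (isMIntegralCurveOn_shift hγ₂ hs3.1)
    (by simpa using heq) (by simpa using hs1.1) (by simpa using hs1.2) (t := r - s)
    ⟨by linarith, by linarith⟩
  simpa using this

/-- The semigroup property. -/
theorem IsForwardFlow.map_add
    (hf : ContMDiff (𝓡 n) (𝓡 n).tangent ∞ (fun x ↦ (⟨x, f x⟩ : TangentBundle (𝓡 n) M)))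
    (hφ : IsForwardFlow f φ) {s t : ℝ} (hs : 0 ≤ s) (ht : 0 ≤ t) (x : M) :
    φ (s + t) x = φ s (φ t x) :=
  curve_eq_of_isMIntegralCurveOn hf (isMIntegralCurveOn_shift (hφ x).2 ht) (hφ (φ t x)).2
    (by rw [(hφ (φ t x)).1, zero_add]) hs

end FlowRegularity

section StrictDifferentiability

variable {n : ℕ} {M : Type*} [TopologicalSpace M] [ChartedSpace (EuclideanSpace ℝ (Fin n)) M]

/-- `g` is strictly differentiable at `x` in the preferred charts at `a` (around `x`) and at `b`
(around `g x`). -/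
def IsStrictlyDifferentiableIn (a b : M) (g : M → M) (x : M) : Prop :=
  ContinuousAt g x ∧ x ∈ (extChartAt (𝓡 n) a).source ∧ g x ∈ (extChartAt (𝓡 n) b).source ∧
    ∃ D : EuclideanSpace ℝ (Fin n) →L[ℝ] EuclideanSpace ℝ (Fin n),
      HasStrictFDerivAt (fun w ↦ extChartAt (𝓡 n) b (g ((extChartAt (𝓡 n) a).symm w))) D
        (extChartAt (𝓡 n) a x)

theorem IsStrictlyDifferentiableIn.comp {a b c x : M} {g h : M → M}
    (hh : IsStrictlyDifferentiableIn (n := n) b c h (g x))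
    (hg : IsStrictlyDifferentiableIn (n := n) a b g x) :
    IsStrictlyDifferentiableIn (n := n) a c (h ∘ g) x := by
  obtain ⟨hgc, hxa, hgb, D, hD⟩ := hg
  obtain ⟨hhc, -, hhc', D', hD'⟩ := hh
  refine ⟨hhc.comp hgc, hxa, hhc', D'.comp D, ?_⟩
  set Φ := extChartAt (𝓡 n) a
  set Ψ := extChartAt (𝓡 n) b
  have hx : Φ.symm (Φ x) = x := Φ.left_inv hxa
  have h1 : HasStrictFDerivAt (fun w ↦ extChartAt (𝓡 n) c (h (Ψ.symm w))) D'
      (Ψ (g (Φ.symm (Φ x)))) := by rwa [hx]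
  refine (h1.comp (Φ x) hD).congr_of_eventuallyEq ?_
  have hsymm : Tendsto Φ.symm (𝓝 (Φ x)) (𝓝 x) := by
    have := continuousAt_extChartAt_symm' (I := 𝓡 n) hxa
    rwa [ContinuousAt, hx] at this
  filter_upwards [(hgc.tendsto.comp hsymm).eventually
    ((isOpen_extChartAt_source b).mem_nhds hgb)] with w hw
  rw [Ψ.left_inv (x := g (Φ.symm w)) hw]
  rfl

/-- In a flow box the flow for short times is the flow of a `C¹` vector field in coordinates. -/
theorem IsFlowBox.isStrictlyDifferentiableIn {f : ∀ x : M, TangentSpace (𝓡 n) x} {φ : ℝ → M → M}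
    {e : M} {F : EuclideanSpace ℝ (Fin n) → EuclideanSpace ℝ (Fin n)}
    {F' : EuclideanSpace ℝ (Fin n) → EuclideanSpace ℝ (Fin n) →L[ℝ] EuclideanSpace ℝ (Fin n)}
    {S B : Set (EuclideanSpace ℝ (Fin n))} {T : ℝ} (h : IsFlowBox f e F F' S B T)
    (hφ : IsForwardFlow f φ) {y : M} (hy : y ∈ (extChartAt (𝓡 n) e).source)
    (hyB : extChartAt (𝓡 n) e y ∈ B) {t : ℝ} (ht : t ∈ Icc 0 T) :
    IsStrictlyDifferentiableIn (n := n) e e (φ t) y := by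
  set Φ := extChartAt (𝓡 n) e with hΦ
  have hsrc : Φ.source = (chartAt (EuclideanSpace ℝ (Fin n)) e).source := extChartAt_source _ e
  have hB : ∀ w ∈ B, w ∈ Φ.target := fun w hw ↦ h.subset_target (h.subset hw)
  have hs : ∀ w ∈ B, φ 0 (Φ.symm w) ∈ Φ.source ∧ Φ (φ 0 (Φ.symm w)) ∈ B := by
    intro w hw
    rw [(hφ _).1, Φ.right_inv (hB w hw)]
    exact ⟨Φ.map_target (hB w hw), hw⟩
  have hconf : ∀ w ∈ B, ∀ t ∈ Icc 0 T, _ := fun w hw t ht ↦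
    h.confined _ (hφ (Φ.symm w)).2 (hs w hw).1 (hs w hw).2 t ht
  have hty : φ t y ∈ Φ.source := by
    have := (hconf (Φ y) hyB t ht).1
    rwa [Φ.left_inv hy] at this
  have hWo : IsOpen (Φ.source ∩ Φ ⁻¹' B) :=
    (continuousOn_extChartAt e).isOpen_inter_preimage (isOpen_extChartAt_source e) h.isOpen
  have hcont : ContinuousOn (φ t) (Φ.source ∩ Φ ⁻¹' B) :=
    (h.continuousOn_flow hφ).comp (f := fun z ↦ (t, z)) (by fun_prop) fun z hz ↦ ⟨ht, hz⟩
  obtain ⟨K, hKT, hK⟩ := h.short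
  have hKt : 2 * K * t ≤ 1 := le_trans (by gcongr; exact ht.2) hKT
  refine ⟨hcont.continuousAt (hWo.mem_nhds ⟨hy, hyB⟩), hy, hty, ?_⟩
  refine exists_hasStrictFDerivAt_of_flow h.isCompact h.convex h.hasFDerivAt h.continuousOn h.isOpen
    (G := fun t w ↦ Φ (φ t (Φ.symm w))) ht.1 hK hKt (fun w hw ↦ ?_)
    (fun w hw r hr ↦ (hconf w hw r ⟨hr.1, hr.2.trans ht.2⟩).2.1) (fun w hw ↦ ?_)
    (fun w hw r hr ↦ (hconf w hw r ⟨hr.1, hr.2.le.trans ht.2⟩).2.2) hyB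
  · rw [(hφ _).1, Φ.right_inv (hB w hw)]
  · exact (h.curve_continuousOn (hφ (Φ.symm w)).2 (hs w hw).1 (hs w hw).2).mono
      (Icc_subset_Icc_right ht.2)

variable [IsManifold (𝓡 n) ∞ M]

theorem isStrictlyDifferentiableIn_id {a b x : M} (ha : x ∈ (extChartAt (𝓡 n) a).source)
    (hb : x ∈ (extChartAt (𝓡 n) b).source) : IsStrictlyDifferentiableIn (n := n) a b id x := by
  refine ⟨continuousAt_id, ha, hb, _, ContDiffAt.hasStrictFDerivAt (n := ∞) ?_ (by simp)⟩
  have h1 := contDiffWithinAt_ext_coord_change (I := 𝓡 n) (n := ∞) b a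
    (y := extChartAt (𝓡 n) a x) (by
      rw [PartialEquiv.trans_source, PartialEquiv.symm_source]
      refine ⟨(extChartAt (𝓡 n) a).map_source ha, ?_⟩
      rwa [mem_preimage, (extChartAt (𝓡 n) a).left_inv ha])
  rw [ModelWithCorners.range_eq_univ, contDiffWithinAt_univ] at h1
  exact h1

/-- Strict differentiability does not depend on the charts, and the derivative in the preferred
charts is the manifold derivative. -/
theorem IsStrictlyDifferentiableIn.hasStrictFDerivAt {a b x : M} {g : M → M}
    (hg : IsStrictlyDifferentiableIn (n := n) a b g x) :
    HasStrictFDerivAt (fun w ↦ extChartAt (𝓡 n) (g x) (g ((extChartAt (𝓡 n) x).symm w)))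
      (mfderiv (𝓡 n) (𝓡 n) g x : EuclideanSpace ℝ (Fin n) →L[ℝ] EuclideanSpace ℝ (Fin n))
      (extChartAt (𝓡 n) x x) := by
  obtain ⟨-, -, -, D, hD⟩ := ((isStrictlyDifferentiableIn_id (n := n) (b := g x) hg.2.2.1
    (mem_extChartAt_source _)).comp hg).comp (isStrictlyDifferentiableIn_id (n := n) (a := x)
      (mem_extChartAt_source x) hg.2.1)
  have h1 : HasFDerivAt (fun w ↦ extChartAt (𝓡 n) (g x) (g ((extChartAt (𝓡 n) x).symm w)))
      (mfderiv (𝓡 n) (𝓡 n) g x : EuclideanSpace ℝ (Fin n) →L[ℝ] EuclideanSpace ℝ (Fin n))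
      (extChartAt (𝓡 n) x x) := by
    have hd : MDifferentiableAt (𝓡 n) (𝓡 n) g x :=
      ⟨hg.1.continuousWithinAt, hD.hasFDerivAt.differentiableAt.differentiableWithinAt⟩
    have := hd.hasMFDerivAt.2
    rw [ModelWithCorners.range_eq_univ] at this
    exact hasFDerivWithinAt_univ.1 this
  have h2 : D = mfderiv (𝓡 n) (𝓡 n) g x := hD.hasFDerivAt.unique h1
  rw [← h2]
  exact hD

/-- The time maps of the flow of a smooth vector field are strictly differentiable: they are
compositions of time maps in flow boxes along the orbit. -/
theorem IsForwardFlow.exists_isStrictlyDifferentiableIn [T2Space M]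
    {f : ∀ x : M, TangentSpace (𝓡 n) x} {φ : ℝ → M → M}
    (hf : ContMDiff (𝓡 n) (𝓡 n).tangent ∞ (fun x ↦ (⟨x, f x⟩ : TangentBundle (𝓡 n) M)))
    (hφ : IsForwardFlow f φ) {t : ℝ} (ht : 0 ≤ t) (x : M) :
    ∃ a b, IsStrictlyDifferentiableIn (n := n) a b (φ t) x := by
  have key := rel_of_locally
    (R := fun s r ↦ ∃ a b, IsStrictlyDifferentiableIn (n := n) a b (φ (r - s)) (φ s x)) ht
    (fun r s t hr hrs hst h1 h2 ↦ ?_) fun τ hτ ↦ ?_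
  · simpa only [sub_zero, (hφ x).1] using key
  · obtain ⟨a, b, h1⟩ := h1
    obtain ⟨a', b', h2⟩ := h2
    have hsx : φ (s - r) (φ r x) = φ s x := by
      rw [← hφ.map_add hf (by linarith) hr, sub_add_cancel]
    have hcomp : φ (t - r) = φ (t - s) ∘ id ∘ φ (s - r) := by
      funext y
      change _ = φ (t - s) (φ (s - r) y)
      rw [← hφ.map_add hf (by linarith) (by linarith), sub_add_sub_cancel]
    have hb : φ s x ∈ (extChartAt (𝓡 n) b).source := hsx ▸ h1.2.2.1
    rw [← hsx] at h2 hb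
    refine ⟨a, b', ?_⟩
    rw [hcomp]
    exact IsStrictlyDifferentiableIn.comp (g := id ∘ φ (s - r)) h2
      (IsStrictlyDifferentiableIn.comp (h := id) (isStrictlyDifferentiableIn_id hb h2.2.1) h1)
  · obtain ⟨F, F', S, B, T, hbox⟩ := exists_isFlowBox hf (φ τ x)
    have hT := hbox.pos
    have h1 : ∀ᶠ s in 𝓝[Icc 0 t] τ,
        φ s x ∈ (extChartAt (𝓡 n) (φ τ x)).source ∩ extChartAt (𝓡 n) (φ τ x) ⁻¹' B :=
      (((hφ x).2.continuousOn τ hτ.1).mono Icc_subset_Ici_self).eventually hbox.nhds_mem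
    have h2 : ∀ᶠ s in 𝓝[Icc 0 t] τ, s ∈ Metric.ball τ (T / 2) :=
      mem_nhdsWithin_of_mem_nhds (Metric.ball_mem_nhds τ (half_pos hT))
    refine ⟨_, h1.and h2, fun s hs r hr hsr ↦ ⟨φ τ x, φ τ x, ?_⟩⟩
    obtain ⟨⟨hs1, hs1'⟩, hs2⟩ := hs
    have hr2 := hr.2
    rw [Metric.mem_ball, Real.dist_eq, abs_lt] at hs2 hr2
    exact hbox.isStrictlyDifferentiableIn hφ hs1 hs1' ⟨by linarith, by linarith⟩

theorem IsForwardFlow.continuous [T2Space M] {f : ∀ x : M, TangentSpace (𝓡 n) x} {φ : ℝ → M → M}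
    (hf : ContMDiff (𝓡 n) (𝓡 n).tangent ∞ (fun x ↦ (⟨x, f x⟩ : TangentBundle (𝓡 n) M)))
    (hφ : IsForwardFlow f φ) {t : ℝ} (ht : 0 ≤ t) : Continuous (φ t) :=
  continuous_iff_continuousAt.2 fun x ↦
    (hφ.exists_isStrictlyDifferentiableIn hf ht x).choose_spec.choose_spec.1

theorem IsForwardFlow.hasStrictFDerivAt [T2Space M] {f : ∀ x : M, TangentSpace (𝓡 n) x}
    {φ : ℝ → M → M}
    (hf : ContMDiff (𝓡 n) (𝓡 n).tangent ∞ (fun x ↦ (⟨x, f x⟩ : TangentBundle (𝓡 n) M)))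
    (hφ : IsForwardFlow f φ) {t : ℝ} (ht : 0 ≤ t) (x : M) :
    HasStrictFDerivAt (fun w ↦ extChartAt (𝓡 n) (φ t x) (φ t ((extChartAt (𝓡 n) x).symm w)))
      (mfderiv (𝓡 n) (𝓡 n) (φ t) x : EuclideanSpace ℝ (Fin n) →L[ℝ] EuclideanSpace ℝ (Fin n))
      (extChartAt (𝓡 n) x x) :=
  (hφ.exists_isStrictlyDifferentiableIn hf ht x).choose_spec.choose_spec.hasStrictFDerivAt

/-- Joint continuity of the flow: near time `t` it is the composition of a flow box around `φ t x`
with a time map `φ s`, where `s < t` (or `s = t = 0`) is close to `t`. -/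
theorem IsForwardFlow.continuousOn [T2Space M] {f : ∀ x : M, TangentSpace (𝓡 n) x}
    {φ : ℝ → M → M}
    (hf : ContMDiff (𝓡 n) (𝓡 n).tangent ∞ (fun x ↦ (⟨x, f x⟩ : TangentBundle (𝓡 n) M)))
    (hφ : IsForwardFlow f φ) :
    ContinuousOn (fun p : ℝ × M ↦ φ p.1 p.2) (Ici 0 ×ˢ univ) := by
  rintro ⟨t, x⟩ ⟨ht, -⟩
  have ht : 0 ≤ t := ht
  obtain ⟨F, F', S, B, T, hbox⟩ := exists_isFlowBox hf (φ t x)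
  have hT := hbox.pos
  obtain ⟨s, hs0, hst, htT, hsW⟩ : ∃ s, 0 ≤ s ∧ (s < t ∨ t = 0 ∧ s = 0) ∧ t - s < T ∧
      φ s x ∈ (extChartAt (𝓡 n) (φ t x)).source ∩ extChartAt (𝓡 n) (φ t x) ⁻¹' B := by
    rcases ht.eq_or_lt with rfl | ht
    · refine ⟨0, le_rfl, Or.inr ⟨rfl, rfl⟩, by simpa using hT, mem_of_mem_nhds hbox.nhds_mem⟩
    · have h1 : Tendsto (fun s ↦ φ s x) (𝓝[<] t) (𝓝 (φ t x)) :=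
        ((((hφ x).2.continuousOn t ht.le).continuousAt (Ici_mem_nhds ht)).tendsto).mono_left
          nhdsWithin_le_nhds
      have h2 : ∀ᶠ s in 𝓝[<] t, s ∈ Ioo (max 0 (t - T)) t :=
        Ioo_mem_nhdsLT (max_lt ht (by linarith))
      obtain ⟨s, hs1, hs2⟩ := ((h1.eventually hbox.nhds_mem).and h2).exists
      exact ⟨s, (le_max_left _ _).trans hs2.1.le, Or.inl hs2.2,
        by linarith [(le_max_right 0 (t - T)).trans_lt hs2.1], hs1⟩
  have hcs : Continuous (φ s) := hφ.continuous hf hs0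
  set W := (extChartAt (𝓡 n) (φ t x)).source ∩ extChartAt (𝓡 n) (φ t x) ⁻¹' B with hW
  have hWo : IsOpen W :=
    (continuousOn_extChartAt _).isOpen_inter_preimage (isOpen_extChartAt_source _) hbox.isOpen
  have hst' : s ≤ t := by rcases hst with h | ⟨h, h'⟩ <;> linarith
  have h1 : ContinuousWithinAt (fun p : ℝ × M ↦ φ p.1 p.2) (Icc 0 T ×ˢ W) (t - s, φ s x) :=
    hbox.continuousOn_flow hφ _ ⟨⟨by linarith, htT.le⟩, hsW⟩
  have h2 : Tendsto (fun p : ℝ × M ↦ (p.1 - s, φ s p.2)) (𝓝[Ici 0 ×ˢ univ] (t, x))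
      (𝓝[Icc 0 T ×ˢ W] (t - s, φ s x)) := by
    refine tendsto_nhdsWithin_iff.2 ⟨?_, ?_⟩
    · have : Continuous (fun p : ℝ × M ↦ (p.1 - s, φ s p.2)) := by fun_prop
      exact this.continuousAt.continuousWithinAt
    · have h3 : ∀ᶠ p : ℝ × M in 𝓝[Ici 0 ×ˢ univ] (t, x), φ s p.2 ∈ W :=
        ((hcs.comp continuous_snd).continuousAt.continuousWithinAt).eventually (hWo.mem_nhds hsW)
      have h4 : ∀ᶠ p : ℝ × M in 𝓝[Ici 0 ×ˢ univ] (t, x), p.1 < s + T :=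
        (continuous_fst.continuousAt.continuousWithinAt).eventually
          (Iio_mem_nhds (show t < s + T by linarith))
      have h5 : ∀ᶠ p : ℝ × M in 𝓝[Ici 0 ×ˢ univ] (t, x), s ≤ p.1 := by
        rcases hst with h | ⟨rfl, rfl⟩
        · filter_upwards [(continuous_fst.continuousAt.continuousWithinAt).eventually
            (Ioi_mem_nhds (show s < t from h))] with p hp using le_of_lt hp
        · filter_upwards [self_mem_nhdsWithin] with p hp using hp.1
      filter_upwards [h3, h4, h5] with p hp3 hp4 hp5
      exact ⟨⟨by linarith, by linarith⟩, hp3⟩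
  have h3 := h1.tendsto.comp h2
  have h4 : φ (t - s) (φ s x) = φ t x := by
    rw [← IsForwardFlow.map_add hf hφ (by linarith) hs0, sub_add_cancel]
  change Tendsto _ _ (𝓝 (φ (t - s) (φ s x))) at h3
  rw [h4] at h3
  refine h3.congr' ?_
  have h5 : ∀ᶠ p : ℝ × M in 𝓝[Ici 0 ×ˢ univ] (t, x), s ≤ p.1 := by
    rcases hst with h | ⟨rfl, rfl⟩
    · filter_upwards [(continuous_fst.continuousAt.continuousWithinAt).eventually
        (Ioi_mem_nhds (show s < t from h))] with p hp using le_of_lt hp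
    · filter_upwards [self_mem_nhdsWithin] with p hp using hp.1
  filter_upwards [h5] with p hp
  change φ (p.1 - s) (φ s p.2) = φ p.1 p.2
  rw [← IsForwardFlow.map_add hf hφ (by linarith) hs0, sub_add_cancel]

end StrictDifferentiability

/-! ### Strong monotonicity with respect to the conal order -/

section StrongMonotonicity

variable {n : ℕ} {M : Type*} [TopologicalSpace M] [ChartedSpace (EuclideanSpace ℝ (Fin n)) M]
  {C : ∀ x : M, Set (TangentSpace (𝓡 n) x)}

theorem IsSolidConeField.isClosedConvexCone_coneAt (h : IsSolidConeField C) (e : M) :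
    IsClosedConvexCone (coneAt C e) := (h e).1

theorem IsSolidConeField.nonempty_interior (h : IsSolidConeField C) (e : M) :
    (interior (coneAt C e)).Nonempty := (h e).2

/-- Near a point, a strictly differentiable map whose derivative is strongly positive maps the end
points of a short conal curve to strictly ordered points. -/
theorem IsSolidConeField.exists_nhds_stableLL_map [IsManifold (𝓡 n) ∞ M]
    [Nontrivial (EuclideanSpace ℝ (Fin n))] [RiemannianBundle (fun x : M ↦ TangentSpace (𝓡 n) x)]
    (h : IsSolidConeField C) (H3 : IsGammaInvariant C) {ψ : M → M} {e : M} (hψ : ContinuousAt ψ e)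
    {D : EuclideanSpace ℝ (Fin n) →L[ℝ] EuclideanSpace ℝ (Fin n)}
    (hD : HasStrictFDerivAt (fun w ↦ extChartAt (𝓡 n) (ψ e) (ψ ((extChartAt (𝓡 n) e).symm w))) D
      (extChartAt (𝓡 n) e e))
    (hpos : ∀ w ∈ coneAt C e, w ≠ 0 → D w ∈ interior (coneAt C (ψ e))) :
    ∃ U ∈ 𝓝 e, ∀ (γ : ℝ → M) (a b : ℝ), a ≤ b → IsConalCurve C γ a b →
      (∀ t ∈ Icc a b, γ t ∈ U) → γ a ≠ γ b → StableLL C (ψ (γ a)) (ψ (γ b)) := by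
  obtain ⟨P, hP⟩ := exists_isConeTransport H3 e
  obtain ⟨Q, hQ⟩ := exists_isConeTransport H3 (ψ e)
  obtain ⟨l, hl⟩ := (h.isClosedConvexCone_coneAt e).exists_norm_le
  obtain ⟨c, hc, ε, hε, hεl, hball⟩ :=
    (h.isClosedConvexCone_coneAt e).exists_closedBall_subset_of_mem_fatCone
      (h.isClosedConvexCone_coneAt (ψ e)) hpos l
  obtain ⟨U, hU, hUfat⟩ := hP.exists_nhds_sub_mem_fatCone (h.isClosedConvexCone_coneAt e) hl hε hεl
  -- the increment `v` of a conal curve is mapped to `v'` with `‖v' - D v‖ ≤ c / 2 * ‖v‖`, so that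
  -- the ball of radius `c / 2 * ‖v‖ ≥ η * ‖v'‖` around `v'` is in the cone
  have hη : 0 < c / 2 / (‖D‖ + c / 2) := by positivity
  obtain ⟨V, hV, hVll⟩ := hQ.exists_nhds_stableLL hη
  set Φ := extChartAt (𝓡 n) e with hΦ
  set Ψ := extChartAt (𝓡 n) (ψ e) with hΨ
  obtain ⟨p, hp, hp'⟩ := hD.approximates_deriv_on_nhds (c := (c / 2).toNNReal)
    (Or.inr (Real.toNNReal_pos.2 (half_pos hc)))
  have hW : ∀ᶠ y in 𝓝 e, y ∈ U ∧ ψ y ∈ V ∧ Φ y ∈ p ∧ y ∈ Φ.source :=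
    Filter.Eventually.and hU (Filter.Eventually.and (hψ hV)
      (((continuousAt_extChartAt e).eventually hp).and (extChartAt_source_mem_nhds e)))
  refine ⟨{y | y ∈ U ∧ ψ y ∈ V ∧ Φ y ∈ p ∧ y ∈ Φ.source}, hW, fun γ a b hab hγ hγW hne ↦ ?_⟩
  obtain ⟨-, hVa, hpa, hsa⟩ := hγW a (left_mem_Icc.2 hab)
  obtain ⟨-, hVb, hpb, hsb⟩ := hγW b (right_mem_Icc.2 hab)
  have hfat := hUfat γ a b hab hγ fun t ht ↦ (hγW t ht).1
  have hst := hp' _ hpb _ hpa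
  beta_reduce at hst
  rw [Real.coe_toNNReal _ (half_pos hc).le, Φ.left_inv hsa, Φ.left_inv hsb] at hst
  set v := Φ (γ b) - Φ (γ a)
  set v' := Ψ (ψ (γ b)) - Ψ (ψ (γ a))
  have hv0 : 0 < ‖v‖ := norm_pos_iff.2 (sub_ne_zero.2 fun heq ↦ hne (Φ.injOn hsb hsa heq).symm)
  have hsub : Metric.closedBall v' (c / 2 * ‖v‖) ⊆ coneAt C (ψ e) := by
    refine (Metric.closedBall_subset_closedBall' ?_).trans (hball v hfat)
    rw [dist_eq_norm]
    linarith
  have hv' : ‖v'‖ ≤ (‖D‖ + c / 2) * ‖v‖ := by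
    calc ‖v'‖ = ‖(v' - D v) + D v‖ := by rw [sub_add_cancel]
      _ ≤ c / 2 * ‖v‖ + ‖D‖ * ‖v‖ := (norm_add_le _ _).trans (add_le_add hst (D.le_opNorm v))
      _ = _ := by ring
  refine hVll _ hVa _ hVb (fun h0 ↦ ?_) ((Metric.closedBall_subset_closedBall ?_).trans hsub)
  · rw [show v' = 0 from h0] at hsub
    exact (h.isClosedConvexCone_coneAt (ψ e)).zero_notMem_interior (mem_interior_iff_mem_nhds.2
      (mem_of_superset (Metric.closedBall_mem_nhds 0 (by positivity)) hsub))
  · rw [div_mul_eq_mul_div, div_le_iff₀ (by positivity)]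
    calc c / 2 * ‖v'‖ ≤ c / 2 * ((‖D‖ + c / 2) * ‖v‖) := by gcongr
      _ = _ := by ring

/-- A map with strongly positive derivatives is strongly monotone for the conal order. -/
theorem IsSolidConeField.stableLL_map [IsManifold (𝓡 n) ∞ M]
    [Nontrivial (EuclideanSpace ℝ (Fin n))] [RiemannianBundle (fun x : M ↦ TangentSpace (𝓡 n) x)]
    (h : IsSolidConeField C) (H3 : IsGammaInvariant C) {ψ : M → M} (hψ : Continuous ψ)
    {D : M → EuclideanSpace ℝ (Fin n) →L[ℝ] EuclideanSpace ℝ (Fin n)}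
    (hD : ∀ e, HasStrictFDerivAt
      (fun w ↦ extChartAt (𝓡 n) (ψ e) (ψ ((extChartAt (𝓡 n) e).symm w))) (D e)
      (extChartAt (𝓡 n) e e))
    (hpos : ∀ e, ∀ w ∈ coneAt C e, w ≠ 0 →
      D e w ∈ interior (coneAt C (ψ e))) {x y : M}
    (hxy : ConalLE C x y) (hne : x ≠ y) : StableLL C (ψ x) (ψ y) := by
  obtain ⟨γ, a, b, hab, hγ, rfl, rfl⟩ := hxy
  -- chain the local statement along a conal curve from `x` to `y`
  refine (rel_of_locally (R := fun s t ↦ γ s = γ t ∨ StableLL C (ψ (γ s)) (ψ (γ t))) hab.le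
    ?_ fun τ hτ ↦ ?_).resolve_left hne
  · rintro r s t - - - (h1 | h1) (h2 | h2)
    · exact Or.inl (h1.trans h2)
    · exact Or.inr (h1 ▸ h2)
    · exact Or.inr (h2 ▸ h1)
    · exact Or.inr (h1.trans h2)
  · obtain ⟨U, hU, hUll⟩ := h.exists_nhds_stableLL_map H3 hψ.continuousAt (hD (γ τ)) (hpos (γ τ))
    obtain ⟨δ, hδ, hδU⟩ := Metric.mem_nhdsWithin_iff.1 (hγ.1.1 τ hτ hU)
    refine ⟨Metric.ball τ δ ∩ Icc a b,
      inter_mem (mem_nhdsWithin_of_mem_nhds (Metric.ball_mem_nhds τ hδ)) self_mem_nhdsWithin,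
      fun s hs t ht hst ↦ or_iff_not_imp_left.2 fun hne ↦ ?_⟩
    refine hUll γ s t hst (hγ.mono hs.2.1 hst ht.2.2) (fun r hr ↦ hδU ⟨?_, ?_⟩) hne
    · rw [Real.ball_eq_Ioo] at hs ht ⊢
      exact ⟨hs.1.1.trans_le hr.1, hr.2.trans_lt ht.1.2⟩
    · exact ⟨hs.2.1.trans hr.1, hr.2.trans ht.2.2⟩

/-- A stable self-relation `x ≪ x` would put `x` in a closed chain with a point `y ≠ x` nearby,
which exists because manifolds of positive dimension have no isolated points. -/
theorem not_stableLL_self [Nontrivial (EuclideanSpace ℝ (Fin n))]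
    (H1 : ∀ x y : M, ConalLE C x y → ConalLE C y x → x = y) (x : M) : ¬ StableLL C x x := by
  intro hx
  obtain ⟨U, hU, V, hV, hUV⟩ := mem_nhds_prod_iff.1 (mem_interior_iff_mem_nhds.1 hx)
  set Φ := extChartAt (𝓡 n) x
  have h1 : Φ.symm ⁻¹' (U ∩ V) ∈ 𝓝 (Φ x) := by
    refine (continuousAt_extChartAt_symm x).preimage_mem_nhds ?_
    rw [extChartAt_to_inv]
    exact inter_mem hU hV
  obtain ⟨z, ⟨hz, hzt⟩, hzx⟩ := (mem_closure_iff_nhds.1 ((dense_compl_singleton (Φ x)) (Φ x)) _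
    (inter_mem h1 (extChartAt_target_mem_nhds x))).imp fun z hz ↦ hz
  have hne : Φ.symm z ≠ x := fun heq ↦ hzx (by rw [mem_singleton_iff, ← heq, Φ.right_inv hzt])
  have hxy : ConalLL C x (Φ.symm z) := hUV (mk_mem_prod (mem_of_mem_nhds hU) hz.2)
  have hyx : ConalLL C (Φ.symm z) x := hUV (mk_mem_prod hz.1 (mem_of_mem_nhds hV))
  exact hne (H1 _ _ hyx.conalLE hxy.conalLE)

/-- A strongly differentially positive flow is strongly monotone for the conal order. -/
theorem IsForwardFlow.isStronglyMonotoneFlow [FirstCountableTopology M] [T2Space M]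
    [IsManifold (𝓡 n) ∞ M] [Nontrivial (EuclideanSpace ℝ (Fin n))]
    [RiemannianBundle (fun x : M ↦ TangentSpace (𝓡 n) x)]
    (hsolid : IsSolidConeField C) {f : ∀ x : M, TangentSpace (𝓡 n) x}
    (hf : ContMDiff (𝓡 n) (𝓡 n).tangent ∞ (fun x ↦ (⟨x, f x⟩ : TangentBundle (𝓡 n) M)))
    {φ : ℝ → M → M} (hφ : IsForwardFlow f φ)
    (hcompact : ∀ x, IsCompact (closure ((fun t ↦ φ t x) '' Ici 0)))
    (hSDP : IsStronglyDifferentiallyPositive C φ)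
    (H1 : ∀ x y : M, ConalLE C x y → ConalLE C y x → x = y) (H2 : IsQuasiClosed C)
    (H3 : IsGammaInvariant C) :
    IsStronglyMonotoneFlow (StableLL C) (ConalLE C) φ := by
  refine ⟨fun x ↦ (hφ x).1, fun s t hs ht x ↦ hφ.map_add hf hs ht x, hφ.continuousOn hf,
    hcompact, H1, fun x y z ↦ StableLL.trans, not_stableLL_self H1, isOpen_stableLL, ?_, ?_⟩
  · rintro ⟨x, y⟩ hp
    obtain ⟨u, hu, hux⟩ := mem_closure_iff_seq_limit.1 hp
    exact H2 x y (fun k ↦ (u k).1) (fun k ↦ (u k).2) ((continuous_fst.tendsto _).comp hux)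
      ((continuous_snd.tendsto _).comp hux) fun k ↦ StableLL.conalLL (hu k)
  · intro t ht x y hxy hne
    exact hsolid.stableLL_map H3 (hφ.continuous hf ht.le) (fun e ↦ hφ.hasStrictFDerivAt hf ht.le e)
      (fun e w hw hw0 ↦ hSDP e t ht w hw hw0) hxy hne

end StrongMonotonicity

/-! ### Expansion near a nonisolated set of equilibria -/

/-- An orbit that visits a closed set at arbitrarily large times accumulates there. -/
theorem IsStronglyMonotoneFlow.exists_mem_omegaLimit_of_frequently {X : Type*} [TopologicalSpace X]
    {ll le : X → X → Prop} {φ : ℝ → X → X} (h : IsStronglyMonotoneFlow ll le φ) {x : X} {S : Set X}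
    (hS : IsClosed S) (hfreq : ∃ᶠ t in atTop, φ t x ∈ S) : ∃ p ∈ omegaLimit atTop φ {x}, p ∈ S := by
  have : (atTop ⊓ 𝓟 {t | φ t x ∈ S}).NeBot := frequently_mem_iff_neBot.1 hfreq
  set F := Ultrafilter.of (atTop ⊓ 𝓟 {t | φ t x ∈ S})
  have hF : (F : Filter ℝ) ≤ atTop ⊓ 𝓟 {t | φ t x ∈ S} := Ultrafilter.of_le _
  obtain ⟨p, hp⟩ := h.exists_tendsto F (s := id) (hF.trans inf_le_left (eventually_ge_atTop 0)) x
  exact ⟨p, mem_omegaLimit_iff_ultrafilter.2 ⟨F, hF.trans inf_le_left, hp⟩,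
    hS.mem_of_tendsto hp (hF.trans inf_le_right (mem_principal_self _))⟩

theorem frequently_mem_of_mem_omegaLimit {X : Type*} [TopologicalSpace X]
    {φ : ℝ → X → X} {x p : X} (hp : p ∈ omegaLimit atTop φ {x}) {W : Set X} (hW : W ∈ 𝓝 p) :
    ∃ᶠ t in atTop, φ t x ∈ W :=
  ((mem_omegaLimit_singleton_iff_mapClusterPt _ _ _ _).1 hp).frequently hW

/-- The omega-limit set of a nonconvergent point has no isolated point: an orbit that comes back to
a point and leaves it infinitely often has to cross the boundaries of small neighbourhoods. -/
theorem IsStronglyMonotoneFlow.frequently_mem_omegaLimit {X : Type*} [TopologicalSpace X]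
    [T2Space X] [RegularSpace X] {ll le : X → X → Prop} {φ : ℝ → X → X}
    (h : IsStronglyMonotoneFlow ll le φ) {x e : X} (hx : x ∉ convergentPoints φ)
    (he : e ∈ omegaLimit atTop φ {x}) :
    ∃ᶠ z in 𝓝[≠] e, z ∈ omegaLimit atTop φ {x} := by
  rw [Filter.Frequently]
  intro hev
  rw [eventually_nhdsWithin_iff] at hev
  obtain ⟨q, hq, hqe⟩ := h.exists_ne_of_notMem_convergentPoints hx e
  obtain ⟨V, ⟨hV, hVc⟩, hVsub⟩ := (closed_nhds_basis e).mem_iff.1 hev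
  set U := interior V
  have hUV : closure U ⊆ V := closure_minimal interior_subset hVc
  have heU : e ∈ U := mem_interior_iff_mem_nhds.2 hV
  have honly : ∀ z ∈ V, z ∈ omegaLimit atTop φ {x} → z = e := fun z hz hzω ↦ by
    by_contra hne
    exact hVsub hz hne hzω
  have hcross : ∃ᶠ t in atTop, φ t x ∈ frontier U := by
    refine frequently_atTop.2 fun T ↦ ?_
    obtain ⟨t₁, ht₁, h1⟩ := frequently_atTop.1
      (frequently_mem_of_mem_omegaLimit he (isOpen_interior.mem_nhds heU)) (max T 0)
    obtain ⟨t₂, ht₂, h2⟩ := frequently_atTop.1 (frequently_mem_of_mem_omegaLimit hq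
      (hVc.isOpen_compl.mem_nhds (show q ∈ Vᶜ from fun hqV ↦ hqe (honly q hqV hq)))) t₁
    have hc : ContinuousOn (fun t ↦ φ t x) (Icc t₁ t₂) := by
      refine h.continuousOn.comp (f := fun t ↦ (t, x)) (by fun_prop) fun t ht ↦ ⟨?_, mem_univ _⟩
      exact ((le_max_right T 0).trans ht₁).trans ht.1
    by_contra hnot
    have hsub : (fun t ↦ φ t x) '' Icc t₁ t₂ ⊆ U ∪ (closure U)ᶜ := by
      rintro _ ⟨t, ht, rfl⟩
      by_contra hz
      rw [mem_union, not_or, notMem_compl_iff] at hz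
      refine hnot ⟨t, ((le_max_left T 0).trans ht₁).trans ht.1, ?_⟩
      rw [isOpen_interior.frontier_eq]
      exact ⟨hz.2, hz.1⟩
    obtain ⟨z, -, hzU, hzU'⟩ := isPreconnected_Icc.image _ hc U (closure U)ᶜ isOpen_interior
      isClosed_closure.isOpen_compl hsub ⟨_, mem_image_of_mem _ (left_mem_Icc.2 ht₂), h1⟩
      ⟨_, mem_image_of_mem _ (right_mem_Icc.2 ht₂), fun h' ↦ h2 (hUV h')⟩
    exact hzU' (subset_closure hzU)
  obtain ⟨p, hpω, hpf⟩ := h.exists_mem_omegaLimit_of_frequently isClosed_frontier hcross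
  have hpe := honly p (hUV (frontier_subset_closure hpf)) hpω
  rw [hpe] at hpf
  rw [(isOpen_interior : IsOpen U).frontier_eq] at hpf
  exact hpf.2 heU

/-- A differentiable map of a finite-dimensional space with fixed points accumulating at `z₀` fixes,
to first order, a limit direction of these fixed points. -/
theorem exists_tendsto_direction {E : Type*} [NormedAddCommGroup E] [NormedSpace ℝ E]
    [FiniteDimensional ℝ E] {g : E → E} {D : E →L[ℝ] E} {z₀ : E} (hg : HasFDerivAt g D z₀)
    (hz₀ : g z₀ = z₀) {p : E → Prop} (hp : ∃ᶠ z in 𝓝[≠] z₀, p z)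
    (hpg : ∀ᶠ z in 𝓝 z₀, p z → g z = z) :
    ∃ (G : Ultrafilter E) (u : E), (G : Filter E) ≤ 𝓝[≠] z₀ ∧ (∀ᶠ z in (G : Filter E), p z) ∧
      Tendsto (fun z ↦ ‖z - z₀‖⁻¹ • (z - z₀)) G (𝓝 u) ∧ D u = u := by
  have : ProperSpace E := FiniteDimensional.proper ℝ E
  have : (𝓝[≠] z₀ ⊓ 𝓟 {z | p z}).NeBot := frequently_mem_iff_neBot.1 hp
  set G := Ultrafilter.of (𝓝[≠] z₀ ⊓ 𝓟 {z | p z})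
  have hG : (G : Filter E) ≤ 𝓝[≠] z₀ ⊓ 𝓟 {z | p z} := Ultrafilter.of_le _
  have hG1 : (G : Filter E) ≤ 𝓝[≠] z₀ := hG.trans inf_le_left
  have hGp : ∀ᶠ z in (G : Filter E), p z := hG.trans inf_le_right (mem_principal_self _)
  have hGne : ∀ᶠ z in (G : Filter E), z ≠ z₀ := hG1 self_mem_nhdsWithin
  have hsph : ∀ᶠ z in (G : Filter E), ‖z - z₀‖⁻¹ • (z - z₀) ∈ Metric.sphere (0 : E) 1 := by
    filter_upwards [hGne] with z hz
    rw [mem_sphere_zero_iff_norm, norm_smul, norm_inv, norm_norm,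
      inv_mul_cancel₀ (norm_ne_zero_iff.2 (sub_ne_zero.2 hz))]
  obtain ⟨u, -, hu⟩ := (isCompact_sphere (0 : E) 1).ultrafilter_le_nhds
    (G.map fun z ↦ ‖z - z₀‖⁻¹ • (z - z₀)) (le_principal_iff.2 hsph)
  have hu' : Tendsto (fun z ↦ ‖z - z₀‖⁻¹ • (z - z₀)) G (𝓝 u) := hu
  refine ⟨G, u, hG1, hGp, hu', ?_⟩
  have h1 : Tendsto (fun z ↦ ‖z - z₀‖⁻¹ • (g z - g z₀ - D (z - z₀))) (𝓝 z₀) (𝓝 0) := by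
    refine squeeze_zero_norm (fun z ↦ ?_) (hasFDerivAt_iff_tendsto.1 hg)
    rw [norm_smul, norm_inv, norm_norm]
  have h2 : Tendsto (fun z ↦ ‖z - z₀‖⁻¹ • (g z - g z₀ - D (z - z₀))) G (𝓝 (u - D u)) := by
    refine (hu'.sub ((D.continuous.tendsto u).comp hu')).congr' ?_
    filter_upwards [hGp, hG1.trans nhdsWithin_le_nhds hpg] with z hz hzg
    rw [hzg hz, hz₀, smul_sub _ (z - z₀), Function.comp_apply, map_smul]
  exact (sub_eq_zero.1 (tendsto_nhds_unique h2
    (h1.mono_left (hG1.trans nhdsWithin_le_nhds)))).symm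

/-- Directions close to an interior direction of a cone lie in it with a uniform margin. -/
theorem IsClosedConvexCone.exists_eventually_closedBall_subset {E : Type*} [NormedAddCommGroup E]
    [NormedSpace ℝ E] {K : Set E} (hK : IsClosedConvexCone K) {u : E} (hu : u ∈ interior K)
    {ι : Type*} {l : Filter ι} {v : ι → E} (hv0 : ∀ᶠ i in l, v i ≠ 0)
    (hv : Tendsto (fun i ↦ ‖v i‖⁻¹ • v i) l (𝓝 u)) :
    ∃ η > 0, ∀ᶠ i in l, Metric.closedBall (v i) (η * ‖v i‖) ⊆ K := by
  obtain ⟨r, hr, hsub⟩ := Metric.mem_nhds_iff.1 (mem_interior_iff_mem_nhds.1 hu)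
  refine ⟨r / 2, by positivity, ?_⟩
  filter_upwards [hv0, Metric.tendsto_nhds.1 hv (r / 2) (by positivity)] with i hi hi' w hw
  have hn : 0 < ‖v i‖ := norm_pos_iff.2 hi
  have h1 : ‖v i‖⁻¹ • w ∈ K := by
    refine hsub ?_
    have h2 : dist (‖v i‖⁻¹ • w) (‖v i‖⁻¹ • v i) ≤ r / 2 := by
      rw [dist_smul₀, norm_inv, norm_norm, inv_mul_le_iff₀ hn, mul_comm]
      exact hw
    rw [Metric.mem_ball]
    linarith [dist_triangle (‖v i‖⁻¹ • w) (‖v i‖⁻¹ • v i) u]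
  have h2 := hK.smul_mem ‖v i‖ hn.le _ h1
  rwa [smul_inv_smul₀ hn.ne'] at h2

section Expansion

variable {n : ℕ} {M : Type*} [TopologicalSpace M] [ChartedSpace (EuclideanSpace ℝ (Fin n)) M]
  {C : ∀ x : M, Set (TangentSpace (𝓡 n) x)}

/-- If fixed points of `ψ` that are unrelated to the fixed point `e` accumulate at `e`, then the
derivative of `ψ` at `e` fixes a direction outside `±C`, and Perron–Frobenius theory makes a power
of `ψ` expand the distances of ordered pairs of points near `e` by an arbitrary factor. -/
theorem IsSolidConeField.exists_nhds_expanding [IsManifold (𝓡 n) ∞ M]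
    [RiemannianBundle (fun x : M ↦ TangentSpace (𝓡 n) x)]
    (h : IsSolidConeField C) (H1 : IsGloballyOrderable C) (H3 : IsGammaInvariant C) {ψ : M → M}
    {e : M} (hψ : ContinuousAt ψ e) (he : ψ e = e)
    {D : EuclideanSpace ℝ (Fin n) →L[ℝ] EuclideanSpace ℝ (Fin n)}
    (hD : HasStrictFDerivAt (fun w ↦ extChartAt (𝓡 n) e (ψ ((extChartAt (𝓡 n) e).symm w))) D
      (extChartAt (𝓡 n) e e))
    (hpos : ∀ w ∈ coneAt C e, w ≠ 0 → D w ∈ interior (coneAt C e)) {A : Set M}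
    (hA : ∃ᶠ z in 𝓝[≠] e, z ∈ A) (hAψ : ∀ z ∈ A, ψ z = z)
    (hAll : ∀ z ∈ A, ¬ StableLL C e z ∧ ¬ StableLL C z e) {κ : ℝ} (hκ : 0 ≤ κ) :
    ∃ m : ℕ, 1 ≤ m ∧ ∃ U ∈ 𝓝 e, ∀ p ∈ U, ∀ q ∈ U, ConalLE C p q →
      κ * ‖extChartAt (𝓡 n) e q - extChartAt (𝓡 n) e p‖ ≤
        ‖extChartAt (𝓡 n) e (ψ^[m] q) - extChartAt (𝓡 n) e (ψ^[m] p)‖ := by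
  obtain ⟨P, hP⟩ := exists_isConeTransport H3 e
  have hK := h.isClosedConvexCone_coneAt e
  set Φ := extChartAt (𝓡 n) e with hΦ
  have heS : e ∈ Φ.source := mem_extChartAt_source e
  have hsymm : Φ.symm (Φ e) = e := Φ.left_inv heS
  set g : EuclideanSpace ℝ (Fin n) → EuclideanSpace ℝ (Fin n) := fun w ↦ Φ (ψ (Φ.symm w)) with hg
  have hge : g (Φ e) = Φ e := by simp only [hg, hsymm, he]
  have hsource : ∀ᶠ y in 𝓝 e, y ∈ Φ.source := extChartAt_source_mem_nhds e
  have htarget : ∀ᶠ w in 𝓝 (Φ e), w ∈ Φ.target := extChartAt_target_mem_nhds e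
  -- the fixed points in the chart
  have hfreq : ∃ᶠ w in 𝓝[≠] (Φ e), Φ.symm w ∈ A := by
    have h1 : Tendsto Φ (𝓝[≠] e) (𝓝[≠] (Φ e)) := by
      refine tendsto_nhdsWithin_iff.2
        ⟨(continuousAt_extChartAt e).tendsto.mono_left nhdsWithin_le_nhds, ?_⟩
      filter_upwards [nhdsWithin_le_nhds hsource, self_mem_nhdsWithin] with y hy hye hΦy
      exact hye (Φ.injOn hy heS hΦy)
    refine h1.frequently ((hA.and_eventually (nhdsWithin_le_nhds hsource)).mono ?_)
    rintro y ⟨hyA, hy⟩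
    rwa [Φ.left_inv hy]
  obtain ⟨G, u, hG, hGA, hGu, hDu⟩ := exists_tendsto_direction hD.hasFDerivAt hge hfreq (by
    filter_upwards [htarget] with w hw hwA
    change Φ (ψ (Φ.symm w)) = w
    rw [hAψ _ hwA, Φ.right_inv hw])
  have hGne : ∀ᶠ w in (G : Filter _), w ≠ Φ e := hG self_mem_nhdsWithin
  have hGn : (G : Filter _) ≤ 𝓝 (Φ e) := hG.trans nhdsWithin_le_nhds
  have hGe : Tendsto Φ.symm G (𝓝 e) := by
    have := continuousAt_extChartAt_symm (I := 𝓡 n) e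
    rw [ContinuousAt, ← hΦ, hsymm] at this
    exact this.mono_left hGn
  have hu0 : u ≠ 0 := by
    rintro rfl
    have h1 : Tendsto (fun w ↦ ‖‖w - Φ e‖⁻¹ • (w - Φ e)‖) G (𝓝 1) := by
      refine tendsto_const_nhds.congr' ?_
      filter_upwards [hGne] with w hw
      rw [norm_smul, norm_inv, norm_norm, inv_mul_cancel₀ (norm_ne_zero_iff.2 (sub_ne_zero.2 hw))]
    have h2 := hGu.norm
    rw [norm_zero] at h2
    exact zero_ne_one (tendsto_nhds_unique h2 h1)
  -- otherwise `u = D u` is interior to the cone and `e` is below some of the fixed points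
  have huC : u ∉ coneAt C e := by
    intro huC
    have hint : u ∈ interior (coneAt C e) := by
      have := hpos u huC hu0
      rwa [hDu] at this
    obtain ⟨η, hη, hball⟩ := hK.exists_eventually_closedBall_subset hint
      (hGne.mono fun w hw ↦ sub_ne_zero.2 hw) hGu
    obtain ⟨U, hU, hUll⟩ := hP.exists_nhds_stableLL hη
    obtain ⟨w, hw1, hw2, hw3, hw4, hw5⟩ :=
      (hGne.and (hball.and (Filter.Eventually.and (hGe hU) (hGA.and (hGn htarget))))).exists
    have hw6 := hUll e (mem_of_mem_nhds hU) (Φ.symm w) hw3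
    rw [← hΦ, Φ.right_inv hw5] at hw6
    exact (hAll _ hw4).1 (hw6 (sub_ne_zero.2 hw1) hw2)
  -- otherwise `e` is above some of the fixed points
  have huC' : -u ∉ coneAt C e := by
    intro huC
    have hint : -u ∈ interior (coneAt C e) := by
      have := hpos (-u) huC (neg_ne_zero.2 hu0)
      rwa [map_neg, hDu] at this
    obtain ⟨η, hη, hball⟩ := hK.exists_eventually_closedBall_subset hint
      (hGne.mono fun w hw ↦ sub_ne_zero.2 (Ne.symm hw)) (hGu.neg.congr fun w ↦ by
        rw [← smul_neg, neg_sub, norm_sub_rev])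
    obtain ⟨U, hU, hUll⟩ := hP.exists_nhds_stableLL hη
    obtain ⟨w, hw1, hw2, hw3, hw4, hw5⟩ :=
      (hGne.and (hball.and (Filter.Eventually.and (hGe hU) (hGA.and (hGn htarget))))).exists
    have hw6 := hUll (Φ.symm w) hw3 e (mem_of_mem_nhds hU)
    rw [← hΦ, Φ.right_inv hw5] at hw6
    exact (hAll _ hw4).2 (hw6 (sub_ne_zero.2 (Ne.symm hw1)) hw2)
  -- the rate `2 * (κ + 1) + 1` on the cone gives `κ + 1` on its enlargement, and `κ` after the
  -- error of the linearisation, at most `1`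
  obtain ⟨m, hm, hgrow⟩ := hK.exists_le_norm_pow hpos hDu huC huC' (2 * (κ + 1) + 1)
  obtain ⟨l, hl⟩ := hK.exists_norm_le
  obtain ⟨ε, hε, hεl, hfat⟩ :=
    IsClosedConvexCone.exists_le_norm_of_mem_fatCone (by positivity : 0 ≤ κ + 1) hgrow l
  obtain ⟨V, hV, hVfat⟩ := hP.exists_nhds_sub_mem_fatCone hK hl hε hεl
  obtain ⟨W, hW, hWV, hWc⟩ := H1.2 e V hV
  have hiter : ∀ k : ℕ, (∀ᶠ y in 𝓝 e, g^[k] (Φ y) = Φ (ψ^[k] y)) ∧ ContinuousAt ψ^[k] e ∧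
      ψ^[k] e = e := by
    intro k
    induction k with
    | zero => exact ⟨Eventually.of_forall fun _ ↦ rfl, continuousAt_id, rfl⟩
    | succ k ih =>
      obtain ⟨ih1, ih2, ih3⟩ := ih
      simp only [Function.iterate_succ', Function.comp_apply]
      refine ⟨?_, ContinuousAt.comp (by rwa [ih3]) ih2, by rw [ih3, he]⟩
      have h1 : ∀ᶠ y in 𝓝 e, ψ^[k] y ∈ Φ.source := by
        refine ih2.eventually ?_
        rwa [ih3]
      filter_upwards [ih1, h1] with y hy1 hy2
      rw [hy1]
      change Φ (ψ (Φ.symm (Φ (ψ^[k] y)))) = _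
      rw [Φ.left_inv hy2]
  obtain ⟨B, hB, hBD⟩ := (hD.iterate hge m).approximates_deriv_on_nhds (c := 1)
    (Or.inr zero_lt_one)
  refine ⟨m, hm, {y | y ∈ W ∧ g^[m] (Φ y) = Φ (ψ^[m] y) ∧ Φ y ∈ B},
    inter_mem hW (inter_mem (hiter m).1 ((continuousAt_extChartAt e).preimage_mem_nhds hB)), ?_⟩
  rintro p ⟨hpW, hpm, hpB⟩ q ⟨hqW, hqm, hqB⟩ hpq
  have hmem : Φ q - Φ p ∈ fatCone (coneAt C e) l ε := by
    -- order convexity keeps a conal curve from `p` to `q` near `e`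
    obtain ⟨γ, a, b, hab, hγ, rfl, rfl⟩ := hpq
    refine hVfat γ a b hab.le hγ fun t ht ↦ ?_
    rcases ht.1.eq_or_lt with rfl | hat
    · exact hWV hpW
    rcases ht.2.eq_or_lt with rfl | htb
    · exact hWV hqW
    exact hWV (hWc _ hpW _ hqW ⟨⟨γ, a, t, hat, hγ.mono le_rfl hat.le htb.le, rfl, rfl⟩,
      ⟨γ, t, b, htb, hγ.mono hat.le htb.le le_rfl, rfl, rfl⟩⟩)
  have h1 := hBD _ hqB _ hpB
  rw [hpm, hqm, NNReal.coe_one, one_mul] at h1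
  have h2 := hfat _ hmem
  have h3 := norm_le_norm_add_norm_sub' ((D ^ m) (Φ q - Φ p)) (Φ (ψ^[m] q) - Φ (ψ^[m] p))
  rw [norm_sub_rev _ (Φ (ψ^[m] q) - Φ (ψ^[m] p))] at h3
  linarith

end Expansion

/-! ### Separation of strictly ordered orbits -/

section Separation

variable {n : ℕ} {M : Type*} [TopologicalSpace M] [ChartedSpace (EuclideanSpace ℝ (Fin n)) M]
  [IsManifold (𝓡 n) ∞ M]

/-- Changes of charts are locally Lipschitz. -/
theorem exists_eventually_norm_extChartAt_sub_le {a b e : M} (ha : e ∈ (extChartAt (𝓡 n) a).source)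
    (hb : e ∈ (extChartAt (𝓡 n) b).source) :
    ∃ L : ℝ, 0 ≤ L ∧ ∀ᶠ p : M × M in 𝓝 (e, e),
      ‖extChartAt (𝓡 n) b p.2 - extChartAt (𝓡 n) b p.1‖ ≤
        L * ‖extChartAt (𝓡 n) a p.2 - extChartAt (𝓡 n) a p.1‖ := by
  obtain ⟨-, -, -, D, hD⟩ := isStrictlyDifferentiableIn_id (n := n) ha hb
  obtain ⟨K, s, hs, hK⟩ := hD.exists_lipschitzOnWith
  refine ⟨K, K.2, ?_⟩
  have h1 : ∀ᶠ y in 𝓝 e, y ∈ (extChartAt (𝓡 n) a).source ∧ extChartAt (𝓡 n) a y ∈ s :=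
    Filter.Eventually.and ((isOpen_extChartAt_source a).mem_nhds ha)
      ((continuousAt_extChartAt' ha).preimage_mem_nhds hs)
  rw [nhds_prod_eq]
  filter_upwards [h1.prod_mk h1] with p hp
  have h2 := hK.norm_sub_le hp.2.2 hp.1.2
  simp only [id] at h2
  rwa [(extChartAt (𝓡 n) a).left_inv hp.2.1, (extChartAt (𝓡 n) a).left_inv hp.1.1] at h2

/-- Near a compact set there is a function of two points that is comparable, near each point `e` of
the set, to the distance in the chart at `e`. -/
theorem exists_comparable_dist [RegularSpace M] {K : Set M} (hK : IsCompact K) :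
    ∃ d : M → M → ℝ, ∀ e ∈ K, ∃ L > 0, ∀ᶠ p : M × M in 𝓝 (e, e),
      d p.1 p.2 ≤ L * ‖extChartAt (𝓡 n) e p.2 - extChartAt (𝓡 n) e p.1‖ ∧
      ‖extChartAt (𝓡 n) e p.2 - extChartAt (𝓡 n) e p.1‖ ≤ L * d p.1 p.2 := by
  classical
  have hN : ∀ a : M, ∃ N ∈ 𝓝 a, IsClosed N ∧ N ⊆ (extChartAt (𝓡 n) a).source := fun a ↦ by
    obtain ⟨N, ⟨hN, hNc⟩, hNs⟩ := (closed_nhds_basis a).mem_iff.1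
      (extChartAt_source_mem_nhds (I := 𝓡 n) a)
    exact ⟨N, hN, hNc, hNs⟩
  choose N hN hNc hNs using hN
  obtain ⟨t, -, ht⟩ := hK.elim_nhds_subcover (fun a ↦ interior (N a)) fun a _ ↦
    isOpen_interior.mem_nhds (mem_interior_iff_mem_nhds.2 (hN a))
  -- the sum of the distances in finitely many charts; each term is switched on, on a closed
  -- neighbourhood inside the domain of its chart, by the first point alone
  refine ⟨fun x y ↦ ∑ a ∈ t, (N a).indicator
    (fun x ↦ ‖extChartAt (𝓡 n) a y - extChartAt (𝓡 n) a x‖) x, fun e he ↦ ?_⟩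
  have hupper : ∀ a : M, ∃ L : ℝ, 0 ≤ L ∧ ∀ᶠ p : M × M in 𝓝 (e, e), (N a).indicator
      (fun x ↦ ‖extChartAt (𝓡 n) a p.2 - extChartAt (𝓡 n) a x‖) p.1 ≤
        L * ‖extChartAt (𝓡 n) e p.2 - extChartAt (𝓡 n) e p.1‖ := by
    intro a
    by_cases hea : e ∈ N a
    · obtain ⟨L, hL, h⟩ := exists_eventually_norm_extChartAt_sub_le (mem_extChartAt_source e)
        (hNs a hea)
      refine ⟨L, hL, h.mono fun p hp ↦ ?_⟩
      exact (indicator_le_self' (fun _ _ ↦ norm_nonneg _) _).trans hp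
    · refine ⟨0, le_rfl, ?_⟩
      have h1 : ∀ᶠ p : M × M in 𝓝 (e, e), p.1 ∉ N a :=
        (continuous_fst.tendsto (e, e)).eventually ((hNc a).isOpen_compl.mem_nhds hea)
      filter_upwards [h1] with p hp
      rw [indicator_of_notMem hp, zero_mul]
  choose L hL0 hL using hupper
  obtain ⟨a, hat, hea⟩ := mem_iUnion₂.1 (ht he)
  obtain ⟨L', hL'0, hL'⟩ := exists_eventually_norm_extChartAt_sub_le
    (hNs a (interior_subset hea)) (mem_extChartAt_source e)
  have hsum : 0 ≤ ∑ a ∈ t, L a := Finset.sum_nonneg fun a _ ↦ hL0 a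
  refine ⟨∑ a ∈ t, L a + L' + 1, by positivity, ?_⟩
  have h1 : ∀ᶠ p : M × M in 𝓝 (e, e), p.1 ∈ N a :=
    (continuous_fst.tendsto (e, e)).eventually (mem_interior_iff_mem_nhds.1 hea)
  filter_upwards [(Finset.eventually_all t).2 fun a _ ↦ hL a, hL', h1] with p hp hp' hpa
  constructor
  · refine (Finset.sum_le_sum fun a ha ↦ hp a ha).trans ?_
    rw [← Finset.sum_mul]
    gcongr
    linarith
  · have h2 : ‖extChartAt (𝓡 n) a p.2 - extChartAt (𝓡 n) a p.1‖ ≤ ∑ a ∈ t, (N a).indicator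
        (fun x ↦ ‖extChartAt (𝓡 n) a p.2 - extChartAt (𝓡 n) a x‖) p.1 := by
      refine le_trans ?_ (Finset.single_le_sum (f := fun a ↦ (N a).indicator
        (fun x ↦ ‖extChartAt (𝓡 n) a p.2 - extChartAt (𝓡 n) a x‖) p.1)
        (fun b _ ↦ indicator_nonneg (fun _ _ ↦ norm_nonneg _) _) hat)
      rw [indicator_of_mem hpa]
    refine hp'.trans (mul_le_mul ?_ h2 (norm_nonneg _) (by positivity))
    linarith

/-- Two strictly ordered orbits, the lower one nonconvergent, have distinct synchronous limits.
Otherwise the lower limit set would be a perfect set of unordered equilibria, near which the flow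
expands the distance of ordered points; so the two orbits could not approach each other. -/
theorem exists_ne_of_stableLL [RegularSpace M] [T2Space M]
    [RiemannianBundle (fun x : M ↦ TangentSpace (𝓡 n) x)]
    {C : ∀ x : M, Set (TangentSpace (𝓡 n) x)} (hsolid : IsSolidConeField C)
    {f : ∀ x : M, TangentSpace (𝓡 n) x}
    (hf : ContMDiff (𝓡 n) (𝓡 n).tangent ∞ (fun x ↦ (⟨x, f x⟩ : TangentBundle (𝓡 n) M)))
    {φ : ℝ → M → M} (hφ : IsForwardFlow f φ)
    (hSDP : IsStronglyDifferentiallyPositive C φ) (H1 : IsGloballyOrderable C)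
    (H3 : IsGammaInvariant C) (h : IsStronglyMonotoneFlow (StableLL C) (ConalLE C) φ) {x y : M}
    (hxy : StableLL C x y) (hx : x ∉ convergentPoints φ) :
    ∃ (F : Ultrafilter ℝ) (a b : M), (F : Filter ℝ) ≤ atTop ∧ Tendsto (fun t ↦ φ t x) F (𝓝 a) ∧
      Tendsto (fun t ↦ φ t y) F (𝓝 b) ∧ a ≠ b := by
  by_contra! hsync
  have hiter : ∀ (m : ℕ) (z : M), (φ 1)^[m] z = φ m z := by
    intro m z
    induction m with
    | zero => rw [Function.iterate_zero_apply, Nat.cast_zero, h.map_zero]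
    | succ m ih =>
      rw [Function.iterate_succ_apply', ih, ← h.map_add 1 m zero_le_one m.cast_nonneg]
      push_cast
      rw [add_comm]
  have hequil : ∀ e ∈ omegaLimit atTop φ {x}, IsEquilibrium φ e := by
    intro e he
    obtain ⟨F, hF, hFe⟩ := mem_omegaLimit_iff_ultrafilter.1 he
    obtain ⟨b, hb⟩ := h.exists_tendsto F (s := id) (hF (eventually_ge_atTop 0)) y
    have hb' : Tendsto (fun t ↦ φ t y) F (𝓝 b) := hb
    obtain rfl := hsync F e b hF hFe hb'
    exact h.isEquilibrium_of_tendsto_of_tendsto hxy hF hFe hb'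
  obtain ⟨d, hd'⟩ := exists_comparable_dist (n := n) (h.isCompact_omegaLimit x)
  have hlocal : ∀ e ∈ omegaLimit atTop φ {x}, ∃ m : ℕ, ∀ᶠ p : M × M in 𝓝 (e, e),
      (ConalLE C p.1 p.2 → 2 * d p.1 p.2 ≤ d (φ m p.1) (φ m p.2)) ∧
      (p.1 ≠ p.2 → 0 < d p.1 p.2) ∧ d p.1 p.2 ≤ 1 := by
    intro e he
    obtain ⟨L, hL, hLd⟩ := hd' e he
    have h1e : φ 1 e = e := hequil e he 1 zero_le_one
    obtain ⟨D, hD, hDpos⟩ : ∃ D : EuclideanSpace ℝ (Fin n) →L[ℝ] EuclideanSpace ℝ (Fin n),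
        HasStrictFDerivAt (fun w ↦ extChartAt (𝓡 n) (φ 1 e) (φ 1 ((extChartAt (𝓡 n) e).symm w))) D
          (extChartAt (𝓡 n) e e) ∧
        ∀ w ∈ coneAt C e, w ≠ 0 → D w ∈ interior (coneAt C (φ 1 e)) :=
      ⟨_, hφ.hasStrictFDerivAt hf zero_le_one e, fun w hw hw0 ↦ hSDP e 1 one_pos w hw hw0⟩
    rw [h1e] at hD hDpos
    -- the factor `2 L²` absorbs two comparisons, each with constant `L`, between `d` and the
    -- distance in the chart
    obtain ⟨m, -, U, hU, hexp⟩ := hsolid.exists_nhds_expanding H1 H3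
      (hφ.continuous hf zero_le_one).continuousAt h1e hD hDpos
      (h.frequently_mem_omegaLimit hx he) (fun z hz ↦ hequil z hz 1 zero_le_one)
      (fun z hz ↦ ⟨fun hez ↦ h.ll_irrefl z (by
          rwa [h.eq_of_mem_omegaLimit_of_le he hz (h.le_of_ll hez)] at hez),
        fun hze ↦ h.ll_irrefl e (by
          rwa [h.eq_of_mem_omegaLimit_of_le hz he (h.le_of_ll hze)] at hze)⟩)
      (show 0 ≤ 2 * L ^ 2 by positivity)
    simp only [hiter] at hexp
    have hmc : Tendsto (fun p : M × M ↦ (φ m p.1, φ m p.2)) (𝓝 (e, e)) (𝓝 (e, e)) := by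
      have h2 : Tendsto (φ m) (𝓝 e) (𝓝 e) := by
        have := h.tendsto_map_const (s := m) m.cast_nonneg (tendsto_id (x := 𝓝 e))
        rwa [hequil e he m m.cast_nonneg] at this
      rw [nhds_prod_eq]
      exact h2.prodMap h2
    have hsm : ∀ᶠ p : M × M in 𝓝 (e, e),
        ‖extChartAt (𝓡 n) e p.2 - extChartAt (𝓡 n) e p.1‖ < 1 / L := by
      have h2 : ContinuousAt (fun p : M × M ↦
          ‖extChartAt (𝓡 n) e p.2 - extChartAt (𝓡 n) e p.1‖) (e, e) := by
        have h3 := continuousAt_extChartAt (I := 𝓡 n) e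
        exact ((h3.comp (x := (e, e)) (f := Prod.snd) continuousAt_snd).sub
          (h3.comp (x := (e, e)) (f := Prod.fst) continuousAt_fst)).norm
      refine h2.eventually (Iio_mem_nhds ?_)
      simp only [sub_self, norm_zero]
      positivity
    refine ⟨m, ?_⟩
    have hUU : ∀ᶠ p : M × M in 𝓝 (e, e), (p.1 ∈ U ∧ p.1 ∈ (extChartAt (𝓡 n) e).source) ∧
        p.2 ∈ U ∧ p.2 ∈ (extChartAt (𝓡 n) e).source := by
      rw [nhds_prod_eq]
      have : ∀ᶠ z in 𝓝 e, z ∈ U ∧ z ∈ (extChartAt (𝓡 n) e).source :=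
        inter_mem hU (extChartAt_source_mem_nhds e)
      exact this.prod_mk this
    filter_upwards [hLd, hmc.eventually hLd, hUU, hsm] with p hp hpm hpU hps
    refine ⟨fun hle ↦ ?_, fun hne ↦ ?_, ?_⟩
    · have h2 := hexp _ hpU.1.1 _ hpU.2.1 hle
      have h3 := hpm.2
      refine le_of_mul_le_mul_left ?_ hL
      calc L * (2 * d p.1 p.2)
          ≤ L * (2 * (L * ‖extChartAt (𝓡 n) e p.2 - extChartAt (𝓡 n) e p.1‖)) := by
            gcongr; exact hp.1
        _ = 2 * L ^ 2 * ‖extChartAt (𝓡 n) e p.2 - extChartAt (𝓡 n) e p.1‖ := by ring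
        _ ≤ _ := h2.trans h3
    · have h2 : 0 < ‖extChartAt (𝓡 n) e p.2 - extChartAt (𝓡 n) e p.1‖ :=
        norm_pos_iff.2 (sub_ne_zero.2 fun heq ↦
          hne ((extChartAt (𝓡 n) e).injOn hpU.1.2 hpU.2.2 heq.symm))
      exact pos_of_mul_pos_right (h2.trans_le hp.2) hL.le
    · refine hp.1.trans ?_
      rw [lt_div_iff₀' hL] at hps
      exact hps.le
  have hev : ∀ᶠ t in atTop, ∃ m : ℕ, 2 * d (φ t x) (φ t y) ≤ d (φ (m + t) x) (φ (m + t) y) ∧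
      0 < d (φ t x) (φ t y) ∧ d (φ t x) (φ t y) ≤ 1 := by
    by_contra hnot
    have : (atTop ⊓ 𝓟 {t | ¬ ∃ m : ℕ, 2 * d (φ t x) (φ t y) ≤ d (φ (m + t) x) (φ (m + t) y) ∧
      0 < d (φ t x) (φ t y) ∧ d (φ t x) (φ t y) ≤ 1}).NeBot :=
      frequently_mem_iff_neBot.1 (not_eventually.1 hnot)
    obtain ⟨F, hF⟩ := Ultrafilter.exists_le (atTop ⊓ 𝓟 {t | ¬ ∃ m : ℕ,
      2 * d (φ t x) (φ t y) ≤ d (φ (m + t) x) (φ (m + t) y) ∧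
      0 < d (φ t x) (φ t y) ∧ d (φ t x) (φ t y) ≤ 1})
    have hF1 : (F : Filter ℝ) ≤ atTop := hF.trans inf_le_left
    obtain ⟨a, ha⟩ := h.exists_tendsto F (s := id) (hF1 (eventually_ge_atTop 0)) x
    obtain ⟨b, hb⟩ := h.exists_tendsto F (s := id) (hF1 (eventually_ge_atTop 0)) y
    have ha' : Tendsto (fun t ↦ φ t x) F (𝓝 a) := ha
    have hb' : Tendsto (fun t ↦ φ t y) F (𝓝 b) := hb
    obtain rfl := hsync F a b hF1 ha' hb'
    obtain ⟨m, hm⟩ := hlocal a (mem_omegaLimit_iff_ultrafilter.2 ⟨F, hF1, ha'⟩)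
    have h1 := (ha'.prodMk_nhds hb').eventually hm
    have h2 : ∀ᶠ t in (F : Filter ℝ), ¬ ∃ m : ℕ,
        2 * d (φ t x) (φ t y) ≤ d (φ (m + t) x) (φ (m + t) y) ∧
        0 < d (φ t x) (φ t y) ∧ d (φ t x) (φ t y) ≤ 1 :=
      hF.trans inf_le_right (mem_principal_self _)
    obtain ⟨t, ht1, ht2, ht0⟩ := (h1.and (h2.and (hF1 (eventually_ge_atTop 0)))).exists
    have hll := h.ll_map hxy ht0
    refine ht2 ⟨m, ?_, ht1.2.1 fun heq ↦ ?_, ht1.2.2⟩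
    · rw [h.map_add m t m.cast_nonneg ht0, h.map_add m t m.cast_nonneg ht0]
      exact ht1.1 (h.le_of_ll hll)
    · change φ t x = φ t y at heq
      rw [heq] at hll
      exact h.ll_irrefl _ hll
  -- the distance between the orbits doubles again and again, yet it remains bounded by `1`
  obtain ⟨t₀, ht₀⟩ := eventually_atTop.1 hev
  have hgrow : ∀ k : ℕ, ∃ t ≥ t₀, 2 ^ k * d (φ t₀ x) (φ t₀ y) ≤ d (φ t x) (φ t y) := by
    intro k
    induction k with
    | zero => exact ⟨t₀, le_rfl, by simp⟩
    | succ k ih =>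
      obtain ⟨t, ht, hk⟩ := ih
      obtain ⟨m, hm, -⟩ := ht₀ t ht
      refine ⟨m + t, ht.trans (le_add_of_nonneg_left m.cast_nonneg), le_trans ?_ hm⟩
      rw [pow_succ]
      linarith
  obtain ⟨-, -, hpos, -⟩ := ht₀ t₀ le_rfl
  obtain ⟨k, hk⟩ := pow_unbounded_of_one_lt (d (φ t₀ x) (φ t₀ y))⁻¹ one_lt_two
  obtain ⟨t, ht, hkt⟩ := hgrow k
  obtain ⟨-, -, -, hle⟩ := ht₀ t ht
  have := (inv_lt_iff_one_lt_mul₀ hpos).1 hk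
  linarith

end Separation

/-! ### The measure of the set of nonconvergent points -/

/-- The set of nonconvergent points of a strongly monotone flow is a Borel set: an orbit does not
converge if and only if it visits infinitely often two basic open sets with disjoint closures. -/
theorem IsStronglyMonotoneFlow.measurableSet_compl_convergentPoints {X : Type*} [TopologicalSpace X]
    [T25Space X] [SecondCountableTopology X] [MeasurableSpace X] [BorelSpace X]
    {ll le : X → X → Prop} {φ : ℝ → X → X} (h : IsStronglyMonotoneFlow ll le φ) :
    MeasurableSet (convergentPoints φ)ᶜ := by
  set 𝓑 := TopologicalSpace.countableBasis X
  have h𝓑 := TopologicalSpace.isBasis_countableBasis X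
  have hmeas : ∀ U : Set X, IsOpen U → MeasurableSet {x | ∃ᶠ t in atTop, φ t x ∈ U} := by
    intro U hU
    have h1 : {x | ∃ᶠ t in atTop, φ t x ∈ U} =
        ⋂ N : ℕ, ⋃ t : ℝ, ⋃ _ : (N : ℝ) ≤ t, φ t ⁻¹' U := by
      ext x
      simp only [mem_ofPred_eq, mem_iInter, mem_iUnion, mem_preimage, exists_prop, frequently_atTop]
      refine ⟨fun hx N ↦ hx N, fun hx a ↦ ?_⟩
      obtain ⟨N, hN⟩ := exists_nat_ge a
      obtain ⟨t, ht, htU⟩ := hx N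
      exact ⟨t, hN.trans ht, htU⟩
    rw [h1]
    refine MeasurableSet.iInter fun N ↦
      (isOpen_iUnion fun t ↦ isOpen_iUnion fun ht ↦ ?_).measurableSet
    have hc : Continuous (φ t) := continuous_iff_continuousAt.2 fun x ↦
      h.tendsto_map_const (N.cast_nonneg.trans ht) tendsto_id
    exact hU.preimage hc
  have heq : (convergentPoints φ)ᶜ = ⋃ U ∈ 𝓑, ⋃ V ∈ 𝓑, ⋃ _ : Disjoint (closure U) (closure V),
      {x | ∃ᶠ t in atTop, φ t x ∈ U} ∩ {x | ∃ᶠ t in atTop, φ t x ∈ V} := by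
    ext x
    simp only [mem_compl_iff, mem_iUnion, exists_prop, mem_inter_iff, mem_ofPred_eq]
    constructor
    · intro hx
      obtain ⟨p, hp⟩ := h.nonempty_omegaLimit x
      obtain ⟨q, hq, hqp⟩ := h.exists_ne_of_notMem_convergentPoints hx p
      obtain ⟨U, hqU, hU, V, hpV, hV, hUV⟩ := exists_open_nhds_disjoint_closure hqp
      obtain ⟨U', hU'𝓑, hqU', hU'U⟩ := h𝓑.exists_subset_of_mem_open hqU hU
      obtain ⟨V', hV'𝓑, hpV', hV'V⟩ := h𝓑.exists_subset_of_mem_open hpV hV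
      exact ⟨U', hU'𝓑, V', hV'𝓑, hUV.mono (closure_mono hU'U) (closure_mono hV'V),
        frequently_mem_of_mem_omegaLimit hq ((h𝓑.isOpen hU'𝓑).mem_nhds hqU'),
        frequently_mem_of_mem_omegaLimit hp ((h𝓑.isOpen hV'𝓑).mem_nhds hpV')⟩
    · rintro ⟨U, -, V, -, hUV, hxU, hxV⟩ ⟨e, -, he⟩
      obtain ⟨p, hp, hpU⟩ := h.exists_mem_omegaLimit_of_frequently isClosed_closure
        (hxU.mono fun t ht ↦ subset_closure ht)
      obtain ⟨q, hq, hqV⟩ := h.exists_mem_omegaLimit_of_frequently isClosed_closure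
        (hxV.mono fun t ht ↦ subset_closure ht)
      rw [he] at hp hq
      rw [mem_singleton_iff.1 hp] at hpU
      rw [mem_singleton_iff.1 hq] at hqV
      exact hUV.notMem_of_mem_left hpU hqV
  rw [heq]
  have hcount := TopologicalSpace.countable_countableBasis X
  exact MeasurableSet.biUnion hcount fun U hU ↦ MeasurableSet.biUnion hcount fun V hV ↦
    MeasurableSet.iUnion fun _ ↦ (hmeas U (h𝓑.isOpen hU)).inter (hmeas V (h𝓑.isOpen hV))

/-- A Borel set that meets all the lines in one direction in null sets is null. -/
theorem measure_eq_zero_of_forall_line {E : Type*} [NormedAddCommGroup E] [NormedSpace ℝ E]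
    [FiniteDimensional ℝ E] [MeasurableSpace E] [BorelSpace E] (μ : Measure E) [μ.IsAddHaarMeasure]
    {A : Set E} (hA : MeasurableSet A) (v : E) (h : ∀ w, volume {s : ℝ | w + s • v ∈ A} = 0) :
    μ A = 0 := by
  have : ProperSpace E := FiniteDimensional.proper ℝ E
  have h1 := ae_mem_of_ae_add_linearMap_mem (LinearMap.toSpanSingleton ℝ E v) volume μ hA.compl
    fun w ↦ by
      rw [ae_iff]
      simpa using h w
  rw [ae_iff] at h1
  simpa using h1

section MeasureZero

variable {n : ℕ} {M : Type*} [TopologicalSpace M] [ChartedSpace (EuclideanSpace ℝ (Fin n)) M]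

/-- A set that is locally null in the preferred charts has measure zero. -/
theorem hasMeasureZero_of_forall_exists_nhds [IsManifold (𝓡 n) ∞ M]
    [SecondCountableTopology M] {A : Set M}
    (hA : ∀ e : M, ∃ U ∈ 𝓝 e, U ⊆ (extChartAt (𝓡 n) e).source ∧
      (volume : Measure (EuclideanSpace ℝ (Fin n))) (extChartAt (𝓡 n) e '' (A ∩ U)) = 0) :
    HasMeasureZero n A := by
  intro Φ hΦ
  choose U hU hUs hUA using hA
  obtain ⟨s, hs, hcover⟩ := TopologicalSpace.countable_cover_nhds hU
  have hsub : Φ '' (A ∩ Φ.source) ⊆ ⋃ e ∈ s, Φ '' (A ∩ U e ∩ Φ.source) := by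
    rintro _ ⟨y, ⟨hyA, hyΦ⟩, rfl⟩
    obtain ⟨e, he, hye⟩ := mem_iUnion₂.1 (hcover.ge (mem_univ y))
    exact mem_iUnion₂.2 ⟨e, he, mem_image_of_mem _ ⟨⟨hyA, hye⟩, hyΦ⟩⟩
  refine measure_mono_null hsub ((measure_biUnion_null_iff hs).2 fun e _ ↦ ?_)
  set Ψ := extChartAt (𝓡 n) e with hΨ
  have himage : Φ '' (A ∩ U e ∩ Φ.source) =
      (fun w ↦ Φ (Ψ.symm w)) '' (Ψ '' (A ∩ U e ∩ Φ.source)) := by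
    rw [image_image]
    refine image_congr fun y hy ↦ ?_
    rw [Ψ.left_inv (hUs e hy.1.2)]
  rw [himage]
  refine addHaar_image_eq_zero_of_differentiableOn_of_addHaar_eq_zero _ ?_
    (measure_mono_null (image_mono inter_subset_left) (hUA e))
  have h1 : ContMDiffOn (𝓡 n) (𝓡 n) ∞ (fun w ↦ Φ (Ψ.symm w)) (Ψ '' (A ∩ U e ∩ Φ.source)) := by
    refine (contMDiffOn_of_mem_maximalAtlas hΦ).comp
      ((contMDiffOn_extChartAt_symm (I := 𝓡 n) e).mono ?_) ?_
    · rintro _ ⟨y, hy, rfl⟩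
      exact Ψ.map_source (hUs e hy.1.2)
    · rintro _ ⟨y, hy, rfl⟩
      rw [mem_preimage, Ψ.left_inv (hUs e hy.1.2)]
      exact hy.2
  exact (contMDiffOn_iff_contDiffOn.1 h1).differentiableOn (by simp)

/-- Lines in a direction interior to the cone are chains for the strict order, and they meet the set
of nonconvergent points in countable sets; hence this set has measure zero. -/
theorem IsSolidConeField.hasMeasureZero [IsManifold (𝓡 n) ∞ M] [SecondCountableTopology M]
    [T25Space M]
    [RiemannianBundle (fun x : M ↦ TangentSpace (𝓡 n) x)]
    {C : ∀ x : M, Set (TangentSpace (𝓡 n) x)} (hsolid : IsSolidConeField C)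
    (H3 : IsGammaInvariant C) [Nontrivial (EuclideanSpace ℝ (Fin n))] {φ : ℝ → M → M}
    (h : IsStronglyMonotoneFlow (StableLL C) (ConalLE C) φ)
    (hsep : ∀ x y, StableLL C x y → x ∉ convergentPoints φ →
      ∃ (F : Ultrafilter ℝ) (a b : M), (F : Filter ℝ) ≤ atTop ∧ Tendsto (fun t ↦ φ t x) F (𝓝 a) ∧
        Tendsto (fun t ↦ φ t y) F (𝓝 b) ∧ a ≠ b) :
    HasMeasureZero n (convergentPoints φ)ᶜ := by
  let _ : MeasurableSpace M := borel M
  have : BorelSpace M := ⟨rfl⟩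
  refine hasMeasureZero_of_forall_exists_nhds fun e ↦ ?_
  have hK := hsolid.isClosedConvexCone_coneAt e
  obtain ⟨v, hv⟩ := hsolid.nonempty_interior e
  have hv0 : v ≠ 0 := fun h0 ↦ hK.zero_notMem_interior (h0 ▸ hv)
  obtain ⟨r, hr, hball⟩ := Metric.nhds_basis_closedBall.mem_iff.1 (mem_interior_iff_mem_nhds.1 hv)
  have hvn : 0 < ‖v‖ := norm_pos_iff.2 hv0
  obtain ⟨P, hP⟩ := exists_isConeTransport H3 e
  obtain ⟨V, hV, hVll⟩ := hP.exists_nhds_stableLL (div_pos hr hvn)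
  set Φ := extChartAt (𝓡 n) e with hΦ
  have hsymm : ContinuousAt Φ.symm (Φ e) := continuousAt_extChartAt_symm e
  have hV' : Φ.symm ⁻¹' V ∈ 𝓝 (Φ e) := by
    refine hsymm.preimage_mem_nhds ?_
    rwa [hΦ, extChartAt_to_inv]
  obtain ⟨R, hR, hRsub⟩ := Metric.mem_nhds_iff.1 (inter_mem hV' (extChartAt_target_mem_nhds e))
  set B := Metric.ball (Φ e) R
  refine ⟨Φ.source ∩ Φ ⁻¹' B, inter_mem (extChartAt_source_mem_nhds e)
    ((continuousAt_extChartAt e).preimage_mem_nhds (Metric.ball_mem_nhds _ hR)),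
    inter_subset_left, ?_⟩
  set A := B ∩ Φ.symm ⁻¹' (convergentPoints φ)ᶜ with hA
  have hsub : Φ '' ((convergentPoints φ)ᶜ ∩ (Φ.source ∩ Φ ⁻¹' B)) ⊆ A := by
    rintro _ ⟨y, ⟨hy, hys, hyB⟩, rfl⟩
    refine ⟨hyB, ?_⟩
    rwa [mem_preimage, Φ.left_inv hys]
  have hAm : MeasurableSet A := by
    have h1 : ContinuousOn Φ.symm B :=
      (continuousOn_extChartAt_symm e).mono fun w hw ↦ (hRsub hw).2
    have h2 := (continuousOn_iff_continuous_domRestrict.1 h1).measurable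
      h.measurableSet_compl_convergentPoints
    have h3 := Metric.isOpen_ball.measurableSet.subtype_image h2
    convert h3 using 1
    ext w
    constructor
    · rintro ⟨hw, hwC⟩
      exact ⟨⟨w, hw⟩, hwC, rfl⟩
    · rintro ⟨⟨w, hw⟩, hwC, rfl⟩
      exact ⟨hw, hwC⟩
  -- along a line in the direction `v` the points are ordered by their parameter
  refine measure_mono_null hsub (measure_eq_zero_of_forall_line _ hAm v fun w ↦ ?_)
  refine (h.countable_of_forall_ll hsep (c := fun s ↦ Φ.symm (w + s • v)) (fun s hs ↦ hs.2)
    fun s hs t ht hst ↦ ?_).measure_zero volume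
  have hs' := hRsub hs.1
  have ht' := hRsub ht.1
  have hdiff : Φ (Φ.symm (w + t • v)) - Φ (Φ.symm (w + s • v)) = (t - s) • v := by
    rw [Φ.right_inv hs'.2, Φ.right_inv ht'.2, sub_smul]
    abel
  have hts : 0 < t - s := sub_pos.2 hst
  refine hVll _ hs'.1 _ ht'.1 ?_ ?_
  · rw [hdiff]
    exact smul_ne_zero hts.ne' hv0
  · rw [hdiff]
    intro u hu
    have h1 : (t - s)⁻¹ • u ∈ coneAt C e := by
      refine hball ?_
      rw [Metric.mem_closedBall, dist_eq_norm] at hu ⊢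
      have h2 : (t - s)⁻¹ • u - v = (t - s)⁻¹ • (u - (t - s) • v) := by
        rw [smul_sub, inv_smul_smul₀ hts.ne']
      rw [h2, norm_smul, norm_inv, Real.norm_of_nonneg hts.le, inv_mul_le_iff₀ hts]
      refine hu.trans (le_of_eq ?_)
      rw [norm_smul, Real.norm_of_nonneg hts.le]
      field_simp
    have h2 := hK.smul_mem (t - s) hts.le _ h1
    rwa [smul_inv_smul₀ hts.ne'] at h2

/-- On a zero-dimensional manifold all points are equilibria. -/
theorem hasMeasureZero_of_subsingleton [T2Space M] [Subsingleton (EuclideanSpace ℝ (Fin n))]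
    {f : ∀ x : M, TangentSpace (𝓡 n) x} {φ : ℝ → M → M} (hφ : IsForwardFlow f φ) :
    HasMeasureZero n (convergentPoints φ)ᶜ := by
  have : DiscreteTopology M := ChartedSpace.discreteTopology (EuclideanSpace ℝ (Fin n)) M
  have hconst : ∀ x t, 0 ≤ t → φ t x = x := fun x t ht ↦ by
    rw [isPreconnected_Ici.constant (hφ x).2.continuousOn (x := t) (y := 0) ht self_mem_Ici,
      (hφ x).1]
  have huniv : (convergentPoints φ)ᶜ = ∅ := by
    refine compl_empty_iff.2 (eq_univ_of_forall fun x ↦ ⟨x, hconst x, ?_⟩)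
    have h1 : Tendsto (fun t ↦ φ t x) atTop (𝓝 x) := by
      refine tendsto_const_nhds.congr' ?_
      filter_upwards [eventually_ge_atTop 0] with t ht using (hconst x t ht).symm
    ext p
    rw [mem_omegaLimit_iff_ultrafilter, mem_singleton_iff]
    constructor
    · rintro ⟨F, hF, hFp⟩
      exact tendsto_nhds_unique hFp (h1.mono_left hF)
    · rintro rfl
      obtain ⟨F, hF⟩ := Ultrafilter.exists_le (atTop : Filter ℝ)
      exact ⟨F, hF, h1.mono_left hF⟩
  intro Φ _
  rw [huniv, empty_inter, image_empty, measure_empty]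

end MeasureZero

end ConalFlow

theorem theoremA {n : ℕ} {M : Type*} [EMetricSpace M] [SecondCountableTopology M]
    [ChartedSpace (EuclideanSpace ℝ (Fin n)) M] [IsManifold (𝓡 n) ∞ M]
    [RiemannianBundle (fun x : M ↦ TangentSpace (𝓡 n) x)]
    [IsContMDiffRiemannianBundle (𝓡 n) ∞ (EuclideanSpace ℝ (Fin n))
      (fun x : M ↦ TangentSpace (𝓡 n) x)]
    [IsRiemannianManifold (𝓡 n) M] [CompleteSpace M]
    (C : ∀ x : M, Set (TangentSpace (𝓡 n) x))
    (hsolid : ConalFlow.IsSolidConeField C)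
    (hcont : ConalFlow.IsContinuousConeField C)
    (f : ∀ x : M, TangentSpace (𝓡 n) x)
    (hf : ContMDiff (𝓡 n) (𝓡 n).tangent ∞ (fun x ↦ (⟨x, f x⟩ : TangentBundle (𝓡 n) M)))
    (φ : ℝ → M → M)
    (hφ : ConalFlow.IsForwardFlow f φ)
    (hcompact : ∀ x, IsCompact (closure ((fun t ↦ φ t x) '' Ici 0)))
    (hSDP : ConalFlow.IsStronglyDifferentiallyPositive C φ)
    (H1 : ConalFlow.IsGloballyOrderable C)
    (H2 : ConalFlow.IsQuasiClosed C)
    (H3 : ConalFlow.IsGammaInvariant C) :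
    ConalFlow.HasMeasureZero n (ConalFlow.convergentPoints φ)ᶜ := by
  rcases subsingleton_or_nontrivial (EuclideanSpace ℝ (Fin n)) with hE | hE
  · exact ConalFlow.hasMeasureZero_of_subsingleton hφ
  · have h := hφ.isStronglyMonotoneFlow hsolid hf hcompact hSDP H1.1 H2 H3
    exact hsolid.hasMeasureZero H3 h fun x y hxy hx ↦
      ConalFlow.exists_ne_of_stableLL hsolid hf hφ hSDP H1 H3 h hxy hx
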